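/- Let $\varrho,a^1,a^2\in C^\infty(\mathbb R^4)$ be arbitrary and let $P=P(\varrho,a^1,a^2)=\tfrac12\sum_{i,j}P^{ij}\,\partial_i\wedge\partial_j$ be the Nambu--Poisson bi-vector field of the bracket $\{f,g\}=\varrho\cdot\det(\nabla f,\nabla g,\nabla a^1,\nabla a^2)$, so $P^{ij}=\{x_i,x_j\}$. The tetrahedral flow is the bi-vector field $Q^{\gamma_3}(P)=\tfrac12\sum_{i,j} Q^{ij}\,\partial_i\wedge\partial_j$ with $Q^{ij}=-8\bigl(T_1^{ij}+3\,(T_2^{ij}-T_2^{ji})\bigr)$, where, summing over repeated indices, $$T_1^{ij}=\partial_k\partial_l\partial_m P^{ij}\;\partial_{l'}P^{kk'}\;\partial_{m'}P^{ll'}\;\partial_{k'}P^{mm'},\qquad T_2^{ij}=\partial_k\partial_l P^{in}\;\partial_{k'}\partial_{l'}P^{kj}\;\partial_{m'}P^{k'l}\;\partial_nP^{m'l'}.$$ (This is the image of the tetrahedron $\gamma_3$, with edges in the order $12,13,14,23,24,34$, under Kontsevich's orientation morphism: $\Delta_{12}\Delta_{13}\Delta_{14}\Delta_{23}\Delta_{24}\Delta_{34}(P\otimes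 P\otimes P\otimes P)$ multiplied out, where $P=\tfrac12\sum P^{ij}\xi_i\xi_j$ and $\Delta_{uv}=\sum_i\bigl(\partial_{\xi_i}^{(u)}\partial_{x_i}^{(v)}+\partial_{x_i}^{(u)}\partial_{\xi_i}^{(v)}\bigr)$.) For a vector field $X$, $[\![P,X]\!]=-L_XP$ is the Schouten bracket. A micro-graph $\Gamma=(t_{11},t_{12},t_{13},t_{14}\,;\,t_{21},\dots,t_{24}\,;\,t_{31},\dots,t_{34})$ has a sink $0$, vertices $1,2,3$ containing $\varrho$, vertices $4,5,6$ containing $a^1$, vertices $7,8,9$ containing $a^2$, and for $v=1,2,3$ four ordered edges from $v$ to $t_{v1},\dots,t_{v4}$, exactly one of the twelve edges going to $0$. Its formula $\phi(\Gamma)$ is the vector field obtained as follows: give each edge $(v,e)$ an index $i_{ve}\in\{1,2,3,4\}$; differentiate the content of each vertex $1,\dots,9$ by $\partial_{i}$ for all indices $i$ on its incoming edges; multiply the results, $\prod_{v=1}^3\varepsilon^{i_{v1}i_{v2}i_{v3}i_{v4}}$ and $\partial_{i}$ for the index $i$ on the edge into the sink; sum over all indices. Let $\overline\Gamma$ be $\Gamma$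 with targets exchanged by $4\leftrightarrow7$, $5\leftrightarrow8$, $6\leftrightarrow9$. The skew pair of $\Gamma$ is $S(\Gamma)=\tfrac12\bigl(\phi(\Gamma)-\phi(\overline\Gamma)\bigr)$. The 4D-descendants of the 2D sunflower are the 324 micro-graphs $(0,1,4,7\,;\,i_1,j,5,8\,;\,i_2,k,6,9)$ and $(0,k_1,4,7\,;\,i_1,j,5,8\,;\,i_2,k_2,6,9)$ with $i_1,i_2\in\{1,4,7\}$, $j\in\{3,6,9\}$, $k,k_1,k_2\in\{2,5,8\}$. Let $V$ be the real vector space spanned by their skew pairs, regarded as functions of the smooth triple $(\varrho,a^1,a^2)$ with values in vector fields on $\mathbb R^4$. Let $X=\sum_\Gamma c_\Gamma\,S(\Gamma)$ be the sum over the following 27 terms $c_\Gamma:\Gamma$: $-8:(0,1,4,7\,;\,1,3,5,8\,;\,1,2,6,9)$, $-48:(0,1,4,7\,;\,1,6,5,8\,;\,4,2,6,9)$, $-16:(0,1,4,7\,;\,4,3,5,8\,;\,4,2,6,9)$, $-48:(0,1,4,7\,;\,4,6,5,8\,;\,4,2,6,9)$, $-48:(0,1,4,7\,;\,4,9,5,8\,;\,4,2,6,9)$,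 $-16:(0,1,4,7\,;\,4,3,5,8\,;\,7,2,6,9)$, $-48:(0,1,4,7\,;\,4,6,5,8\,;\,7,2,6,9)$, $12:(0,1,4,7\,;\,1,6,5,8\,;\,1,5,6,9)$, $-24:(0,1,4,7\,;\,4,6,5,8\,;\,4,5,6,9)$, $24:(0,1,4,7\,;\,4,9,5,8\,;\,7,5,6,9)$, $-24:(0,1,4,7\,;\,7,6,5,8\,;\,7,5,6,9)$, $-16:(0,2,4,7\,;\,1,3,5,8\,;\,1,2,6,9)$, $-32:(0,2,4,7\,;\,1,3,5,8\,;\,1,5,6,9)$, $-12:(0,2,4,7\,;\,1,6,5,8\,;\,1,5,6,9)$, $48:(0,2,4,7\,;\,1,9,5,8\,;\,4,5,6,9)$, $-48:(0,2,4,7\,;\,1,9,5,8\,;\,7,5,6,9)$, $-32:(0,2,4,7\,;\,4,3,5,8\,;\,1,5,6,9)$, $-32:(0,2,4,7\,;\,7,3,5,8\,;\,1,5,6,9)$, $-48:(0,5,4,7\,;\,1,3,5,8\,;\,1,2,6,9)$, $-48:(0,5,4,7\,;\,1,9,5,8\,;\,1,2,6,9)$, $-96:(0,5,4,7\,;\,1,9,5,8\,;\,4,2,6,9)$,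 $-48:(0,5,4,7\,;\,4,9,5,8\,;\,4,2,6,9)$, $-48:(0,5,4,7\,;\,7,9,5,8\,;\,4,2,6,9)$, $-48:(0,5,4,7\,;\,7,9,5,8\,;\,7,2,6,9)$, $24:(0,5,4,7\,;\,1,6,5,8\,;\,1,5,6,9)$, $48:(0,5,4,7\,;\,4,6,5,8\,;\,7,5,6,9)$, $48:(0,5,4,7\,;\,4,9,5,8\,;\,7,5,6,9)$. Then: (1) $X$ is a smooth vector field and $Q^{\gamma_3}(P)=[\![P,X]\!]$ for all $\varrho,a^1,a^2\in C^\infty(\mathbb R^4)$; thus $Q^{\gamma_3}(P)$ is a Poisson 2-coboundary. (2) All 27 graphs $\Gamma$ are 4D-descendants of the 2D sunflower. (3) The set of $Y\in V$ with $Q^{\gamma_3}(P)=[\![P,Y]\!]$ for all $\varrho,a^1,a^2$ is the affine space $X+K$, where $K=\{Y\in V:\ [\![P,Y]\!]=0\text{ for all }\varrho,a^1,a^2\}$ is a vector space of dimension $7$. -/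

import Mathlib

open scoped ContDiff

noncomputable section

namespace NambuFlow

/-- Points of `ℝ⁴`; only partial derivatives are used below. -/
abbrev Pt : Type := Fin 4 → ℝ

/-- Smooth real functions on `ℝ⁴`. -/
abbrev Smooth : Type := {f : Pt → ℝ // ContDiff ℝ ∞ f}

/-- A vector field `∑ i, X x i ∂/∂xᵢ`. -/
abbrev VectorField : Type := Pt → Fin 4 → ℝ

/-- A bi-vector field `(1/2) ∑ i j, B x i j ∂/∂xᵢ ∧ ∂/∂xⱼ`, given by its skew coefficient matrix. -/
abbrev BivectorField : Type := Pt → Fin 4 → Fin 4 → ℝ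

/-- The partial derivative `∂f/∂xᵢ`. -/
def pd (i : Fin 4) (f : Pt → ℝ) : Pt → ℝ := fun x => fderiv ℝ f x (Pi.single i 1)

/-- The iterated partial derivative along a list of directions. -/
def pds (l : List (Fin 4)) (f : Pt → ℝ) : Pt → ℝ := l.foldr pd f

/-! ### The Nambu-determinant Poisson bracket -/

/-- `{f, g} = ϱ · det (∇f, ∇g, ∇a¹, ∇a²)`, with `r` the inverse density and `a`, `b` the Casimirs. -/
def nambuBracket (r a b f g : Pt → ℝ) : Pt → ℝ := fun x =>
  r x * Matrix.det (Matrix.of fun i c : Fin 4 => pd i ((![f, g, a, b] : Fin 4 → Pt → ℝ) c) x)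

/-- The Nambu–Poisson bi-vector field `P(ϱ, a¹, a²)`: `P^{ij} = {xᵢ, xⱼ}`. -/
def nambu (r a b : Pt → ℝ) : BivectorField := fun x i j =>
  nambuBracket r a b (fun y => y i) (fun y => y j) x

/-! ### The Schouten bracket of a bi-vector field and a vector field -/

/-- The Lie derivative `L_X P = ⟦X, P⟧` of a bi-vector field along a vector field. -/
def lieDeriv (X : VectorField) (P : BivectorField) : BivectorField := fun x i j =>
  ∑ k, (X x k * pd k (fun y => P y i j) x
    - P x k j * pd k (fun y => X y i) x - P x i k * pd k (fun y => X y j) x)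

/-- `⟦P, X⟧ = -⟦X, P⟧`, the graded skew-symmetry of the Schouten bracket in these degrees. -/
def schouten (P : BivectorField) (X : VectorField) : BivectorField := fun x i j =>
  - lieDeriv X P x i j

/-! ### The tetrahedral flow -/

/-- `∑ ∂ₖ∂ₗ∂ₘ P^{ij} · ∂_{l'} P^{kk'} · ∂_{m'} P^{ll'} · ∂_{k'} P^{mm'}`. -/
def tetraOne (P : BivectorField) : BivectorField := fun x i j =>
  ∑ k, ∑ l, ∑ m, ∑ k', ∑ l', ∑ m',
    pds [k, l, m] (fun y => P y i j) x * pd l' (fun y => P y k k') x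
      * pd m' (fun y => P y l l') x * pd k' (fun y => P y m m') x

/-- `∑ ∂ₖ∂ₗ P^{in} · ∂_{k'}∂_{l'} P^{kj} · ∂_{m'} P^{k'l} · ∂ₙ P^{m'l'}`, not yet skew in `i, j`. -/
def tetraTwo (P : BivectorField) : BivectorField := fun x i j =>
  ∑ n, ∑ k, ∑ l, ∑ k', ∑ l', ∑ m',
    pds [k, l] (fun y => P y i n) x * pds [k', l'] (fun y => P y k j) x
      * pd m' (fun y => P y k' l) x * pd n (fun y => P y m' l') x

/-- The Kontsevich flow `Q^{γ₃}(P)` of the tetrahedron `γ₃`, as a bi-vector field.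
Normalisation: this is the image of `γ₃`, with edges in the order `12 ∧ 13 ∧ 14 ∧ 23 ∧ 24 ∧ 34`,
under the orientation morphism, that is, `Δ₁₂ Δ₁₃ Δ₁₄ Δ₂₃ Δ₂₄ Δ₃₄ (P ⊗ P ⊗ P ⊗ P)` multiplied
out, where `P = (1/2) ∑ P^{ij} ξᵢ ξⱼ` and
`Δ_{uv} = ∑ᵢ (∂/∂ξᵢ⁽ᵘ⁾ ∂/∂xᵢ⁽ᵛ⁾ + ∂/∂xᵢ⁽ᵘ⁾ ∂/∂ξᵢ⁽ᵛ⁾)`: the `8` orientations of one kind give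
`tetraOne`, the `24` of the other kind give the skew part of `tetraTwo`. The overall sign
depends only on the chosen order of the edges. -/
def tetraFlow (P : BivectorField) : BivectorField := fun x i j =>
  -8 * (tetraOne P x i j + 3 * (tetraTwo P x i j - tetraTwo P x j i))

/-! ### Nambu micro-graphs and their formulas -/

/-- The encoding of a micro-graph on the sink `0`, the Levi-Civita vertices `1, 2, 3` (each
containing `ε ϱ`), three vertices `4, 5, 6` containing `a¹` and three vertices `7, 8, 9`
containing `a²`: `G v e` is the target of the `e`-th edge issued from the vertex `v + 1`. -/
abbrev Graph : Type := Fin 3 → Fin 4 → Fin 10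

/-- Given index values `I v e` on the edges, the list of those on the edges into vertex `w`. -/
def incoming (G : Graph) (I : Fin 3 → Fin 4 → Fin 4) (w : Fin 10) : List (Fin 4) :=
  ((List.finRange 3 ×ˢ List.finRange 4).filter fun e => G e.1 e.2 = w).map fun e => I e.1 e.2

/-- The function contained in a vertex other than the sink. -/
def content (r a b : Pt → ℝ) (w : Fin 10) : Pt → ℝ :=
  if w.val ≤ 3 then r else if w.val ≤ 6 then a else b

/-- The formula `φ(G)`: the sum over all indices of `∏ ε^{i₁i₂i₃i₄}` times the product of the
vertex contents differentiated along their incoming edges, the edge into the sink giving the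
direction `∂/∂xₘ`. The symbols `ε` vanish off permutations, so the sum runs over permutations. -/
def formula (G : Graph) (r a b : Pt → ℝ) : VectorField := fun x m =>
  ∑ s : Fin 3 → Equiv.Perm (Fin 4),
    if incoming G (fun v e => s v e) 0 = [m] then
      (∏ v, ((Equiv.Perm.sign (s v) : ℤ) : ℝ)) *
        ∏ w ∈ Finset.univ.erase (0 : Fin 10),
          pds (incoming G (fun v e => s v e) w) (content r a b w) x
    else 0

/-- Vector fields that depend on `(ϱ, a¹, a²)`. -/
abbrev FieldFormula : Type := Smooth → Smooth → Smooth → VectorField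

/-- `φ(G)` as a function of the smooth data `(ϱ, a¹, a²)`. -/
def phi (G : Graph) : FieldFormula := fun r a b => formula G r.1 a.1 b.1

/-- Exchange of the Casimir vertices `4 ↔ 7`, `5 ↔ 8`, `6 ↔ 9`. -/
def swapVertex : Fin 10 → Fin 10 := ![0, 1, 2, 3, 7, 8, 9, 4, 5, 6]

/-- The micro-graph with the roles of `a¹` and `a²` exchanged. -/
def swapCasimirs (G : Graph) : Graph := fun v e => swapVertex (G v e)

/-- The skew pair `(1/2) (φ(G(a¹, a²)) - φ(G(a², a¹)))`. -/
def skewPair (G : Graph) : FieldFormula := (1 / 2 : ℝ) • (phi G - phi (swapCasimirs G))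

/-- The 4D-descendants of the 2D sunflower `(0,1 ; 1,3 ; 1,2) + 2 (0,2 ; 1,3 ; 1,2)`: each
vertex `v` gets two Casimirs `v + 3`, `v + 6`, and each edge into another vertex `v` may be
redirected to one of these Casimirs. -/
def descendants : Set Graph :=
  {G | ∃ i₁ ∈ ({1, 4, 7} : Set (Fin 10)), ∃ i₂ ∈ ({1, 4, 7} : Set (Fin 10)),
      ∃ j ∈ ({3, 6, 9} : Set (Fin 10)), ∃ k ∈ ({2, 5, 8} : Set (Fin 10)),
        G = ![![0, 1, 4, 7], ![i₁, j, 5, 8], ![i₂, k, 6, 9]]} ∪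
  {G | ∃ i₁ ∈ ({1, 4, 7} : Set (Fin 10)), ∃ i₂ ∈ ({1, 4, 7} : Set (Fin 10)),
      ∃ j ∈ ({3, 6, 9} : Set (Fin 10)), ∃ k₁ ∈ ({2, 5, 8} : Set (Fin 10)),
        ∃ k₂ ∈ ({2, 5, 8} : Set (Fin 10)),
          G = ![![0, k₁, 4, 7], ![i₁, j, 5, 8], ![i₂, k₂, 6, 9]]}

/-- The ansatz: linear combinations of the skew pairs of the 4D-descendants. -/
def ansatz : Submodule ℝ FieldFormula := Submodule.span ℝ (skewPair '' descendants)

/-- `Q^{γ₃}(P) = ⟦P, X⟧` for `P = P(ϱ, a¹, a²)`, for all smooth `ϱ, a¹, a²`. -/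
def Trivialises (X : FieldFormula) : Prop :=
  ∀ r a b : Smooth, schouten (nambu r.1 a.1 b.1) (X r a b) = tetraFlow (nambu r.1 a.1 b.1)

/-- `⟦P, X⟧ = 0` for `P = P(ϱ, a¹, a²)`, for all smooth `ϱ, a¹, a²`. -/
def IsOneCocycle (X : FieldFormula) : Prop :=
  ∀ r a b : Smooth, schouten (nambu r.1 a.1 b.1) (X r a b) = 0

/-- The 27 coefficients and micro-graphs. -/
def solutionData : List (ℤ × Graph) :=
  [(-8, ![![0, 1, 4, 7], ![1, 3, 5, 8], ![1, 2, 6, 9]]),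
   (-48, ![![0, 1, 4, 7], ![1, 6, 5, 8], ![4, 2, 6, 9]]),
   (-16, ![![0, 1, 4, 7], ![4, 3, 5, 8], ![4, 2, 6, 9]]),
   (-48, ![![0, 1, 4, 7], ![4, 6, 5, 8], ![4, 2, 6, 9]]),
   (-48, ![![0, 1, 4, 7], ![4, 9, 5, 8], ![4, 2, 6, 9]]),
   (-16, ![![0, 1, 4, 7], ![4, 3, 5, 8], ![7, 2, 6, 9]]),
   (-48, ![![0, 1, 4, 7], ![4, 6, 5, 8], ![7, 2, 6, 9]]),
   (12, ![![0, 1, 4, 7], ![1, 6, 5, 8], ![1, 5, 6, 9]]),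
   (-24, ![![0, 1, 4, 7], ![4, 6, 5, 8], ![4, 5, 6, 9]]),
   (24, ![![0, 1, 4, 7], ![4, 9, 5, 8], ![7, 5, 6, 9]]),
   (-24, ![![0, 1, 4, 7], ![7, 6, 5, 8], ![7, 5, 6, 9]]),
   (-16, ![![0, 2, 4, 7], ![1, 3, 5, 8], ![1, 2, 6, 9]]),
   (-32, ![![0, 2, 4, 7], ![1, 3, 5, 8], ![1, 5, 6, 9]]),
   (-12, ![![0, 2, 4, 7], ![1, 6, 5, 8], ![1, 5, 6, 9]]),
   (48, ![![0, 2, 4, 7], ![1, 9, 5, 8], ![4, 5, 6, 9]]),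
   (-48, ![![0, 2, 4, 7], ![1, 9, 5, 8], ![7, 5, 6, 9]]),
   (-32, ![![0, 2, 4, 7], ![4, 3, 5, 8], ![1, 5, 6, 9]]),
   (-32, ![![0, 2, 4, 7], ![7, 3, 5, 8], ![1, 5, 6, 9]]),
   (-48, ![![0, 5, 4, 7], ![1, 3, 5, 8], ![1, 2, 6, 9]]),
   (-48, ![![0, 5, 4, 7], ![1, 9, 5, 8], ![1, 2, 6, 9]]),
   (-96, ![![0, 5, 4, 7], ![1, 9, 5, 8], ![4, 2, 6, 9]]),
   (-48, ![![0, 5, 4, 7], ![4, 9, 5, 8], ![4, 2, 6, 9]]),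
   (-48, ![![0, 5, 4, 7], ![7, 9, 5, 8], ![4, 2, 6, 9]]),
   (-48, ![![0, 5, 4, 7], ![7, 9, 5, 8], ![7, 2, 6, 9]]),
   (24, ![![0, 5, 4, 7], ![1, 6, 5, 8], ![1, 5, 6, 9]]),
   (48, ![![0, 5, 4, 7], ![4, 6, 5, 8], ![7, 5, 6, 9]]),
   (48, ![![0, 5, 4, 7], ![4, 9, 5, 8], ![7, 5, 6, 9]])]

/-- The vector field `X^{γ₃}`: the combination of the 27 skew pairs with these coefficients. -/
def solution : FieldFormula := (solutionData.map fun p => (p.1 : ℝ) • skewPair p.2).sum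

end NambuFlow

end

open scoped ContDiff

noncomputable section

namespace NambuFlow

/-! ### Formal sums of bracket monomials

The functions below are evaluated by the kernel on large inputs: literals are raw, arithmetic is
that of `Nat`, and `strict` evaluates intermediate results before they are used. -/

/-- A Levi-Civita bracket of four letters. -/
structure Row where
  (a b c d : ℕ)

/-- Renaming of the letters of a bracket. -/
def Row.map (m : ℕ → ℕ) (r : Row) : Row := ⟨m r.a, m r.b, m r.c, m r.d⟩

/-- Application to an evaluated argument. -/
def strict {α : Type} (n : ℕ) (f : ℕ → α) : α :=
  @Nat.rec (fun _ => α) (f (nat_lit 0)) (fun k _ => f k) (Nat.add n (nat_lit 1))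

/-- The `l`-th hexadecimal digit. -/
def digit (M l : ℕ) : ℕ := Nat.mod (Nat.shiftRight M (Nat.mul (nat_lit 4) l)) (nat_lit 16)

def unpackRow (k : ℕ) : Row :=
  ⟨Nat.mod k (nat_lit 16), Nat.mod (Nat.div k (nat_lit 16)) (nat_lit 16),
    Nat.mod (Nat.div k (nat_lit 256)) (nat_lit 16), Nat.mod (Nat.div k (nat_lit 4096)) (nat_lit 16)⟩

/-- The list of `n` brackets with a given hexadecimal code. -/
def unpack : ℕ → ℕ → List Row
  | 0, _ => []
  | n + 1, k => unpackRow k :: unpack n (Nat.div k (nat_lit 65536))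

/-- Application to an evaluated list of brackets. -/
def unpackWith {α : Type} : ℕ → ℕ → (List Row → α) → α
  | 0, _, f => f []
  | n + 1, k, f =>
    strict (Nat.mod k (nat_lit 16)) fun a =>
    strict (Nat.mod (Nat.div k (nat_lit 16)) (nat_lit 16)) fun b =>
    strict (Nat.mod (Nat.div k (nat_lit 256)) (nat_lit 16)) fun c =>
    strict (Nat.mod (Nat.div k (nat_lit 4096)) (nat_lit 16)) fun d =>
    strict (Nat.div k (nat_lit 65536)) fun k => unpackWith n k fun g => f (⟨a, b, c, d⟩ :: g)

def compareExchange {α : Type} (x y p : ℕ) (k : ℕ → ℕ → ℕ → α) : α :=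
  bif Nat.ble x y then k x y p else k y x (Nat.sub (nat_lit 1) p)

/-- The code of a bracket with sorted letters, plus `65536` if the permutation is odd;
`131072` if a letter is repeated. -/
def sortRow (a b c d : ℕ) : ℕ :=
  compareExchange a b (nat_lit 0) fun a b p => compareExchange c d p fun c d p =>
  compareExchange a c p fun a c p => compareExchange b d p fun b d p =>
  compareExchange b c p fun b c p =>
    bif Nat.beq a b || (Nat.beq b c || Nat.beq c d) then (nat_lit 131072)
    else Nat.add (Nat.add a (Nat.add (Nat.mul (nat_lit 16) b)
        (Nat.add (Nat.mul (nat_lit 256) c) (Nat.mul (nat_lit 4096) d))))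
      (Nat.mul (nat_lit 65536) p)

def insertCode (r : ℕ) : List ℕ → List ℕ
  | [] => [r]
  | s :: l => bif Nat.ble r s then r :: s :: l else s :: insertCode r l

def pack : List ℕ → ℕ
  | [] => (nat_lit 0)
  | r :: l => Nat.add r (Nat.mul (nat_lit 65536) (pack l))

/-- The code of the renamed and sorted graph, plus `2 ^ 64` times the parity; `2 ^ 65` if a
letter is repeated in a bracket. -/
def normCode (M : ℕ) : List Row → List ℕ → ℕ → ℕ
  | [], acc, p => Nat.add (pack acc) (Nat.mul (nat_lit 0x10000000000000000) p)
  | r :: g, acc, p =>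
    strict (digit M r.a) fun a => strict (digit M r.b) fun b =>
    strict (digit M r.c) fun c => strict (digit M r.d) fun d =>
    strict (sortRow a b c d) fun u =>
      bif Nat.ble (nat_lit 131072) u then (nat_lit 0x20000000000000000)
      else normCode M g (insertCode (Nat.mod u (nat_lit 65536)) acc)
        (Nat.mod (Nat.add p (Nat.div u (nat_lit 65536))) (nat_lit 2))

/-! ### The labelling by incidence patterns -/

/-- The set of letters of a bracket, as a sum of powers of `16`. -/
def Row.mask (r : Row) : ℕ :=
  Nat.add (Nat.add (Nat.shiftLeft (nat_lit 1) (Nat.mul (nat_lit 4) r.a))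
      (Nat.shiftLeft (nat_lit 1) (Nat.mul (nat_lit 4) r.b)))
    (Nat.add (Nat.shiftLeft (nat_lit 1) (Nat.mul (nat_lit 4) r.c))
        (Nat.shiftLeft (nat_lit 1) (Nat.mul (nat_lit 4) r.d)))

def hashBase (m : ℕ) : ℕ :=
  strict (Nat.add (Nat.mod m (nat_lit 256))
    (Nat.add (Nat.mul (nat_lit 101) (Nat.mod (Nat.land m (nat_lit 0x111100)) (nat_lit 15)))
      (Nat.mul (nat_lit 1009) (Nat.mod (Nat.land m (nat_lit 0x11111111000000)) (nat_lit 15)))))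
          fun s =>
    Nat.mod (Nat.mul s s) (nat_lit 65521)

def hash (s : ℕ) : ℕ :=
  strict (Nat.mod s (nat_lit 65521)) fun s =>
    Nat.mod (Nat.mul (Nat.mod (Nat.mul s s) (nat_lit 65521)) (Nat.add s (nat_lit 5)))
        (nat_lit 65521)

def common (m k : ℕ) : ℕ := Nat.mod (Nat.land m k) (nat_lit 15)

def hashRow (m m₁ m₂ m₃ h h₁ h₂ h₃ : ℕ) : ℕ :=
  hash (Nat.add (Nat.add h (Nat.mul (common m m₁) h₁))
    (Nat.add (Nat.mul (common m m₂) h₂) (Nat.mul (common m m₃) h₃)))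

def atMost (x y : ℕ) : ℕ := Nat.sub (nat_lit 1) (Nat.sub x y)

def patternsOf (m₁ m₂ m₃ m₄ h₁ h₂ h₃ h₄ : ℕ) : ℕ :=
  strict (atMost h₁ h₂) fun a => strict (atMost h₁ h₃) fun b => strict (atMost h₁ h₄) fun c =>
  strict (atMost h₂ h₃) fun d => strict (atMost h₂ h₄) fun e => strict (atMost h₃ h₄) fun f =>
    Nat.add
      (Nat.add (Nat.shiftLeft m₁ (Nat.sub (nat_lit 3) (Nat.add a (Nat.add b c))))
        (Nat.shiftLeft m₂ (Nat.sub (Nat.add a (nat_lit 2)) (Nat.add d e))))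
      (Nat.add (Nat.shiftLeft m₃ (Nat.sub (Nat.add (Nat.add b d) (nat_lit 1)) f))
        (Nat.shiftLeft m₄ (Nat.add c (Nat.add e f))))

/-- The digits of the brackets, in an order independent of labels, that contain a letter. -/
def patterns : List Row → ℕ
  | [r₁, r₂, r₃] =>
    strict r₁.mask fun m₁ => strict r₂.mask fun m₂ => strict r₃.mask fun m₃ =>
    strict (hashBase m₁) fun h₁ => strict (hashBase m₂) fun h₂ => strict (hashBase m₃) fun h₃ =>
    strict (hashRow m₁ m₂ m₃ (nat_lit 0) h₁ h₂ h₃ (nat_lit 0)) fun k₁ =>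
    strict (hashRow m₂ m₁ m₃ (nat_lit 0) h₂ h₁ h₃ (nat_lit 0)) fun k₂ =>
    strict (hashRow m₃ m₁ m₂ (nat_lit 0) h₃ h₁ h₂ (nat_lit 0)) fun k₃ =>
      patternsOf m₁ m₂ m₃ (nat_lit 0) k₁ k₂ k₃ (nat_lit 70000)
  | [r₁, r₂, r₃, r₄] =>
    strict r₁.mask fun m₁ => strict r₂.mask fun m₂ =>
    strict r₃.mask fun m₃ => strict r₄.mask fun m₄ =>
    strict (hashBase m₁) fun h₁ => strict (hashBase m₂) fun h₂ =>
    strict (hashBase m₃) fun h₃ => strict (hashBase m₄) fun h₄ =>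
    strict (hashRow m₁ m₂ m₃ m₄ h₁ h₂ h₃ h₄) fun k₁ =>
    strict (hashRow m₂ m₁ m₃ m₄ h₂ h₁ h₃ h₄) fun k₂ =>
    strict (hashRow m₃ m₁ m₂ m₄ h₃ h₁ h₂ h₄) fun k₃ =>
    strict (hashRow m₄ m₁ m₂ m₃ h₄ h₁ h₂ h₃) fun k₄ =>
      patternsOf m₁ m₂ m₃ m₄ k₁ k₂ k₃ k₄
  | _ => (nat_lit 0)

def rankPair (x y p q : ℕ) : ℕ := Nat.add p
    (Nat.mul (Nat.sub q p) (Nat.sub (nat_lit 1) (Nat.sub x y)))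

/-- The digits of the labels of the letters of one kind, ordered by colour. -/
def rankBlock (n s t x y z w : ℕ) : ℕ :=
  bif Nat.beq n (nat_lit 3) then
    Nat.add (Nat.add (Nat.mul t (nat_lit 0x111)) (Nat.mul (nat_lit 0x1000) (Nat.add s (nat_lit 3))))
      (Nat.add (rankPair x y (nat_lit 1) (nat_lit 16))
          (Nat.add (rankPair x z (nat_lit 1) (nat_lit 256))
          (rankPair y z (nat_lit 16) (nat_lit 256))))
  else
    Nat.add (Nat.mul t (nat_lit 0x1111))
      (Nat.add
        (Nat.add (rankPair x y (nat_lit 1) (nat_lit 16))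
            (Nat.add (rankPair x z (nat_lit 1) (nat_lit 256))
            (rankPair y z (nat_lit 16) (nat_lit 256))))
        (Nat.add (rankPair x w (nat_lit 1) (nat_lit 4096))
          (Nat.add (rankPair y w (nat_lit 16) (nat_lit 4096))
              (rankPair z w (nat_lit 256) (nat_lit 4096)))))

def squareSum (x y z w : ℕ) : ℕ :=
  Nat.add (Nat.add (Nat.mul x x) (Nat.mul y y)) (Nat.add (Nat.mul z z) (Nat.mul w w))

def identityDigits : ℕ := (nat_lit 0xfedcba9876543210)

/-- The digits of the transposition of `x < y`. -/
def transposition (x y : ℕ) : ℕ :=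
  Nat.sub (Nat.add identityDigits
      (Nat.mul (Nat.sub y x) (Nat.shiftLeft (nat_lit 1) (Nat.mul (nat_lit 4) x))))
    (Nat.mul (Nat.sub y x) (Nat.shiftLeft (nat_lit 1) (Nat.mul (nat_lit 4) y)))

/-- The letters `s, …, s + n - 1` are permuted with a shift by `t - s`. -/
def validBlock (n s t M : ℕ) : Bool :=
  strict (digit M s) fun x => strict (digit M (Nat.add s (nat_lit 1))) fun y =>
  strict (digit M (Nat.add s (nat_lit 2))) fun z => strict (digit M (Nat.add s (nat_lit 3)))
      fun w =>
    (Nat.ble t x && (Nat.ble t y && Nat.ble t z)) &&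
    ((!Nat.beq x y) && ((!Nat.beq x z) && !Nat.beq y z)) &&
    (bif Nat.beq n (nat_lit 3) then
      Nat.ble x (Nat.add t (nat_lit 2)) &&
          (Nat.ble y (Nat.add t (nat_lit 2)) && (Nat.ble z (Nat.add t (nat_lit 2)) &&
        Nat.beq w (Nat.add s (nat_lit 3))))
    else Nat.ble x (Nat.add t (nat_lit 3)) &&
        (Nat.ble y (Nat.add t (nat_lit 3)) && (Nat.ble z (Nat.add t (nat_lit 3)) &&
      (Nat.ble w (Nat.add t (nat_lit 3)) && (Nat.ble t w &&
        ((!Nat.beq x w) && ((!Nat.beq y w) && !Nat.beq z w)))))))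

/-- The renaming of letters preserves the kinds up to `t ↔ 16 - t`. -/
def validMap (n t M : ℕ) : Bool :=
  Nat.beq (Nat.mod M (nat_lit 256)) (nat_lit 0x10) &&
      (Nat.beq (digit M (nat_lit 14)) (nat_lit 14) && Nat.beq (digit M (nat_lit 15))
      (nat_lit 15)) &&
    (validBlock n (nat_lit 2) (nat_lit 2) M &&
        (validBlock n (nat_lit 6) t M && validBlock n (nat_lit 10) (Nat.sub (nat_lit 16) t) M))

/-- The transposition of two letters is a symmetry that changes the sign. -/
def oddTransposition (n x y : ℕ) (g : List Row) : Bool :=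
  validMap n (nat_lit 6) (transposition x y) &&
    strict (normCode identityDigits g [] (nat_lit 0)) fun u =>
    strict (normCode (transposition x y) g [] (nat_lit 0)) fun v =>
      Nat.beq (Nat.mod u (nat_lit 0x10000000000000000)) (Nat.mod v (nat_lit 0x10000000000000000)) &&
        Nat.beq (Nat.add (Nat.div u (nat_lit 0x10000000000000000))
            (Nat.div v (nat_lit 0x10000000000000000))) (nat_lit 1)

def withPatterns (C s : ℕ) (f : ℕ → ℕ → ℕ → ℕ → ℕ) : ℕ :=
  strict (digit C s) fun x => strict (digit C (Nat.add s (nat_lit 1))) fun y =>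
  strict (digit C (Nat.add s (nat_lit 2))) fun z => strict (digit C (Nat.add s (nat_lit 3)))
      fun w => f x y z w

def oddPair (n x y p q : ℕ) (g : List Row) : Bool :=
  bif Nat.beq x y then Nat.beq (Nat.mod (Nat.shiftRight (nat_lit 0x6996) x) (nat_lit 2))
      (nat_lit 1) &&
    oddTransposition n p q g else false

def oddBlock (n s : ℕ) (g : List Row) (x y z w : ℕ) : ℕ :=
  bif oddPair n x y s (Nat.add s (nat_lit 1)) g || (oddPair n x z s (Nat.add s (nat_lit 2)) g ||
    (oddPair n y z (Nat.add s (nat_lit 1)) (Nat.add s (nat_lit 2)) g ||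
      (oddPair n x w s (Nat.add s (nat_lit 3)) g ||
        (oddPair n y w (Nat.add s (nat_lit 1)) (Nat.add s (nat_lit 3)) g ||
          oddPair n z w (Nat.add s (nat_lit 2)) (Nat.add s (nat_lit 3)) g)))) then (nat_lit 1)
  else (nat_lit 0)

def isOdd (n C : ℕ) (g : List Row) : Bool :=
  Nat.beq (withPatterns C (nat_lit 2) (oddBlock n (nat_lit 2) g)) (nat_lit 1) ||
    (Nat.beq (withPatterns C (nat_lit 6) (oddBlock n (nat_lit 6) g)) (nat_lit 1) ||
      Nat.beq (withPatterns C (nat_lit 10) (oddBlock n (nat_lit 10) g)) (nat_lit 1))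

def labelling (n t C : ℕ) : ℕ :=
  Nat.add (Nat.add (nat_lit 0xfe00000000000010)
      (Nat.mul (nat_lit 0x100) (withPatterns C (nat_lit 2) (rankBlock n (nat_lit 2) (nat_lit 2)))))
    (Nat.add (Nat.mul (nat_lit 0x1000000) (withPatterns C (nat_lit 6) (rankBlock n (nat_lit 6) t)))
      (Nat.mul (nat_lit 0x10000000000)
          (withPatterns C (nat_lit 10) (rankBlock n (nat_lit 10) (Nat.sub (nat_lit 16) t)))))

/-- A term of a formal sum: the code of a graph and its coefficient. -/
abbrev Term : Type := ℕ × ℤ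

def signed (u : ℕ) (c : ℤ) : ℤ := bif Nat.ble (nat_lit 0x10000000000000000) u then -c else c

/-- The term of a renamed and sorted graph, none if a letter is repeated in a bracket. -/
def emit (M : ℕ) (c : ℤ) (g : List Row) : List Term :=
  strict (normCode M g [] (nat_lit 0)) fun u =>
    bif Nat.ble (nat_lit 0x20000000000000000) u then []
    else strict (Nat.mod u (nat_lit 0x10000000000000000)) fun k => [(k, signed u c)]

def emitLabelled (n : ℕ) (ε : ℤ) (t M : ℕ) (c : ℤ) (g : List Row) : List Term :=
  bif validMap n t M then emit M (bif Nat.beq t (nat_lit 6) then c else ε * c) g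
  else emit identityDigits c g

def normalWith (n : ℕ) (ε : ℤ) (c : ℤ) (g : List Row) (C : ℕ) : List Term :=
  bif isOdd n C g then [] else
    strict (bif Nat.ble (withPatterns C (nat_lit 6) squareSum)
        (withPatterns C (nat_lit 10) squareSum)
      then (nat_lit 6) else (nat_lit 10)) fun t =>
    strict (labelling n t C) fun M => emitLabelled n ε t M c g

/-- The normal form of a term. -/
def normalGraph (n : ℕ) (ε : ℤ) (c : ℤ) (g : List Row) : List Term :=
  strict (patterns g) fun C => normalWith n ε c g C

/-- The code of a graph. -/
def packGraph : List Row → ℕ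
  | [] => (nat_lit 0)
  | r :: g => Nat.add (Nat.add r.a
      (Nat.add (Nat.mul (nat_lit 16) r.b) (Nat.add (Nat.mul (nat_lit 256) r.c)
      (Nat.mul (nat_lit 4096) r.d)))) (Nat.mul (nat_lit 65536) (packGraph g))

def normalTerm (n : ℕ) (ε : ℤ) (c : ℤ) (g : List Row) : List Term :=
  strict (packGraph g) fun k => unpackWith n k (normalGraph n ε c)

/-! ### Collecting terms -/

def mergeTerms : List Term → List Term → List Term
  | [] => fun ys => ys
  | x :: xs => fun ys => @List.rec Term (fun _ => List Term) (x :: xs)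
      (fun y ys' ih => bif Nat.ble x.1 y.1 then x :: mergeTerms xs (y :: ys') else y :: ih) ys

def mergePairs : List (List Term) → List (List Term)
  | [] => []
  | [x] => [x]
  | x :: y :: l => mergeTerms x y :: mergePairs l

def mergeAll : ℕ → List (List Term) → List (List Term)
  | 0, l => l
  | n + 1, l => mergeAll n (mergePairs l)

/-- The coefficients of equal consecutive codes add up to zero. -/
def sumsToZero : List Term → ℕ → ℤ → Bool
  | [], _, c => Int.beq' c 0
  | x :: l, k, c => bif Nat.beq x.1 k then sumsToZero l k (c + x.2)
    else Int.beq' c 0 && sumsToZero l x.1 x.2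

def vanishes (l : List Term) : Bool :=
  match mergeAll 14 (l.map fun x => [x]) with
  | [m] => sumsToZero m 0 0
  | [] => true
  | _ => false

/-- The five terms of a Cramer relation between the first two brackets. -/
def cramerTerms (n : ℕ) (ε : ℤ) (c : ℤ) : List Row → List Term
  | ⟨p, q, r, s⟩ :: ⟨x, y, z, w⟩ :: g =>
    normalTerm n ε c (⟨p, q, r, s⟩ :: ⟨x, y, z, w⟩ :: g) ++
    (normalTerm n ε (-c) (⟨x, q, r, s⟩ :: ⟨p, y, z, w⟩ :: g) ++
    (normalTerm n ε (-c) (⟨p, x, r, s⟩ :: ⟨q, y, z, w⟩ :: g) ++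
    (normalTerm n ε (-c) (⟨p, q, x, s⟩ :: ⟨r, y, z, w⟩ :: g) ++
    normalTerm n ε (-c) (⟨p, q, r, x⟩ :: ⟨s, y, z, w⟩ :: g))))
  | _ => []

/-- The two terms of a renaming of letters. -/
def renameTerms (n : ℕ) (ε : ℤ) (c : ℤ) (M : ℕ) (g : List Row) : List Term :=
  emit identityDigits c g ++
    emitLabelled n ε (bif Nat.ble 10 (digit M 6) then 10 else 6) M (-c) g

/-- A bracket of sums of letters. -/
structure SumRow where
  (a b c d : List ℕ)

def SumRow.expand (r : SumRow) : List Row :=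
  r.a.flatMap fun a => r.b.flatMap fun b => r.c.flatMap fun c => r.d.map fun d => ⟨a, b, c, d⟩

/-- The graphs in a product of brackets of sums of letters. -/
def expand : List SumRow → List (List Row)
  | [] => [[]]
  | r :: l => (expand l).flatMap fun g => r.expand.map fun s => s :: g

/-- The graph is a list of `n` brackets with letters below `16`. -/
def wellFormed (n : ℕ) (g : List Row) : Bool :=
  Nat.beq g.length n &&
    g.all fun r => (Nat.ble r.a 15 && Nat.ble r.b 15) && (Nat.ble r.c 15 && Nat.ble r.d 15)

/-- A formal sum of graphs. -/
abbrev FormalSum : Type := List (ℤ × List Row)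

/-- The digits of a number in base `2 ^ (4 * w)`, at most `m` of them. -/
def chunks (w : ℕ) : ℕ → ℕ → List ℕ
  | 0, _ => []
  | m + 1, x => bif Nat.beq x (nat_lit 0) then [] else
    strict (Nat.mod x (Nat.shiftLeft (nat_lit 1) (Nat.mul (nat_lit 4) w))) fun d =>
    strict (Nat.shiftRight x (Nat.mul (nat_lit 4) w)) fun x => d :: chunks w m x

/-- A coefficient stored with an offset. -/
def coefficient (d : ℕ) : ℤ := Int.subNatNat d (nat_lit 32768)

/-- The terms of the Cramer relations with a hexadecimal encoding. -/
def relationTerms (n : ℕ) (ε : ℤ) (x : ℕ) : List Term :=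
  (chunks 20 4 x).flatMap fun d =>
    strict (Nat.mod d (nat_lit 0x10000000000000000)) fun k => unpackWith n k
      (cramerTerms n ε (coefficient (Nat.shiftRight d (nat_lit 64))))

/-- The terms of the renamings with a hexadecimal encoding. -/
def renamingTerms (n : ℕ) (ε : ℤ) (x : ℕ) : List Term :=
  (chunks 36 2 x).flatMap fun d =>
    strict (Nat.mod d (nat_lit 0x10000000000000000)) fun k =>
    strict (Nat.mod (Nat.shiftRight d (nat_lit 64)) (nat_lit 0x10000000000000000)) fun M =>
      unpackWith n k (renameTerms n ε (coefficient (Nat.shiftRight d (nat_lit 128))) M)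

/-- The formal sum vanishes by the given Cramer relations and renamings. -/
def certifies (n : ℕ) (ε : ℤ) (s : FormalSum) (rel ren : List ℕ) : Bool :=
  vanishes (s.flatMap (fun p => normalTerm n ε p.1 p.2) ++
    (rel.flatMap (relationTerms n ε) ++ ren.flatMap (renamingTerms n ε)))


/-! ### Graph functionals -/

/-- The content of a letter: `0` for the density, `1` and `2` for the Casimirs, with `n` letters
each; all other letters are distinguished from each other. -/
def kind (n l : ℕ) : ℕ := if 2 ≤ l ∧ l < 14 ∧ (l - 2) % 4 < n then (l - 2) / 4 else l + 3

def swapKind (k : ℕ) : ℕ := if k = 1 then 2 else if k = 2 then 1 else k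

/-- A function of products of brackets that satisfies the Cramer identities, is invariant
under the permutations of letters of each kind and has the parity `ε` under the exchange of
the two kinds of Casimir letters. -/
structure GraphFunctional (n : ℕ) (ε : ℤ) (L : List Row → ℝ) : Prop where
  perm : ∀ g h : List Row, g.Perm h → L g = L h
  swap₁ : ∀ a b c d g, L (⟨b, a, c, d⟩ :: g) = -L (⟨a, b, c, d⟩ :: g)
  swap₂ : ∀ a b c d g, L (⟨a, c, b, d⟩ :: g) = -L (⟨a, b, c, d⟩ :: g)
  swap₃ : ∀ a b c d g, L (⟨a, b, d, c⟩ :: g) = -L (⟨a, b, c, d⟩ :: g)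
  relabel : ∀ m : ℕ → ℕ, m.Injective → (∀ l, kind n (m l) = kind n l) →
    ∀ g, L (g.map (Row.map m)) = L g
  exchange : ∀ m : ℕ → ℕ, m.Injective → (∀ l, kind n (m l) = swapKind (kind n l)) →
    ∀ g, L (g.map (Row.map m)) = ε * L g
  cramer : ∀ p q r s x y z w g, L (⟨p, q, r, s⟩ :: ⟨x, y, z, w⟩ :: g) =
    L (⟨x, q, r, s⟩ :: ⟨p, y, z, w⟩ :: g) + L (⟨p, x, r, s⟩ :: ⟨q, y, z, w⟩ :: g) +
    L (⟨p, q, x, s⟩ :: ⟨r, y, z, w⟩ :: g) + L (⟨p, q, r, x⟩ :: ⟨s, y, z, w⟩ :: g)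

/-! ### Codes -/

theorem strict_eq {α : Type} (n : ℕ) (f : ℕ → α) : strict n f = f n := rfl

theorem digit_eq (M l : ℕ) : digit M l = M / 2 ^ (4 * l) % 16 :=
  congrArg (· % 16) (Nat.shiftRight_eq_div_pow M (4 * l))

theorem digit_lt (M l : ℕ) : digit M l < 16 := Nat.mod_lt _ (by decide)

theorem unpackRow_eq (k : ℕ) :
    unpackRow k = ⟨k % 16, k / 16 % 16, k / 256 % 16, k / 4096 % 16⟩ := rfl

theorem unpackRow_add (r k : ℕ) : unpackRow (r + 65536 * k) = unpackRow r := by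
  simp only [unpackRow_eq, Row.mk.injEq]
  omega

theorem unpack_succ (n k : ℕ) : unpack (n + 1) k = unpackRow k :: unpack n (k / 65536) := rfl

theorem unpackWith_eq {α : Type} (n k : ℕ) (f : List Row → α) :
    unpackWith n k f = f (unpack n k) := by
  induction n generalizing k f with
  | zero => rfl
  | succ n ih => exact ih _ _

theorem length_unpack (n k : ℕ) : (unpack n k).length = n := by
  induction n generalizing k with
  | zero => rfl
  | succ n ih => simp [unpack_succ, ih]

def Row.Small (r : Row) : Prop := r.a < 16 ∧ r.b < 16 ∧ r.c < 16 ∧ r.d < 16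

theorem small_unpack (n k : ℕ) : ∀ r ∈ unpack n k, r.Small := by
  induction n generalizing k with
  | zero => simp [unpack]
  | succ n ih =>
    simp only [unpack_succ, List.mem_cons, forall_eq_or_imp]
    exact ⟨by simp only [unpackRow_eq, Row.Small]; omega, ih _⟩

theorem pack_cons (r : ℕ) (l : List ℕ) : pack (r :: l) = r + 65536 * pack l := rfl

theorem unpack_pack (l : List ℕ) (h : ∀ r ∈ l, r < 65536) :
    unpack l.length (pack l) = l.map unpackRow := by
  induction l with
  | nil => rfl
  | cons r l ih =>
    simp only [List.mem_cons, forall_eq_or_imp] at h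
    rw [List.length_cons, unpack_succ, pack_cons, unpackRow_add, List.map_cons, ← ih h.2]
    congr 2
    omega

theorem pack_lt (l : List ℕ) (h : ∀ r ∈ l, r < 65536) : pack l < 65536 ^ l.length := by
  induction l with
  | nil => exact Nat.one_pos
  | cons r l ih =>
    simp only [List.mem_cons, forall_eq_or_imp] at h
    rw [pack_cons, List.length_cons, pow_succ]
    have := ih h.2
    omega

theorem insertCode_perm (r : ℕ) (l : List ℕ) : (insertCode r l).Perm (r :: l) := by
  induction l with
  | nil => rfl
  | cons s l ih =>
    simp only [insertCode, cond_eq_ite]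
    split
    · rfl
    · exact (ih.cons s).trans (.swap ..)

theorem packGraph_cons (r : Row) (g : List Row) : packGraph (r :: g) =
    r.a + (16 * r.b + (256 * r.c + 4096 * r.d)) + 65536 * packGraph g := rfl

theorem unpack_packGraph (g : List Row) (h : ∀ r ∈ g, r.Small) :
    unpack g.length (packGraph g) = g := by
  induction g with
  | nil => rfl
  | cons r g ih =>
    simp only [List.mem_cons, forall_eq_or_imp] at h
    obtain ⟨⟨ha, hb, hc, hd⟩, hg⟩ := h
    rw [List.length_cons, unpack_succ, packGraph_cons, unpackRow_add,
      show (r.a + (16 * r.b + (256 * r.c + 4096 * r.d)) + 65536 * packGraph g) / 65536 =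
        packGraph g by omega, ih hg]
    congr 1
    obtain ⟨a, b, c, d⟩ := r
    simp only [unpackRow_eq, Row.mk.injEq] at *
    omega

/-! ### Sorting brackets and graphs -/

theorem compareExchange_spec {α : Type} {C : α → Prop} {I : ℕ → ℕ → ℕ → Prop} {x y p : ℕ}
    {k : ℕ → ℕ → ℕ → α} (hI : I x y p) (hs : I x y p → I y x (1 - p))
    (hk : ∀ x y p, I x y p → C (k x y p)) : C (compareExchange x y p k) := by
  simp only [compareExchange, cond_eq_ite]
  split
  · exact hk _ _ _ hI
  · exact hk _ _ _ (hs hI)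

/-- The arguments of an antisymmetric function up to a permutation of parity `p`. -/
def Rearranged (f : ℕ → ℕ → ℕ → ℕ → ℝ) (v : ℝ) (a b c d p : ℕ) : Prop :=
  (p = 0 ∧ v = f a b c d ∨ p = 1 ∧ v = -f a b c d) ∧ a < 16 ∧ b < 16 ∧ c < 16 ∧ d < 16

theorem sortRow_spec (f : ℕ → ℕ → ℕ → ℕ → ℝ) (h₁ : ∀ a b c d, f b a c d = -f a b c d)
    (h₂ : ∀ a b c d, f a c b d = -f a b c d) (h₃ : ∀ a b c d, f a b d c = -f a b c d)
    {a b c d : ℕ} (ha : a < 16) (hb : b < 16) (hc : c < 16) (hd : d < 16) :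
    131072 ≤ sortRow a b c d ∧ f a b c d = 0 ∨
    ∃ a' b' c' d' p, sortRow a b c d =
      a' + (16 * b' + (256 * c' + 4096 * d')) + 65536 * p ∧
      Rearranged f (f a b c d) a' b' c' d' p := by
  have h₁₃ : ∀ a b c d, f c b a d = -f a b c d := fun a b c d => by
    rw [h₁, h₂, h₁, neg_neg]
  have h₂₄ : ∀ a b c d, f a d c b = -f a b c d := fun a b c d => by
    rw [h₂, h₃, h₂, neg_neg]
  generalize hv : f a b c d = v
  have h₀ : Rearranged f v a b c d 0 := ⟨.inl ⟨rfl, hv.symm⟩, ha, hb, hc, hd⟩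
  suffices H : ∀ C : ℕ → Prop, (∀ a b c d p, Rearranged f v a b c d p →
      C (bif Nat.beq a b || (Nat.beq b c || Nat.beq c d) then 131072
        else a + (16 * b + (256 * c + 4096 * d)) + 65536 * p)) → C (sortRow a b c d) by
    refine H (fun u => 131072 ≤ u ∧ v = 0 ∨ ∃ a b c d p,
      u = a + (16 * b + (256 * c + 4096 * d)) + 65536 * p ∧ Rearranged f v a b c d p) ?_
    intro a b c d p h
    simp only [cond_eq_ite, Bool.or_eq_true, Nat.beq_eq]
    split
    · refine .inl ⟨le_rfl, ?_⟩
      have : f a b c d = 0 := by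
        rename_i e
        rcases e with rfl | rfl | rfl
        · linarith [h₁ a a c d]
        · linarith [h₂ a b b d]
        · linarith [h₃ a b c c]
      rcases h.1 with h | h <;> simp [h.2, this]
    · exact .inr ⟨a, b, c, d, p, rfl, h⟩
  intro C hC
  unfold sortRow
  refine compareExchange_spec (I := fun a b p => Rearranged f v a b c d p) h₀ ?_ ?_
  · exact fun _ => ⟨.inr ⟨rfl, by rw [h₁ a b, neg_neg, hv]⟩, hb, ha, hc, hd⟩
  intro a b p h
  refine compareExchange_spec (I := fun c d p => Rearranged f v a b c d p) h ?_ ?_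
  · rintro ⟨h | h, _⟩ <;> refine ⟨?_, by omega⟩ <;> simp [h, h₃ a b c d]
  intro c d p h
  refine compareExchange_spec (I := fun a c p => Rearranged f v a b c d p) h ?_ ?_
  · rintro ⟨h | h, _⟩ <;> refine ⟨?_, by omega⟩ <;> simp [h, h₁₃ a b c d]
  intro a c p h
  refine compareExchange_spec (I := fun b d p => Rearranged f v a b c d p) h ?_ ?_
  · rintro ⟨h | h, _⟩ <;> refine ⟨?_, by omega⟩ <;> simp [h, h₂₄ a b c d]
  intro b d p h
  refine compareExchange_spec (I := fun b c p => Rearranged f v a b c d p) h ?_ ?_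
  · rintro ⟨h | h, _⟩ <;> refine ⟨?_, by omega⟩ <;> simp [h, h₂ a b c d]
  intro b c p h
  exact hC _ _ _ _ _ h

theorem Row.Small.map_digit (M : ℕ) (r : Row) : (r.map (digit M)).Small :=
  ⟨digit_lt _ _, digit_lt _ _, digit_lt _ _, digit_lt _ _⟩

namespace GraphFunctional

variable {n : ℕ} {ε : ℤ} {L : List Row → ℝ}

theorem sortRow_sound (hL : GraphFunctional n ε L) {r : Row} (hr : r.Small) (g : List Row) :
    131072 ≤ sortRow r.a r.b r.c r.d ∧ L (r :: g) = 0 ∨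
    sortRow r.a r.b r.c r.d < 131072 ∧
      L (r :: g) = (-1) ^ (sortRow r.a r.b r.c r.d / 65536) *
        L (unpackRow (sortRow r.a r.b r.c r.d % 65536) :: g) := by
  obtain ⟨ha, hb, hc, hd⟩ := hr
  obtain ⟨h, h'⟩ | ⟨a, b, c, d, p, hu, hp, h⟩ := sortRow_spec
    (fun a b c d => L (⟨a, b, c, d⟩ :: g)) (fun a b c d => hL.swap₁ a b c d g)
    (fun a b c d => hL.swap₂ a b c d g) (fun a b c d => hL.swap₃ a b c d g) ha hb hc hd
  · exact .inl ⟨h, h'⟩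
  · right
    rw [hu]
    have hmod : (a + (16 * b + (256 * c + 4096 * d)) + 65536 * p) % 65536 =
      a + (16 * b + (256 * c + 4096 * d)) := by omega
    have hdiv : (a + (16 * b + (256 * c + 4096 * d)) + 65536 * p) / 65536 = p := by omega
    have hrow : unpackRow (a + (16 * b + (256 * c + 4096 * d))) = ⟨a, b, c, d⟩ := by
      simp only [unpackRow_eq, Row.mk.injEq]
      omega
    rw [hmod, hdiv, hrow]
    obtain ⟨rfl, hp⟩ | ⟨rfl, hp⟩ := hp
    · exact ⟨by omega, by simpa using hp⟩
    · exact ⟨by omega, by simpa using hp⟩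

theorem normCode_sound (hL : GraphFunctional n ε L) (M : ℕ) (g : List Row) (acc : List ℕ) (p : ℕ)
    (hp : p < 2) (hacc : ∀ r ∈ acc, r < 65536) (hlen : g.length + acc.length ≤ 4) :
    2 ^ 65 ≤ normCode M g acc p ∧ L (g.map (Row.map (digit M)) ++ acc.map unpackRow) = 0 ∨
    normCode M g acc p < 2 ^ 65 ∧
      (-1) ^ p * L (g.map (Row.map (digit M)) ++ acc.map unpackRow) =
        (-1) ^ (normCode M g acc p / 2 ^ 64) *
          L (unpack (g.length + acc.length) (normCode M g acc p % 2 ^ 64)) := by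
  induction g generalizing acc p with
  | nil =>
    right
    have h : normCode M [] acc p = pack acc + 2 ^ 64 * p := rfl
    have hlt : pack acc < 2 ^ 64 := (pack_lt acc hacc).trans_le <| by
      simpa using Nat.pow_le_pow_right (n := 65536) (by decide) hlen
    rw [h, show (pack acc + 2 ^ 64 * p) / 2 ^ 64 = p by omega,
      show (pack acc + 2 ^ 64 * p) % 2 ^ 64 = pack acc by omega]
    simp only [List.length_nil, zero_add, unpack_pack acc hacc]
    exact ⟨by omega, rfl⟩
  | cons r g ih =>
    have h : normCode M (r :: g) acc p =
      bif Nat.ble 131072 (sortRow (r.map (digit M)).a (r.map (digit M)).b (r.map (digit M)).c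
        (r.map (digit M)).d) then 2 ^ 65 else
      normCode M g (insertCode (sortRow (r.map (digit M)).a (r.map (digit M)).b
        (r.map (digit M)).c (r.map (digit M)).d % 65536) acc)
        ((p + sortRow (r.map (digit M)).a (r.map (digit M)).b (r.map (digit M)).c
          (r.map (digit M)).d / 65536) % 2) := rfl
    have hs := hL.sortRow_sound (.map_digit M r)
      (g.map (Row.map (digit M)) ++ acc.map unpackRow)
    generalize sortRow (r.map (digit M)).a (r.map (digit M)).b (r.map (digit M)).c
      (r.map (digit M)).d = u at h hs
    rw [h, cond_eq_ite]
    obtain ⟨hu, h0⟩ | ⟨hu, h1⟩ := hs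
    · rw [if_pos (Nat.ble_eq_true_of_le hu)]
      exact .inl ⟨le_rfl, h0⟩
    · rw [if_neg (by simpa using hu)]
      have hperm := insertCode_perm (u % 65536) acc
      have := ih (insertCode (u % 65536) acc) ((p + u / 65536) % 2) (Nat.mod_lt _ (by decide))
        (fun s hs => by
          rcases List.mem_cons.1 (hperm.mem_iff.1 hs) with rfl | hs
          · exact Nat.mod_lt _ (by decide)
          · exact hacc s hs)
        (by rw [hperm.length_eq]; simp only [List.length_cons] at *; omega)
      have hgraph : L (g.map (Row.map (digit M)) ++ (insertCode (u % 65536) acc).map unpackRow) =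
          L (unpackRow (u % 65536) :: (g.map (Row.map (digit M)) ++ acc.map unpackRow)) :=
        hL.perm _ _ (((hperm.map unpackRow).append_left _).trans List.perm_middle)
      rw [hgraph, hperm.length_eq] at this
      have hadd : g.length + (u % 65536 :: acc).length = (r :: g).length + acc.length := by
        simp only [List.length_cons]; omega
      rw [hadd] at this
      refine this.imp (fun h => ⟨h.1, ?_⟩) (fun h => ⟨h.1, ?_⟩)
      · rw [List.map_cons, List.cons_append, h1, h.2, mul_zero]
      · rw [← h.2, List.map_cons, List.cons_append, h1, ← mul_assoc, ← pow_add,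
          ← neg_one_pow_eq_pow_mod_two]

/-! ### Normal forms -/

/-- The value of a sum of terms. -/
def total (n : ℕ) (L : List Row → ℝ) (l : List Term) : ℝ :=
  (l.map fun t => (t.2 : ℝ) * L (unpack n t.1)).sum

theorem total_append (l₁ l₂ : List Term) :
    total n L (l₁ ++ l₂) = total n L l₁ + total n L l₂ := by simp [total]

theorem emit_sound (hL : GraphFunctional n ε L) (M : ℕ) (c : ℤ) {g : List Row}
    (hg : g.length = n) (hn : n ≤ 4) :
    total n L (emit M c g) = c * L (g.map (Row.map (digit M))) := by
  have h : emit M c g = bif Nat.ble (2 ^ 65) (normCode M g [] 0) then []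
    else [(normCode M g [] 0 % 2 ^ 64, signed (normCode M g [] 0) c)] := rfl
  rw [h, cond_eq_ite]
  have := hL.normCode_sound M g [] 0 (by decide) (by simp) (by simp; omega)
  simp only [pow_zero, one_mul, List.map_nil, List.append_nil, List.length_nil, add_zero] at this
  obtain ⟨hu, h0⟩ | ⟨hu, h1⟩ := this
  · rw [if_pos (Nat.ble_eq_true_of_le hu), h0]
    simp [total]
  · rw [if_neg (by simpa using hu), h1, hg]
    generalize normCode M g [] 0 = u at *
    have hs : signed u c = bif Nat.ble (2 ^ 64) u then -c else c := rfl
    rw [hs, cond_eq_ite]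
    split
    · rename_i h
      rw [show u / 2 ^ 64 = 1 by have := Nat.le_of_ble_eq_true h; omega]
      simp [total]
    · rename_i h
      rw [show u / 2 ^ 64 = 0 by simp at h; omega]
      simp [total]

end GraphFunctional


/-! ### Renamings of letters -/

/-- The map of letters with given hexadecimal digits. -/
def letterMap (M l : ℕ) : ℕ := if l < 16 then digit M l else l

theorem map_letterMap (M : ℕ) {g : List Row} (hg : ∀ r ∈ g, r.Small) :
    g.map (Row.map (letterMap M)) = g.map (Row.map (digit M)) := by
  refine List.map_congr_left fun r hr => ?_
  obtain ⟨ha, hb, hc, hd⟩ := hg r hr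
  simp [Row.map, letterMap, ha, hb, hc, hd]

theorem validBlock_spec {n s t M : ℕ} (hn : n = 3 ∨ n = 4) (h : validBlock n s t M = true) :
    (∀ i < n, t ≤ digit M (s + i) ∧ digit M (s + i) < t + n) ∧
    (∀ i < n, ∀ j < i, digit M (s + i) ≠ digit M (s + j)) ∧
    (n = 3 → digit M (s + 3) = s + 3) := by
  rcases hn with rfl | rfl
  · change ((Nat.ble t (digit M (s + 0)) &&
        (Nat.ble t (digit M (s + 1)) && Nat.ble t (digit M (s + 2)))) &&
      ((!Nat.beq (digit M (s + 0)) (digit M (s + 1))) &&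
        ((!Nat.beq (digit M (s + 0)) (digit M (s + 2))) &&
          !Nat.beq (digit M (s + 1)) (digit M (s + 2)))) &&
      (Nat.ble (digit M (s + 0)) (t + 2) && (Nat.ble (digit M (s + 1)) (t + 2) &&
        (Nat.ble (digit M (s + 2)) (t + 2) && Nat.beq (digit M (s + 3)) (s + 3))))) = true at h
    simp only [Bool.and_eq_true, Nat.ble_eq, Bool.not_eq_true', Nat.beq_eq,
      ← Bool.not_eq_true] at h
    refine ⟨fun i hi => ?_, fun i hi j hj => ?_, fun _ => h.2.2.2.2⟩
    · interval_cases i <;> omega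
    · interval_cases i <;> interval_cases j <;> omega
  · change ((Nat.ble t (digit M (s + 0)) &&
        (Nat.ble t (digit M (s + 1)) && Nat.ble t (digit M (s + 2)))) &&
      ((!Nat.beq (digit M (s + 0)) (digit M (s + 1))) &&
        ((!Nat.beq (digit M (s + 0)) (digit M (s + 2))) &&
          !Nat.beq (digit M (s + 1)) (digit M (s + 2)))) &&
      (Nat.ble (digit M (s + 0)) (t + 3) && (Nat.ble (digit M (s + 1)) (t + 3) &&
        (Nat.ble (digit M (s + 2)) (t + 3) && (Nat.ble (digit M (s + 3)) (t + 3) &&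
          (Nat.ble t (digit M (s + 3)) && ((!Nat.beq (digit M (s + 0)) (digit M (s + 3))) &&
          ((!Nat.beq (digit M (s + 1)) (digit M (s + 3))) &&
            !Nat.beq (digit M (s + 2)) (digit M (s + 3)))))))))) = true at h
    simp only [Bool.and_eq_true, Nat.ble_eq, Bool.not_eq_true', Nat.beq_eq,
      ← Bool.not_eq_true] at h
    refine ⟨fun i hi => ?_, fun i hi j hj => ?_, by omega⟩
    · interval_cases i <;> omega
    · interval_cases i <;> interval_cases j <;> omega

theorem letterMap_injective {M : ℕ} {n : ℕ} {σ : ℕ → ℕ} (hσ : σ.Injective)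
    (hk : ∀ l, kind n (letterMap M l) = σ (kind n l))
    (h : ∀ k < 3, ∀ i < n, ∀ j < i,
      digit M (2 + 4 * k + i) ≠ digit M (2 + 4 * k + j)) : (letterMap M).Injective := by
  have key : ∀ l l', l' < l → letterMap M l ≠ letterMap M l' := by
    intro l l' hl e
    have e' := hσ ((hk l).symm.trans ((congrArg (kind n) e).trans (hk l')))
    by_cases hb : 2 ≤ l ∧ l < 14 ∧ (l - 2) % 4 < n
    · by_cases hb' : 2 ≤ l' ∧ l' < 14 ∧ (l' - 2) % 4 < n
      · rw [kind, kind, if_pos hb, if_pos hb'] at e'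
        have := h ((l - 2) / 4) (by omega) ((l - 2) % 4) (by omega) ((l' - 2) % 4) (by omega)
        rw [show 2 + 4 * ((l - 2) / 4) + (l - 2) % 4 = l by omega,
          show 2 + 4 * ((l - 2) / 4) + (l' - 2) % 4 = l' by omega] at this
        rw [letterMap, letterMap, if_pos (by omega), if_pos (by omega)] at e
        exact this e
      · rw [kind, kind, if_pos hb, if_neg hb'] at e'
        omega
    · by_cases hb' : 2 ≤ l' ∧ l' < 14 ∧ (l' - 2) % 4 < n
      · rw [kind, kind, if_neg hb, if_pos hb'] at e'
        omega
      · rw [kind, kind, if_neg hb, if_neg hb'] at e'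
        omega
  intro l l' e
  rcases lt_trichotomy l l' with hl | hl | hl
  · exact absurd e.symm (key _ _ hl)
  · exact hl
  · exact absurd e (key _ _ hl)

theorem swapKind_involutive : swapKind.Involutive := by
  intro k
  unfold swapKind
  split_ifs <;> omega

theorem validMap_spec {n t M : ℕ} (hn : n = 3 ∨ n = 4) (ht : t = 6 ∨ t = 10)
    (h : validMap n t M = true) : (letterMap M).Injective ∧
      ∀ l, kind n (letterMap M l) = (if t = 6 then id else swapKind) (kind n l) := by
  change (Nat.beq (M % 256) 0x10 && (Nat.beq (digit M 14) 14 && Nat.beq (digit M 15) 15) &&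
    (validBlock n 2 2 M && (validBlock n 6 t M && validBlock n 10 (16 - t) M))) = true at h
  simp only [Bool.and_eq_true, Nat.beq_eq] at h
  obtain ⟨⟨h0, h14, h15⟩, h2, h6, h10⟩ := h
  have d0 : digit M 0 = 0 := by simp only [digit_eq, mul_zero, pow_zero, Nat.div_one]; omega
  have d1 : digit M 1 = 1 := by simp only [digit_eq, mul_one]; omega
  have hσ : (if t = 6 then id else swapKind).Injective := by
    split
    · exact Function.injective_id
    · exact swapKind_involutive.injective
  have hb : ∀ k < 3, ∃ k' < 3, k' = (if t = 6 then id else swapKind) k ∧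
      ((∀ i < n, 2 + 4 * k' ≤ digit M (2 + 4 * k + i) ∧
        digit M (2 + 4 * k + i) < 2 + 4 * k' + n) ∧
      (∀ i < n, ∀ j < i, digit M (2 + 4 * k + i) ≠ digit M (2 + 4 * k + j)) ∧
      (n = 3 → digit M (2 + 4 * k + 3) = 2 + 4 * k + 3)) := by
    intro k hk
    interval_cases k
    · exact ⟨0, by decide, by rcases ht with rfl | rfl <;> rfl, validBlock_spec hn h2⟩
    · rcases ht with rfl | rfl
      · exact ⟨1, by decide, rfl, validBlock_spec hn h6⟩
      · exact ⟨2, by decide, rfl, validBlock_spec hn h6⟩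
    · rcases ht with rfl | rfl
      · exact ⟨2, by decide, rfl, validBlock_spec hn h10⟩
      · exact ⟨1, by decide, rfl, validBlock_spec hn h10⟩
  have hk : ∀ l, kind n (letterMap M l) = (if t = 6 then id else swapKind) (kind n l) := by
    intro l
    by_cases hl : 2 ≤ l ∧ l < 14 ∧ (l - 2) % 4 < n
    · obtain ⟨k', hk', e, hb, -⟩ := hb ((l - 2) / 4) (by omega)
      have := hb ((l - 2) % 4) hl.2.2
      rw [show 2 + 4 * ((l - 2) / 4) + (l - 2) % 4 = l by omega] at this
      rw [letterMap, if_pos (by omega), kind, if_pos (by omega), kind, if_pos hl, ← e]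
      omega
    · have hfix : letterMap M l = l := by
        unfold letterMap
        split
        · have : l = 0 ∨ l = 1 ∨ l = 14 ∨ l = 15 ∨
              (n = 3 ∧ ∃ k < 3, l = 2 + 4 * k + 3) := by
            by_cases h' : 2 ≤ l ∧ l < 14
            · exact .inr <| .inr <| .inr <| .inr ⟨by omega, (l - 2) / 4, by omega, by omega⟩
            · omega
          obtain rfl | rfl | rfl | rfl | ⟨rfl, k, hk, rfl⟩ := this
          · exact d0
          · exact d1
          · exact h14
          · exact h15
          · obtain ⟨k', -, -, -, -, h⟩ := hb k hk
            exact h rfl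
        · rfl
      rw [hfix, kind, if_neg hl]
      split
      · rfl
      · rw [swapKind, if_neg (by omega), if_neg (by omega)]
  refine ⟨letterMap_injective hσ hk fun k hk => ?_, hk⟩
  obtain ⟨-, -, -, -, h, -⟩ := hb k hk
  exact h

theorem map_identityDigits {g : List Row} (hg : ∀ r ∈ g, r.Small) :
    g.map (Row.map (digit identityDigits)) = g := by
  conv_rhs => rw [← List.map_id g]
  refine List.map_congr_left fun r hr => ?_
  have h : ∀ l < 16, digit identityDigits l = l := by decide
  obtain ⟨ha, hb, hc, hd⟩ := hg r hr
  simp [Row.map, h, ha, hb, hc, hd]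


namespace GraphFunctional

variable {n : ℕ} {ε : ℤ} {L : List Row → ℝ}

theorem map_digit (hL : GraphFunctional n ε L) (hn : n = 3 ∨ n = 4) {t M : ℕ}
    (ht : t = 6 ∨ t = 10) (h : validMap n t M = true) {g : List Row} (hg : ∀ r ∈ g, r.Small) :
    L (g.map (Row.map (digit M))) = (if t = 6 then 1 else (ε : ℝ)) * L g := by
  obtain ⟨h₁, h₂⟩ := validMap_spec hn ht h
  rw [← map_letterMap M hg]
  rcases ht with rfl | rfl
  · simpa using hL.relabel _ h₁ h₂ g
  · simpa using hL.exchange _ h₁ h₂ g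

theorem emitLabelled_sound (hL : GraphFunctional n ε L) (hn : n = 3 ∨ n = 4) (hε : ε * ε = 1)
    {t : ℕ} (ht : t = 6 ∨ t = 10) (M : ℕ) (c : ℤ) {g : List Row} (hg : g.length = n)
    (hs : ∀ r ∈ g, r.Small) : total n L (emitLabelled n ε t M c g) = c * L g := by
  rw [emitLabelled, cond_eq_ite]
  split
  · rename_i h
    rw [hL.emit_sound _ _ hg (by omega), hL.map_digit hn ht h hs, ← mul_assoc]
    congr 1
    rcases ht with rfl | rfl
    · simp [cond_eq_ite]
    · have : (ε : ℝ) * ε = 1 := mod_cast hε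
      simp [cond_eq_ite, mul_comm (ε : ℝ) c, mul_assoc, this]
  · rw [hL.emit_sound _ _ hg (by omega), map_identityDigits hs]

theorem oddTransposition_sound (hL : GraphFunctional n ε L) (hn : n = 3 ∨ n = 4) {x y : ℕ}
    {g : List Row} (hg : g.length = n) (hs : ∀ r ∈ g, r.Small)
    (h : oddTransposition n x y g = true) : L g = 0 := by
  change (validMap n 6 (transposition x y) &&
    (Nat.beq (normCode identityDigits g [] 0 % 2 ^ 64)
      (normCode (transposition x y) g [] 0 % 2 ^ 64) &&
    Nat.beq (normCode identityDigits g [] 0 / 2 ^ 64 +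
      normCode (transposition x y) g [] 0 / 2 ^ 64) 1)) = true at h
  simp only [Bool.and_eq_true, Nat.beq_eq] at h
  obtain ⟨hv, he, ho⟩ := h
  have h₁ := hL.normCode_sound identityDigits g [] 0 (by decide) (by simp) (by simp; omega)
  have h₂ := hL.normCode_sound (transposition x y) g [] 0 (by decide) (by simp) (by simp; omega)
  simp only [pow_zero, one_mul, List.map_nil, List.append_nil, List.length_nil, add_zero,
    map_identityDigits hs, hL.map_digit hn (.inl rfl) hv hs, if_true, he] at h₁ h₂
  rcases h₁ with ⟨-, h₁⟩ | ⟨-, h₁⟩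
  · exact h₁
  rcases h₂ with ⟨-, h₂⟩ | ⟨-, h₂⟩
  · exact h₂
  generalize normCode identityDigits g [] 0 / 2 ^ 64 = p at *
  generalize normCode (transposition x y) g [] 0 / 2 ^ 64 = q at *
  obtain ⟨rfl, rfl⟩ | ⟨rfl, rfl⟩ : p = 0 ∧ q = 1 ∨ p = 1 ∧ q = 0 := by omega
  · simp only [pow_zero, pow_one, one_mul] at h₁ h₂; linarith
  · simp only [pow_zero, pow_one, one_mul] at h₁ h₂; linarith

theorem oddPair_sound (hL : GraphFunctional n ε L) (hn : n = 3 ∨ n = 4) {x y p q : ℕ}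
    {g : List Row} (hg : g.length = n) (hs : ∀ r ∈ g, r.Small)
    (h : oddPair n x y p q g = true) : L g = 0 := by
  rw [oddPair, cond_eq_ite] at h
  split at h
  · exact hL.oddTransposition_sound hn hg hs (Bool.and_eq_true _ _ ▸ h).2
  · cases h

theorem oddBlock_sound (hL : GraphFunctional n ε L) (hn : n = 3 ∨ n = 4) {s x y z w : ℕ}
    {g : List Row} (hg : g.length = n) (hs : ∀ r ∈ g, r.Small)
    (h : oddBlock n s g x y z w = 1) : L g = 0 := by
  rw [oddBlock, cond_eq_ite] at h
  split at h
  · rename_i h'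
    simp only [Bool.or_eq_true] at h'
    rcases h' with h | h | h | h | h | h <;> exact hL.oddPair_sound hn hg hs h
  · cases h

theorem isOdd_sound (hL : GraphFunctional n ε L) (hn : n = 3 ∨ n = 4) {C : ℕ}
    {g : List Row} (hg : g.length = n) (hs : ∀ r ∈ g, r.Small)
    (h : isOdd n C g = true) : L g = 0 := by
  simp only [isOdd, Bool.or_eq_true, Nat.beq_eq] at h
  rcases h with h | h | h <;> exact hL.oddBlock_sound hn hg hs h

theorem normalGraph_sound (hL : GraphFunctional n ε L) (hn : n = 3 ∨ n = 4) (hε : ε * ε = 1)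
    (c : ℤ) {g : List Row} (hg : g.length = n) (hs : ∀ r ∈ g, r.Small) :
    total n L (normalGraph n ε c g) = c * L g := by
  rw [normalGraph, strict_eq, normalWith, cond_eq_ite]
  split
  · rename_i h
    rw [hL.isOdd_sound hn hg hs h]
    simp [total]
  · rw [strict_eq, strict_eq]
    refine hL.emitLabelled_sound hn hε ?_ _ c hg hs
    rw [cond_eq_ite]
    split
    · exact .inl rfl
    · exact .inr rfl

theorem normalTerm_sound (hL : GraphFunctional n ε L) (hn : n = 3 ∨ n = 4) (hε : ε * ε = 1)
    (c : ℤ) {g : List Row} (hg : g.length = n) (hs : ∀ r ∈ g, r.Small) :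
    total n L (normalTerm n ε c g) = c * L g := by
  rw [normalTerm, strict_eq, unpackWith_eq, ← hg, unpack_packGraph g hs, hg]
  exact hL.normalGraph_sound hn hε c hg hs

theorem cramerTerms_sound (hL : GraphFunctional n ε L) (hn : n = 3 ∨ n = 4) (hε : ε * ε = 1)
    (c : ℤ) {g : List Row} (hg : g.length = n) (hs : ∀ r ∈ g, r.Small) :
    total n L (cramerTerms n ε c g) = 0 := by
  match g, hg, hs with
  | [], _, _ => simp [cramerTerms, total]
  | [_], _, _ => simp [cramerTerms, total]
  | ⟨p, q, r, s⟩ :: ⟨x, y, z, w⟩ :: g, hg, hs =>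
    simp only [List.mem_cons, forall_eq_or_imp, Row.Small] at hs
    obtain ⟨⟨hp, hq, hr, hs⟩, ⟨hx, hy, hz, hw⟩, hh⟩ := hs
    have key : ∀ c p q r s x y z w, p < 16 → q < 16 → r < 16 → s < 16 → x < 16 → y < 16 →
        z < 16 → w < 16 → total n L (normalTerm n ε c (⟨p, q, r, s⟩ :: ⟨x, y, z, w⟩ :: g)) =
        c * L (⟨p, q, r, s⟩ :: ⟨x, y, z, w⟩ :: g) := by
      intro c p q r s x y z w hp hq hr hs hx hy hz hw
      refine hL.normalTerm_sound hn hε c hg ?_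
      simp only [List.mem_cons, forall_eq_or_imp, Row.Small]
      exact ⟨⟨hp, hq, hr, hs⟩, ⟨hx, hy, hz, hw⟩, hh⟩
    simp only [cramerTerms, total_append]
    rw [key, key, key, key, key, hL.cramer p q r s x y z w g]
    · push_cast; ring
    all_goals assumption

theorem renameTerms_sound (hL : GraphFunctional n ε L) (hn : n = 3 ∨ n = 4) (hε : ε * ε = 1)
    (c : ℤ) (M : ℕ) {g : List Row} (hg : g.length = n) (hs : ∀ r ∈ g, r.Small) :
    total n L (renameTerms n ε c M g) = 0 := by
  rw [renameTerms, total_append, hL.emit_sound _ _ hg (by omega), map_identityDigits hs,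
    hL.emitLabelled_sound hn hε _ _ _ hg hs]
  · push_cast; ring
  · rw [cond_eq_ite]
    split
    · exact .inr rfl
    · exact .inl rfl

theorem total_flatMap {α : Type} (l : List α) (f : α → List Term) :
    total n L (l.flatMap f) = (l.map fun x => total n L (f x)).sum := by
  induction l with
  | nil => simp [total]
  | cons x l ih => rw [List.flatMap_cons, total_append, ih]; simp

theorem total_relations (hL : GraphFunctional n ε L) (hn : n = 3 ∨ n = 4) (hε : ε * ε = 1)
    (rel : List ℕ) : total n L (rel.flatMap (relationTerms n ε)) = 0 := by
  rw [total_flatMap]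
  refine List.sum_eq_zero fun y hy => ?_
  obtain ⟨x, -, rfl⟩ := List.mem_map.1 hy
  rw [relationTerms, total_flatMap]
  refine List.sum_eq_zero fun y hy => ?_
  obtain ⟨d, -, rfl⟩ := List.mem_map.1 hy
  rw [strict_eq, unpackWith_eq]
  exact hL.cramerTerms_sound hn hε _ (length_unpack _ _) (small_unpack _ _)

theorem total_renamings (hL : GraphFunctional n ε L) (hn : n = 3 ∨ n = 4) (hε : ε * ε = 1)
    (ren : List ℕ) : total n L (ren.flatMap (renamingTerms n ε)) = 0 := by
  rw [total_flatMap]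
  refine List.sum_eq_zero fun y hy => ?_
  obtain ⟨x, -, rfl⟩ := List.mem_map.1 hy
  rw [renamingTerms, total_flatMap]
  refine List.sum_eq_zero fun y hy => ?_
  obtain ⟨d, -, rfl⟩ := List.mem_map.1 hy
  rw [strict_eq, strict_eq, unpackWith_eq]
  exact hL.renameTerms_sound hn hε _ _ (length_unpack _ _) (small_unpack _ _)

/-! ### Collecting terms -/

theorem mergeTerms_cons_cons (x y : Term) (xs ys : List Term) :
    mergeTerms (x :: xs) (y :: ys) = bif Nat.ble x.1 y.1 then x :: mergeTerms xs (y :: ys)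
      else y :: mergeTerms (x :: xs) ys := rfl

theorem total_cons (x : Term) (l : List Term) :
    total n L (x :: l) = x.2 * L (unpack n x.1) + total n L l := by simp [total]

theorem total_mergeTerms (xs ys : List Term) :
    total n L (mergeTerms xs ys) = total n L xs + total n L ys := by
  induction xs generalizing ys with
  | nil => simp [mergeTerms, total]
  | cons x xs ih =>
    induction ys with
    | nil => simp [mergeTerms, total]
    | cons y ys ih' =>
      rw [mergeTerms_cons_cons, cond_eq_ite]
      split
      · rw [total_cons, ih, total_cons x xs]; ring
      · rw [total_cons, ih', total_cons y ys]; ring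

theorem total_mergePairs (l : List (List Term)) :
    ((mergePairs l).map (total n L)).sum = (l.map (total n L)).sum := by
  induction l using mergePairs.induct with
  | case1 => rfl
  | case2 => rfl
  | case3 x y l ih => simp [mergePairs, ih, total_mergeTerms, add_assoc]

theorem total_mergeAll (k : ℕ) (l : List (List Term)) :
    ((mergeAll k l).map (total n L)).sum = (l.map (total n L)).sum := by
  induction k generalizing l with
  | zero => rfl
  | succ k ih => rw [mergeAll, ih, total_mergePairs]

theorem sumsToZero_sound (l : List Term) (k : ℕ) (c : ℤ) (h : sumsToZero l k c = true) :
    c * L (unpack n k) + total n L l = 0 := by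
  induction l generalizing k c with
  | nil =>
    rw [sumsToZero, Int.beq'_eq_beq, beq_iff_eq] at h
    simp [h, total]
  | cons x l ih =>
    rw [sumsToZero, cond_eq_ite] at h
    rw [total_cons]
    split at h
    · rename_i e
      rw [Nat.beq_eq] at e
      have := ih _ _ h
      push_cast at this
      rw [e]
      linarith
    · rw [Bool.and_eq_true, Int.beq'_eq_beq, beq_iff_eq] at h
      have := ih _ _ h.2
      rw [h.1]
      push_cast
      linarith

theorem vanishes_sound {l : List Term} (h : vanishes l = true) : total n L l = 0 := by
  have key : ((mergeAll 14 (l.map fun x => [x])).map (total n L)).sum = total n L l := by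
    rw [total_mergeAll]
    simp [total, Function.comp_def]
  unfold vanishes at h
  generalize mergeAll 14 (l.map fun x => [x]) = m at h key
  match m with
  | [] => simpa using key.symm
  | [x] =>
    have := sumsToZero_sound (n := n) (L := L) _ _ _ h
    simpa [← key] using this
  | _ :: _ :: _ => cases h

/-- The value of a formal sum of graphs. -/
def eval (L : List Row → ℝ) (s : FormalSum) : ℝ := (s.map fun p => (p.1 : ℝ) * L p.2).sum

theorem certifies_sound (hL : GraphFunctional n ε L) (hn : n = 3 ∨ n = 4) (hε : ε * ε = 1)
    {s : FormalSum} (hs : ∀ p ∈ s, p.2.length = n ∧ ∀ r ∈ p.2, r.Small) {rel ren : List ℕ}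
    (h : certifies n ε s rel ren = true) : eval L s = 0 := by
  have := vanishes_sound (n := n) (L := L) h
  rw [total_append, total_append, hL.total_relations hn hε, hL.total_renamings hn hε, add_zero,
    add_zero, total_flatMap] at this
  rw [← this, eval]
  refine congrArg List.sum (List.map_congr_left fun p hp => ?_)
  exact (hL.normalTerm_sound hn hε p.1 (hs p hp).1 (hs p hp).2).symm

end GraphFunctional


/-! ### Iterated partial derivatives -/

theorem contDiff_pd {f : Pt → ℝ} (hf : ContDiff ℝ ∞ f) (i : Fin 4) : ContDiff ℝ ∞ (pd i f) :=
  (hf.fderiv_right (m := ∞) (by simp)).clm_apply contDiff_const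

theorem contDiff_pds {f : Pt → ℝ} (hf : ContDiff ℝ ∞ f) (l : List (Fin 4)) :
    ContDiff ℝ ∞ (pds l f) := by
  induction l with
  | nil => exact hf
  | cons i l ih => exact contDiff_pd ih i

theorem pd_comm {f : Pt → ℝ} (hf : ContDiff ℝ ∞ f) (i j : Fin 4) :
    pd i (pd j f) = pd j (pd i f) := by
  have hd : Differentiable ℝ (fderiv ℝ f) :=
    (hf.fderiv_right (m := ∞) (by simp)).differentiable (by simp)
  have h : ∀ i j x, pd i (pd j f) x = fderiv ℝ (fderiv ℝ f) x (Pi.single i 1) (Pi.single j 1) := by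
    intro i j x
    change fderiv ℝ (fun y => fderiv ℝ f y (Pi.single j 1)) x (Pi.single i 1) = _
    rw [fderiv_clm_apply (hd x) (differentiableAt_const _)]
    simp
  funext x
  rw [h, h]
  exact (hf.contDiffAt (x := x)).isSymmSndFDerivAt (by simp; exact WithTop.coe_le_coe.2 le_top) _ _

theorem pds_perm {f : Pt → ℝ} (hf : ContDiff ℝ ∞ f) {l₁ l₂ : List (Fin 4)} (h : l₁.Perm l₂) :
    pds l₁ f = pds l₂ f := by
  induction h with
  | nil => rfl
  | cons i _ ih => exact congrArg (pd i) ih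
  | swap i j l => exact pd_comm (contDiff_pds hf l) j i
  | trans _ _ h₁ h₂ => exact h₁.trans h₂

/-- The derivative along a multiset of directions. -/
def der (s : Multiset (Fin 4)) (f : Pt → ℝ) : Pt → ℝ := pds s.toList f

theorem pds_eq_der {f : Pt → ℝ} (hf : ContDiff ℝ ∞ f) (l : List (Fin 4)) : pds l f = der l f :=
  pds_perm hf (Multiset.coe_eq_coe.1 (Multiset.coe_toList _).symm)

theorem der_cons {f : Pt → ℝ} (hf : ContDiff ℝ ∞ f) (i : Fin 4) (s : Multiset (Fin 4)) :
    der (i ::ₘ s) f = pd i (der s f) := by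
  rw [← Multiset.coe_toList s, Multiset.cons_coe, ← pds_eq_der hf, ← pds_eq_der hf]
  rfl

theorem contDiff_der {f : Pt → ℝ} (hf : ContDiff ℝ ∞ f) (s : Multiset (Fin 4)) :
    ContDiff ℝ ∞ (der s f) := contDiff_pds hf _

/-! ### Differential polynomials -/

/-- Symbols of multilinear differential operators; `(w, k)` is `∂ₖ` on the `w`-th argument. -/
abbrev Symbol : Type := MvPolynomial (ℕ × Fin 4) ℝ

/-- The directions in which a monomial differentiates the `w`-th argument. -/
def directions (w : ℕ) (m : ℕ × Fin 4 →₀ ℕ) : Multiset (Fin 4) :=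
  ((Finsupp.toMultiset m).filter (·.1 = w)).map Prod.snd

theorem directions_add (w : ℕ) (m m' : ℕ × Fin 4 →₀ ℕ) :
    directions w (m + m') = directions w m + directions w m' := by
  simp [directions]

theorem directions_single (w : ℕ) (v : ℕ × Fin 4) :
    directions w (Finsupp.single v 1) = if v.1 = w then {v.2} else 0 := by
  rw [directions, Finsupp.toMultiset_single, one_smul, Multiset.filter_singleton]
  split <;> simp

theorem directions_eq_zero {w : ℕ} {m : ℕ × Fin 4 →₀ ℕ} (h : ∀ v ∈ m.support, v.1 ≠ w) :
    directions w m = 0 := by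
  rw [directions, Multiset.filter_eq_nil.2, Multiset.map_zero]
  intro v hv
  exact h v (by simpa using hv)

def evalMonomial (W : Finset ℕ) (F : ℕ → Pt → ℝ) (m : ℕ × Fin 4 →₀ ℕ) : Pt → ℝ :=
  fun x => ∏ w ∈ W, der (directions w m) (F w) x

/-- Application of a symbol to the functions `F w`, `w ∈ W`. -/
def evalSymbol (W : Finset ℕ) (F : ℕ → Pt → ℝ) : Symbol →ₗ[ℝ] Pt → ℝ :=
  (MvPolynomial.basisMonomials (ℕ × Fin 4) ℝ).constr ℝ (evalMonomial W F)

section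

variable {W : Finset ℕ} {F : ℕ → Pt → ℝ}

theorem evalSymbol_monomial (m : ℕ × Fin 4 →₀ ℕ) (c : ℝ) :
    evalSymbol W F (MvPolynomial.monomial m c) = c • evalMonomial W F m := by
  have h : MvPolynomial.monomial m c =
      c • (MvPolynomial.basisMonomials (ℕ × Fin 4) ℝ) m := by
    simp [MvPolynomial.smul_monomial]
  rw [h, map_smul, evalSymbol, Module.Basis.constr_basis]

theorem contDiff_evalMonomial (hF : ∀ w, ContDiff ℝ ∞ (F w)) (m : ℕ × Fin 4 →₀ ℕ) :
    ContDiff ℝ ∞ (evalMonomial W F m) :=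
  contDiff_prod fun w _ => contDiff_der (hF w) _

theorem contDiff_evalSymbol (hF : ∀ w, ContDiff ℝ ∞ (F w)) (p : Symbol) :
    ContDiff ℝ ∞ (evalSymbol W F p) := by
  induction p using MvPolynomial.induction_on' with
  | monomial m c =>
    rw [evalSymbol_monomial]
    exact contDiff_const.smul (contDiff_evalMonomial hF m)
  | add p q hp hq => rw [map_add]; exact hp.add hq

theorem evalMonomial_cons (hF : ∀ w, ContDiff ℝ ∞ (F w)) {w : ℕ} (hw : w ∈ W) (k : Fin 4)
    (m : ℕ × Fin 4 →₀ ℕ) (x : Pt) : evalMonomial W F (Finsupp.single (w, k) 1 + m) x =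
      (∏ v ∈ W.erase w, der (directions v m) (F v) x) * pd k (der (directions w m) (F w)) x := by
  rw [evalMonomial, ← Finset.prod_erase_mul _ _ hw]
  congr 1
  · refine Finset.prod_congr rfl fun v hv => ?_
    rw [directions_add, directions_single, if_neg (Finset.ne_of_mem_erase hv).symm, zero_add]
  · rw [directions_add, directions_single, if_pos rfl, Multiset.singleton_add, der_cons (hF w)]

theorem pd_evalMonomial (hF : ∀ w, ContDiff ℝ ∞ (F w)) (k : Fin 4) (m : ℕ × Fin 4 →₀ ℕ) :
    pd k (evalMonomial W F m) =
      ∑ w ∈ W, evalMonomial W F (Finsupp.single (w, k) 1 + m) := by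
  funext x
  have h := HasFDerivAt.finsetProd (u := W) (x := x) fun w _ =>
    (((contDiff_der (hF w) (directions w m)).differentiable (by simp)) x).hasFDerivAt
  change fderiv ℝ (fun x => ∏ w ∈ W, der (directions w m) (F w) x) x _ = _
  rw [h.fderiv, Finset.sum_apply, _root_.sum_apply]
  exact Finset.sum_congr rfl fun w hw => (evalMonomial_cons hF hw k m x).symm

theorem pd_add {f g : Pt → ℝ} (hf : ContDiff ℝ ∞ f) (hg : ContDiff ℝ ∞ g) (k : Fin 4) :
    pd k (f + g) = pd k f + pd k g := by
  funext x
  simp [pd, fderiv_add (hf.differentiable (by simp) x) (hg.differentiable (by simp) x)]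

theorem pd_smul {f : Pt → ℝ} (hf : ContDiff ℝ ∞ f) (c : ℝ) (k : Fin 4) :
    pd k (c • f) = c • pd k f := by
  funext x
  simp [pd, fderiv_const_smul (hf.differentiable (by simp) x)]

/-- The symbol of the total derivative `∂ₖ` of a product of the functions `F w`, `w ∈ W`. -/
def totalDer (W : Finset ℕ) (k : Fin 4) : Symbol := ∑ w ∈ W, MvPolynomial.X (w, k)

theorem pd_evalSymbol (hF : ∀ w, ContDiff ℝ ∞ (F w)) (k : Fin 4) (p : Symbol) :
    pd k (evalSymbol W F p) = evalSymbol W F (totalDer W k * p) := by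
  induction p using MvPolynomial.induction_on' with
  | monomial m c =>
    rw [evalSymbol_monomial, pd_smul (contDiff_evalMonomial hF m), pd_evalMonomial hF, totalDer,
      Finset.sum_mul, map_sum, Finset.smul_sum]
    refine Finset.sum_congr rfl fun w _ => ?_
    rw [MvPolynomial.X, MvPolynomial.monomial_mul, one_mul, evalSymbol_monomial]
  | add p q hp hq =>
    rw [map_add, pd_add (contDiff_evalSymbol hF p) (contDiff_evalSymbol hF q), hp, hq, mul_add,
      map_add]

theorem pds_evalSymbol (hF : ∀ w, ContDiff ℝ ∞ (F w)) (l : List (Fin 4)) (p : Symbol) :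
    pds l (evalSymbol W F p) = evalSymbol W F ((l.map (totalDer W)).prod * p) := by
  induction l with
  | nil => simp [pds]
  | cons k l ih =>
    rw [List.map_cons, List.prod_cons, mul_assoc, ← pd_evalSymbol hF, ← ih]
    rfl

/-- The symbols of operators on the functions `F w`, `w ∈ W`. -/
def symbols (W : Finset ℕ) : Subalgebra ℝ Symbol := MvPolynomial.supported ℝ {v | v.1 ∈ W}

theorem X_mem_symbols {w : ℕ} (hw : w ∈ W) (k : Fin 4) :
    (MvPolynomial.X (w, k) : Symbol) ∈ symbols W :=
  MvPolynomial.X_mem_supported.2 hw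

theorem totalDer_mem (W : Finset ℕ) (k : Fin 4) : totalDer W k ∈ symbols W :=
  Subalgebra.sum_mem _ fun _ hw => X_mem_symbols hw k

theorem evalMonomial_mul {W₁ W₂ : Finset ℕ} (hW : Disjoint W₁ W₂) {m₁ m₂ : ℕ × Fin 4 →₀ ℕ}
    (h₁ : ∀ v ∈ m₁.support, v.1 ∈ W₁) (h₂ : ∀ v ∈ m₂.support, v.1 ∈ W₂) :
    evalMonomial W₁ F m₁ * evalMonomial W₂ F m₂ = evalMonomial (W₁ ∪ W₂) F (m₁ + m₂) := by
  funext x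
  rw [evalMonomial, Finset.prod_union hW]
  refine congrArg₂ _ (Finset.prod_congr rfl fun w hw => ?_) (Finset.prod_congr rfl fun w hw => ?_)
  · rw [directions_add, directions_eq_zero (m := m₂), add_zero]
    rintro v hv rfl
    exact Finset.disjoint_left.1 hW hw (h₂ v hv)
  · rw [directions_add, directions_eq_zero (m := m₁), zero_add]
    rintro v hv rfl
    exact Finset.disjoint_left.1 hW (h₁ v hv) hw

theorem mem_of_mem_symbols {p : Symbol} (hp : p ∈ symbols W) {m : ℕ × Fin 4 →₀ ℕ}
    (hm : m ∈ p.support) : ∀ v ∈ m.support, v.1 ∈ W := fun v hv =>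
  MvPolynomial.mem_supported.1 hp
      (Finset.mem_coe.2 (MvPolynomial.mem_vars_iff_mem_support v |>.2 ⟨m, hm, hv⟩))

theorem evalSymbol_mul {W₁ W₂ : Finset ℕ} (hW : Disjoint W₁ W₂) {p q : Symbol}
    (hp : p ∈ symbols W₁) (hq : q ∈ symbols W₂) :
    evalSymbol W₁ F p * evalSymbol W₂ F q = evalSymbol (W₁ ∪ W₂) F (p * q) := by
  conv_lhs => rw [p.as_sum, q.as_sum]
  conv_rhs => rw [p.as_sum, q.as_sum]
  rw [map_sum, map_sum, Finset.sum_mul_sum, Finset.sum_mul_sum, map_sum]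
  refine Finset.sum_congr rfl fun m hm => ?_
  rw [map_sum]
  refine Finset.sum_congr rfl fun m' hm' => ?_
  rw [evalSymbol_monomial, evalSymbol_monomial, MvPolynomial.monomial_mul, evalSymbol_monomial,
    ← evalMonomial_mul hW (mem_of_mem_symbols hp hm)
        (mem_of_mem_symbols hq hm'), smul_mul_smul_comm]

theorem directions_mapDomain {σ : ℕ → ℕ} (hσ : σ.Injective) (w : ℕ) (m : ℕ × Fin 4 →₀ ℕ) :
    directions (σ w) (m.mapDomain (Prod.map σ id)) = directions w m := by
  rw [directions, directions, ← Finsupp.toMultiset_map, Multiset.filter_map, Multiset.map_map]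
  simp [hσ.eq_iff]

theorem evalSymbol_rename {σ : ℕ → ℕ} (hσ : σ.Injective) {G : ℕ → Pt → ℝ}
    (hW : W.image σ = W) (hG : ∀ w ∈ W, F (σ w) = G w) (p : Symbol) :
    evalSymbol W F (MvPolynomial.rename (Prod.map σ id) p) = evalSymbol W G p := by
  induction p using MvPolynomial.induction_on' with
  | monomial m c =>
    rw [MvPolynomial.rename_monomial, evalSymbol_monomial, evalSymbol_monomial]
    congr 1
    funext x
    rw [evalMonomial, evalMonomial]
    conv_lhs => rw [← hW]
    rw [Finset.prod_image fun _ _ _ _ h => hσ h]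
    refine Finset.prod_congr rfl fun w hw => ?_
    rw [directions_mapDomain hσ, hG w hw]
  | add p q hp hq => rw [map_add, map_add, map_add, hp, hq]

end


/-! ### Determinants -/

/-- The cofactors of the first row of a determinant of order four. -/
def cofactor {R : Type} [CommRing R] (v w z : Fin 4 → R) (k : Fin 4) : R :=
  Matrix.det (Matrix.of ![Pi.single k 1, v, w, z])

theorem det_explicit {R : Type} [CommRing R] (u v w z : Fin 4 → R) :
    Matrix.det (Matrix.of ![u, v, w, z]) =
      u 0 * (v 1 * (w 2 * z 3 - w 3 * z 2) - v 2 * (w 1 * z 3 - w 3 * z 1)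
        + v 3 * (w 1 * z 2 - w 2 * z 1))
      - u 1 * (v 0 * (w 2 * z 3 - w 3 * z 2) - v 2 * (w 0 * z 3 - w 3 * z 0)
        + v 3 * (w 0 * z 2 - w 2 * z 0))
      + u 2 * (v 0 * (w 1 * z 3 - w 3 * z 1) - v 1 * (w 0 * z 3 - w 3 * z 0)
        + v 3 * (w 0 * z 1 - w 1 * z 0))
      - u 3 * (v 0 * (w 1 * z 2 - w 2 * z 1) - v 1 * (w 0 * z 2 - w 2 * z 0)
        + v 2 * (w 0 * z 1 - w 1 * z 0)) := by
  rw [Matrix.det_succ_row_zero]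
  simp [Fin.sum_univ_succ, Matrix.det_fin_three, Fin.succAbove]
  ring

theorem det_eq_cofactor {R : Type} [CommRing R] (u v w z : Fin 4 → R) :
    Matrix.det (Matrix.of ![u, v, w, z]) = ∑ k, u k * cofactor v w z k := by
  simp only [cofactor, det_explicit, Fin.sum_univ_four]
  simp
  ring

theorem det_swap₁ {R : Type} [CommRing R] (u v w z : Fin 4 → R) :
    Matrix.det (Matrix.of ![v, u, w, z]) = -Matrix.det (Matrix.of ![u, v, w, z]) := by
  rw [det_explicit, det_explicit]; ring

theorem det_swap₂ {R : Type} [CommRing R] (u v w z : Fin 4 → R) :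
    Matrix.det (Matrix.of ![u, w, v, z]) = -Matrix.det (Matrix.of ![u, v, w, z]) := by
  rw [det_explicit, det_explicit]; ring

theorem det_swap₃ {R : Type} [CommRing R] (u v w z : Fin 4 → R) :
    Matrix.det (Matrix.of ![u, v, z, w]) = -Matrix.det (Matrix.of ![u, v, w, z]) := by
  rw [det_explicit, det_explicit]; ring

theorem cramer_rule {R : Type} [CommRing R] (p q r s x : Fin 4 → R) (k : Fin 4) :
    Matrix.det (Matrix.of ![p, q, r, s]) * x k =
      Matrix.det (Matrix.of ![x, q, r, s]) * p k + Matrix.det (Matrix.of ![p, x, r, s]) * q k +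
      Matrix.det (Matrix.of ![p, q, x, s]) * r k + Matrix.det (Matrix.of ![p, q, r, x]) * s k := by
  simp only [det_explicit]
  fin_cases k <;> simp <;> ring

theorem cramer_det {R : Type} [CommRing R] (p q r s x y z w : Fin 4 → R) :
    Matrix.det (Matrix.of ![p, q, r, s]) * Matrix.det (Matrix.of ![x, y, z, w]) =
      Matrix.det (Matrix.of ![x, q, r, s]) * Matrix.det (Matrix.of ![p, y, z, w]) +
      Matrix.det (Matrix.of ![p, x, r, s]) * Matrix.det (Matrix.of ![q, y, z, w]) +
      Matrix.det (Matrix.of ![p, q, x, s]) * Matrix.det (Matrix.of ![r, y, z, w]) +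
      Matrix.det (Matrix.of ![p, q, r, x]) * Matrix.det (Matrix.of ![s, y, z, w]) := by
  rw [det_eq_cofactor x y z w, det_eq_cofactor p y z w, det_eq_cofactor q y z w,
    det_eq_cofactor r y z w, det_eq_cofactor s y z w]
  simp only [Finset.mul_sum, ← Finset.sum_add_distrib]
  refine Finset.sum_congr rfl fun k _ => ?_
  linear_combination cofactor y z w k * cramer_rule p q r s x k

/-! ### The value of a graph -/

/-- The covector of a letter: two fixed basis covectors and the symbols of gradients. -/
def covector (i j : Fin 4) (l : ℕ) (k : Fin 4) : Symbol :=
  if l = 0 then (if k = i then 1 else 0) else if l = 1 then (if k = j then 1 else 0)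
  else MvPolynomial.X (l, k)

def Row.symbol (i j : Fin 4) (r : Row) : Symbol :=
  Matrix.det (Matrix.of ![covector i j r.a, covector i j r.b, covector i j r.c, covector i j r.d])

def graphSymbol (i j : Fin 4) (g : List Row) : Symbol := (g.map (Row.symbol i j)).prod

/-- The letters of the `3 n` functions. -/
def letters (n : ℕ) : Finset ℕ := (Finset.range 14).filter fun l => kind n l < 3

/-- The function of a letter. -/
def letterContent (n : ℕ) (r a b : Pt → ℝ) (l : ℕ) : Pt → ℝ :=
  if kind n l = 0 then r else if kind n l = 1 then a else b

/-- The differential polynomial of a graph at a point. -/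
def value (n : ℕ) (r a b : Pt → ℝ) (x : Pt) (i j : Fin 4) (g : List Row) : ℝ :=
  evalSymbol (letters n) (letterContent n r a b) (graphSymbol i j g) x

theorem contDiff_letterContent {r a b : Pt → ℝ} (hr : ContDiff ℝ ∞ r) (ha : ContDiff ℝ ∞ a)
    (hb : ContDiff ℝ ∞ b) (n l : ℕ) : ContDiff ℝ ∞ (letterContent n r a b l) := by
  unfold letterContent
  split_ifs <;> assumption

theorem mem_letters {n l : ℕ} : l ∈ letters n ↔ kind n l < 3 := by
  simp only [letters, Finset.mem_filter, Finset.mem_range, and_iff_right_iff_imp]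
  unfold kind
  split_ifs <;> omega

theorem rename_covector {σ : ℕ → ℕ} (h₀ : σ 0 = 0) (h₁ : σ 1 = 1) (hσ : σ.Injective)
    (i j : Fin 4) (l : ℕ) (k : Fin 4) :
    MvPolynomial.rename (Prod.map σ id) (covector i j l k) = covector i j (σ l) k := by
  unfold covector
  have e₀ : σ l = 0 ↔ l = 0 := ⟨fun h => hσ (h.trans h₀.symm), fun h => by rw [h, h₀]⟩
  have e₁ : σ l = 1 ↔ l = 1 := ⟨fun h => hσ (h.trans h₁.symm), fun h => by rw [h, h₁]⟩
  simp only [e₀, e₁]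
  split_ifs <;> simp

theorem rename_graphSymbol {σ : ℕ → ℕ} (h₀ : σ 0 = 0) (h₁ : σ 1 = 1) (hσ : σ.Injective)
    (i j : Fin 4) (g : List Row) :
    MvPolynomial.rename (Prod.map σ id) (graphSymbol i j g) =
      graphSymbol i j (g.map (Row.map σ)) := by
  have h : ∀ r : Row, MvPolynomial.rename (Prod.map σ id) (r.symbol i j) =
      (r.map σ).symbol i j := by
    intro r
    simp only [Row.symbol, Row.map, det_explicit, map_add, map_sub, map_mul,
      rename_covector h₀ h₁ hσ]
  simp only [graphSymbol, map_list_prod, List.map_map, Function.comp_def, h]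

theorem value_map {n : ℕ} {τ : ℕ → ℕ} (hτ : ∀ k, τ k < 3 ↔ k < 3)
    (hτ' : ∀ k, 3 ≤ k → τ k = k) {r a b r' a' b' : Pt → ℝ} {σ : ℕ → ℕ} (hσ : σ.Injective)
    (hk : ∀ l, kind n (σ l) = τ (kind n l))
    (hc : ∀ k < 3, (if τ k = 0 then r else if τ k = 1 then a else b) =
      if k = 0 then r' else if k = 1 then a' else b') (x : Pt) (i j : Fin 4) (g : List Row) :
    value n r a b x i j (g.map (Row.map σ)) = value n r' a' b' x i j g := by
  have hfix : ∀ l, 3 ≤ kind n l → σ l = l := by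
    intro l hl
    have h := hk l
    rw [hτ' _ hl] at h
    unfold kind at h hl
    split_ifs at h hl <;> omega
  have hW : (letters n).image σ = letters n := by
    refine Finset.eq_of_subset_of_card_le ?_ (Finset.card_image_of_injective _ hσ).ge
    intro v hv
    obtain ⟨l, hl, rfl⟩ := Finset.mem_image.1 hv
    rw [mem_letters] at hl
    rwa [mem_letters, hk, hτ]
  rw [value, value, ← rename_graphSymbol (hfix 0 (by simp [kind])) (hfix 1 (by simp [kind])) hσ,
    evalSymbol_rename hσ hW]
  intro w hw
  rw [letterContent, letterContent, hk]
  exact hc _ ((mem_letters).1 hw)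

theorem value_perm (n : ℕ) (r a b : Pt → ℝ) (x : Pt) (i j : Fin 4) {g h : List Row}
    (e : g.Perm h) : value n r a b x i j g = value n r a b x i j h := by
  rw [value, graphSymbol, (e.map _).prod_eq]; rfl

/-- The sum over the exchange of the Casimirs, with a sign. -/
def pairValue (n : ℕ) (ε : ℤ) (r a b : Pt → ℝ) (x : Pt) (i j : Fin 4) (g : List Row) : ℝ :=
  value n r a b x i j g + ε * value n r b a x i j g

theorem graphFunctional_pairValue (n : ℕ) {ε : ℤ} (hε : ε * ε = 1)
    (r a b : Pt → ℝ) (x : Pt) (i j : Fin 4) :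
    GraphFunctional n ε (pairValue n ε r a b x i j) where
  perm g h e := by rw [pairValue, pairValue, value_perm _ _ _ _ _ _ _ e, value_perm _ _ _ _ _ _ _ e]
  swap₁ a' b' c d g := by
    simp only [pairValue, value, graphSymbol, List.map_cons, List.prod_cons, Row.symbol]
    rw [det_swap₁, neg_mul, map_neg, map_neg]
    simp; ring
  swap₂ a' b' c d g := by
    simp only [pairValue, value, graphSymbol, List.map_cons, List.prod_cons, Row.symbol]
    rw [det_swap₂, neg_mul, map_neg, map_neg]
    simp; ring
  swap₃ a' b' c d g := by
    simp only [pairValue, value, graphSymbol, List.map_cons, List.prod_cons, Row.symbol]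
    rw [det_swap₃, neg_mul, map_neg, map_neg]
    simp; ring
  relabel σ hσ hk g := by
    have h : ∀ a b, value n r a b x i j (g.map (Row.map σ)) = value n r a b x i j g :=
      fun a b => value_map (τ := id) (by simp) (by simp) hσ hk (fun _ _ => rfl) x i j g
    rw [pairValue, pairValue, h, h]
  exchange σ hσ hk g := by
    have h : ∀ a b, value n r a b x i j (g.map (Row.map σ)) = value n r b a x i j g := by
      intro a b
      refine value_map (fun k => ?_) (fun k hk => ?_) hσ hk (fun k hk => ?_) x i j g
      · unfold swapKind; split_ifs <;> omega
      · unfold swapKind; split_ifs <;> omega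
      · interval_cases k <;> simp [swapKind]
    have hε' : (ε : ℝ) * ε = 1 := mod_cast hε
    rw [pairValue, pairValue, h, h]
    linear_combination (-value n r b a x i j g) * hε'
  cramer p q r' s x' y z w g := by
    simp only [pairValue, value, graphSymbol, List.map_cons, List.prod_cons, Row.symbol,
      ← mul_assoc]
    rw [cramer_det]
    simp only [add_mul, map_add, Pi.add_apply]
    ring


/-! ### Expansion of brackets of sums -/

/-- A letter as a bracket entry in a formal product. -/
def singles (r : Row) (f : ℕ → List ℕ) : SumRow := ⟨f r.a, f r.b, f r.c, f r.d⟩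

/-- The bracket `⟦P, φ⟧` of a graph. -/
def schoutenSum (c : ℤ) (g : List Row) : FormalSum :=
  ((expand (⟨[0], [1], [9], [13]⟩ ::
    g.map fun r => singles r fun l => if l = 0 then [5, 9, 13] else [l])).map fun h => (-c, h)) ++
  (((expand (⟨[2, 3, 4, 6, 7, 8, 10, 11, 12], [1], [9], [13]⟩ ::
    g.map fun r => singles r fun l => [l])).map fun h => (c, h)) ++
  ((expand (⟨[0], [2, 3, 4, 6, 7, 8, 10, 11, 12], [9], [13]⟩ ::
    g.map fun r => singles r fun l => if l = 0 then [1] else [l])).map fun h => (c, h)))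

/-- The tetrahedral flow. -/
def tetraSum (c : ℤ) : FormalSum :=
  ((expand [⟨[0], [1], [6], [10]⟩, ⟨[2, 6, 10], [5, 9, 13], [7], [11]⟩,
    ⟨[2, 6, 10], [3, 7, 11], [8], [12]⟩, ⟨[2, 6, 10], [4, 8, 12], [9], [13]⟩]).map
    fun h => (-8 * c, h)) ++
  (((expand [⟨[0], [5, 9, 13], [6], [10]⟩, ⟨[2, 6, 10], [1], [7], [11]⟩,
    ⟨[3, 7, 11], [2, 6, 10], [8], [12]⟩, ⟨[4, 8, 12], [3, 7, 11], [9], [13]⟩]).map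
    fun h => (-24 * c, h)) ++
  ((expand [⟨[1], [5, 9, 13], [6], [10]⟩, ⟨[2, 6, 10], [0], [7], [11]⟩,
    ⟨[3, 7, 11], [2, 6, 10], [8], [12]⟩, ⟨[4, 8, 12], [3, 7, 11], [9], [13]⟩]).map
    fun h => (24 * c, h)))

/-- The covector of a sum of letters. -/
def covectorSum (i j : Fin 4) (l : List ℕ) (k : Fin 4) : Symbol :=
  (l.map fun v => covector i j v k).sum

def SumRow.symbol (i j : Fin 4) (r : SumRow) : Symbol :=
  Matrix.det (Matrix.of ![covectorSum i j r.a, covectorSum i j r.b, covectorSum i j r.c,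
    covectorSum i j r.d])

theorem det_add₁ {R : Type} [CommRing R] (u u' v w z : Fin 4 → R) :
    Matrix.det (Matrix.of ![fun k => u k + u' k, v, w, z]) =
      Matrix.det (Matrix.of ![u, v, w, z]) + Matrix.det (Matrix.of ![u', v, w, z]) := by
  simp only [det_explicit]; ring

theorem det_add₂ {R : Type} [CommRing R] (u v v' w z : Fin 4 → R) :
    Matrix.det (Matrix.of ![u, fun k => v k + v' k, w, z]) =
      Matrix.det (Matrix.of ![u, v, w, z]) + Matrix.det (Matrix.of ![u, v', w, z]) := by
  simp only [det_explicit]; ring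

theorem det_add₃ {R : Type} [CommRing R] (u v w w' z : Fin 4 → R) :
    Matrix.det (Matrix.of ![u, v, fun k => w k + w' k, z]) =
      Matrix.det (Matrix.of ![u, v, w, z]) + Matrix.det (Matrix.of ![u, v, w', z]) := by
  simp only [det_explicit]; ring

theorem det_add₄ {R : Type} [CommRing R] (u v w z z' : Fin 4 → R) :
    Matrix.det (Matrix.of ![u, v, w, fun k => z k + z' k]) =
      Matrix.det (Matrix.of ![u, v, w, z]) + Matrix.det (Matrix.of ![u, v, w, z']) := by
  simp only [det_explicit]; ring

theorem covectorSum_cons (i j : Fin 4) (v : ℕ) (l : List ℕ) :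
    covectorSum i j (v :: l) = fun k => covector i j v k + covectorSum i j l k := by
  funext k; simp [covectorSum]

theorem sum_det₁ (i j : Fin 4) (l : List ℕ) (v w z : Fin 4 → Symbol) :
    Matrix.det (Matrix.of ![covectorSum i j l, v, w, z]) =
      (l.map fun u => Matrix.det (Matrix.of ![covector i j u, v, w, z])).sum := by
  induction l with
  | nil => simp [covectorSum, det_explicit]
  | cons u l ih => rw [covectorSum_cons, det_add₁, ih, List.map_cons, List.sum_cons]

theorem sum_det₂ (i j : Fin 4) (l : List ℕ) (u w z : Fin 4 → Symbol) :
    Matrix.det (Matrix.of ![u, covectorSum i j l, w, z]) =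
      (l.map fun v => Matrix.det (Matrix.of ![u, covector i j v, w, z])).sum := by
  induction l with
  | nil => simp [covectorSum, det_explicit]
  | cons v l ih => rw [covectorSum_cons, det_add₂, ih, List.map_cons, List.sum_cons]

theorem sum_det₃ (i j : Fin 4) (l : List ℕ) (u v z : Fin 4 → Symbol) :
    Matrix.det (Matrix.of ![u, v, covectorSum i j l, z]) =
      (l.map fun w => Matrix.det (Matrix.of ![u, v, covector i j w, z])).sum := by
  induction l with
  | nil => simp [covectorSum, det_explicit]
  | cons w l ih => rw [covectorSum_cons, det_add₃, ih, List.map_cons, List.sum_cons]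

theorem sum_det₄ (i j : Fin 4) (l : List ℕ) (u v w : Fin 4 → Symbol) :
    Matrix.det (Matrix.of ![u, v, w, covectorSum i j l]) =
      (l.map fun z => Matrix.det (Matrix.of ![u, v, w, covector i j z])).sum := by
  induction l with
  | nil => simp [covectorSum, det_explicit]
  | cons z l ih => rw [covectorSum_cons, det_add₄, ih, List.map_cons, List.sum_cons]

theorem sum_map_flatMap {α β : Type} {M : Type} [AddCommMonoid M] (l : List α) (f : α → List β)
    (g : β → M) : ((l.flatMap f).map g).sum = (l.map fun a => ((f a).map g).sum).sum := by
  induction l with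
  | nil => rfl
  | cons a l ih => simp [ih]

theorem SumRow.sum_expand (i j : Fin 4) (r : SumRow) :
    (r.expand.map (Row.symbol i j)).sum = r.symbol i j := by
  rw [SumRow.symbol, SumRow.expand, sum_det₁, sum_map_flatMap]
  refine congrArg List.sum (List.map_congr_left fun a _ => ?_)
  rw [sum_det₂, sum_map_flatMap]
  refine congrArg List.sum (List.map_congr_left fun b _ => ?_)
  rw [sum_det₃, sum_map_flatMap]
  refine congrArg List.sum (List.map_congr_left fun c _ => ?_)
  rw [sum_det₄, List.map_map]
  exact congrArg List.sum (List.map_congr_left fun d _ => rfl)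

theorem sum_expand (i j : Fin 4) (l : List SumRow) :
    ((expand l).map (graphSymbol i j)).sum = (l.map (SumRow.symbol i j)).prod := by
  induction l with
  | nil => simp [expand, graphSymbol]
  | cons r l ih =>
    rw [expand, sum_map_flatMap, List.map_cons, List.prod_cons, ← ih, ← r.sum_expand i j,
      ← List.sum_map_mul_left]
    refine congrArg List.sum (List.map_congr_left fun g _ => ?_)
    rw [← List.sum_map_mul_right, List.map_map]
    simp [graphSymbol, Function.comp_def]

/-- The symbol of a formal sum of graphs. -/
def sumSymbol (i j : Fin 4) (s : FormalSum) : Symbol :=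
  (s.map fun p => (p.1 : ℝ) • graphSymbol i j p.2).sum

theorem eval_value (n : ℕ) (r a b : Pt → ℝ) (x : Pt) (i j : Fin 4) (s : FormalSum) :
    GraphFunctional.eval (value n r a b x i j) s =
      evalSymbol (letters n) (letterContent n r a b) (sumSymbol i j s) x := by
  induction s with
  | nil => simp [GraphFunctional.eval, sumSymbol]
  | cons p s ih =>
    simp only [GraphFunctional.eval, sumSymbol, List.map_cons, List.sum_cons, map_add, map_smul,
      Pi.add_apply, Pi.smul_apply, smul_eq_mul] at ih ⊢
    rw [ih]
    rfl

theorem sumSymbol_append (i j : Fin 4) (s t : FormalSum) :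
    sumSymbol i j (s ++ t) = sumSymbol i j s + sumSymbol i j t := by simp [sumSymbol]

theorem sumSymbol_expand (i j : Fin 4) (c : ℤ) (l : List SumRow) :
    sumSymbol i j ((expand l).map fun h => (c, h)) =
      (c : ℝ) • (l.map (SumRow.symbol i j)).prod := by
  rw [sumSymbol, List.map_map, ← sum_expand, List.smul_sum, List.map_map]
  rfl

/-! ### The Nambu bi-vector -/

/-- The three letters of the `c`-th copy of the Nambu bi-vector. -/
def block (c : ℕ) : Finset ℕ := {2 + c, 6 + c, 10 + c}

/-- A basis covector. -/
def basisVector (i k : Fin 4) : Symbol := if k = i then 1 else 0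

/-- The symbol of the `c`-th copy of the Nambu bi-vector, applied to two covectors. -/
def nambuSymbol (c : ℕ) (u v : Fin 4 → Symbol) : Symbol :=
  Matrix.det (Matrix.of ![u, v, fun k => MvPolynomial.X (6 + c, k),
    fun k => MvPolynomial.X (10 + c, k)])

theorem sum_nambuSymbol_left (c : ℕ) (u v : Fin 4 → Symbol) :
    ∑ k, u k * nambuSymbol c (basisVector k) v = nambuSymbol c u v := by
  simp only [nambuSymbol, det_explicit, Fin.sum_univ_four]
  simp [basisVector]
  ring

theorem sum_nambuSymbol_right (c : ℕ) (u v : Fin 4 → Symbol) :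
    ∑ k, v k * nambuSymbol c u (basisVector k) = nambuSymbol c u v := by
  simp only [nambuSymbol, det_explicit, Fin.sum_univ_four]
  simp [basisVector]
  ring

theorem kind_mem_block {c : ℕ} (hc : c < 4) :
    kind 4 (2 + c) = 0 ∧ kind 4 (6 + c) = 1 ∧ kind 4 (10 + c) = 2 := by
  interval_cases c <;> decide

theorem evalSymbol_congr {W : Finset ℕ} {F G : ℕ → Pt → ℝ} (h : ∀ w ∈ W, F w = G w) (p : Symbol) :
    evalSymbol W F p = evalSymbol W G p := by
  have : evalMonomial W F = evalMonomial W G := by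
    funext m x
    exact Finset.prod_congr rfl fun w hw => by rw [h w hw]
  rw [evalSymbol, evalSymbol, this]

theorem evalSymbol_X_mul_X {c : ℕ} (hc : c < 4) (r a b : Pt → ℝ) (k l : Fin 4) (x : Pt) :
    evalSymbol (block c) (letterContent 4 r a b)
      (MvPolynomial.X (6 + c, k) * MvPolynomial.X (10 + c, l)) x =
      r x * (pd k a x * pd l b x) := by
  obtain ⟨h₀, h₁, h₂⟩ := kind_mem_block hc
  rw [MvPolynomial.X, MvPolynomial.X, MvPolynomial.monomial_mul, evalSymbol_monomial,
    Pi.smul_apply, evalMonomial, block, Finset.prod_insert (by simp), Finset.prod_insert (by simp),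
    Finset.prod_singleton]
  simp only [directions_add, directions_single, letterContent, h₀, h₁, h₂]
  simp [der, pds]

theorem pd_coordinate (i k : Fin 4) (x : Pt) :
    pd k (fun y => y i) x = if k = i then 1 else 0 := by
  have h : HasFDerivAt (fun y : Pt => y i)
      (ContinuousLinearMap.proj (R := ℝ) (φ := fun _ : Fin 4 => ℝ) i) x :=
    (ContinuousLinearMap.proj (R := ℝ) (φ := fun _ : Fin 4 => ℝ) i).hasFDerivAt
  rw [pd, h.fderiv]
  simp [Pi.single_apply, eq_comm]

theorem nambu_eq_det (r a b : Pt → ℝ) (x : Pt) (i j : Fin 4) : nambu r a b x i j =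
    r x * Matrix.det (Matrix.of ![fun k => if k = i then (1 : ℝ) else 0,
      fun k => if k = j then (1 : ℝ) else 0, fun k => pd k a x, fun k => pd k b x]) := by
  rw [nambu, nambuBracket, ← Matrix.det_transpose]
  congr 2
  ext c k
  fin_cases c <;> simp [pd_coordinate]

theorem nambu_swap (r a b : Pt → ℝ) : nambu r b a = -nambu r a b := by
  funext x i j
  rw [Pi.neg_apply, Pi.neg_apply, Pi.neg_apply, nambu_eq_det, nambu_eq_det, det_swap₃, mul_neg]

theorem nambu_eq_evalSymbol {c : ℕ} (hc : c < 4) (r a b : Pt → ℝ) (i j : Fin 4) :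
    (fun x => nambu r a b x i j) = evalSymbol (block c) (letterContent 4 r a b)
      (nambuSymbol c (basisVector i) (basisVector j)) := by
  funext x
  rw [nambu_eq_det, det_explicit, nambuSymbol, det_explicit]
  fin_cases i <;> fin_cases j <;>
    simp [basisVector, map_sub, evalSymbol_X_mul_X hc, mul_sub]


/-! ### The tetrahedral flow of the Nambu bi-vector -/

theorem symbols_mono {W₁ W₂ : Finset ℕ} (h : W₁ ⊆ W₂) : symbols W₁ ≤ symbols W₂ :=
  MvPolynomial.supported_mono fun _ hv => h hv

theorem det_mem {A : Subalgebra ℝ Symbol} {u v w z : Fin 4 → Symbol} (hu : ∀ k, u k ∈ A)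
    (hv : ∀ k, v k ∈ A) (hw : ∀ k, w k ∈ A) (hz : ∀ k, z k ∈ A) :
    Matrix.det (Matrix.of ![u, v, w, z]) ∈ A := by
  rw [Matrix.det_apply]
  refine Subalgebra.sum_mem _ fun σ _ => ?_
  have h : ∀ i j, Matrix.of ![u, v, w, z] i j ∈ A := by
    intro i j
    fin_cases i
    exacts [hu j, hv j, hw j, hz j]
  rw [Units.smul_def]
  exact A.toSubring.zsmul_mem (Subalgebra.prod_mem _ fun i _ => h _ _) _

theorem basisVector_mem (A : Subalgebra ℝ Symbol) (i k : Fin 4) : basisVector i k ∈ A := by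
  unfold basisVector
  split
  exacts [A.one_mem, A.zero_mem]

theorem nambuSymbol_mem (c : ℕ) (i j : Fin 4) :
    nambuSymbol c (basisVector i) (basisVector j) ∈ symbols (block c) :=
  det_mem (basisVector_mem _ i) (basisVector_mem _ j) (fun _ => X_mem_symbols (by simp [block]) _)
    fun _ => X_mem_symbols (by simp [block]) _

theorem evalSymbol_blocks (F : ℕ → Pt → ℝ) {p q s t : Symbol} (hp : p ∈ symbols (block 0))
    (hq : q ∈ symbols (block 1)) (hs : s ∈ symbols (block 2)) (ht : t ∈ symbols (block 3))
    (x : Pt) : evalSymbol (block 0) F p x * evalSymbol (block 1) F q x *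
      evalSymbol (block 2) F s x * evalSymbol (block 3) F t x =
      evalSymbol (letters 4) F (p * q * s * t) x := by
  have h : letters 4 = ((block 0 ∪ block 1) ∪ block 2) ∪ block 3 := by decide
  have hpq : p * q ∈ symbols (block 0 ∪ block 1) := (symbols _).mul_mem
    (symbols_mono Finset.subset_union_left hp) (symbols_mono Finset.subset_union_right hq)
  have hpqs : p * q * s ∈ symbols (block 0 ∪ block 1 ∪ block 2) := (symbols _).mul_mem
    (symbols_mono Finset.subset_union_left hpq) (symbols_mono Finset.subset_union_right hs)
  rw [h, ← evalSymbol_mul (by decide) hpqs ht, ← evalSymbol_mul (by decide) hpq hs,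
    ← evalSymbol_mul (by decide) hp hq]
  rfl

theorem derivatives_mem (c : ℕ) (l : List (Fin 4)) (i j : Fin 4) :
    (l.map (totalDer (block c))).prod * nambuSymbol c (basisVector i) (basisVector j) ∈
      symbols (block c) := by
  refine (symbols _).mul_mem (Subalgebra.list_prod_mem _ fun y hy => ?_) (nambuSymbol_mem c i j)
  obtain ⟨k, -, rfl⟩ := List.mem_map.1 hy
  exact totalDer_mem _ k

section

variable {r a b : Pt → ℝ} (hr : ContDiff ℝ ∞ r) (ha : ContDiff ℝ ∞ a) (hb : ContDiff ℝ ∞ b)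

include hr ha hb

theorem pds_nambu {c : ℕ} (hc : c < 4) (l : List (Fin 4)) (i j : Fin 4) (x : Pt) :
    pds l (fun y => nambu r a b y i j) x = evalSymbol (block c) (letterContent 4 r a b)
      ((l.map (totalDer (block c))).prod * nambuSymbol c (basisVector i) (basisVector j)) x := by
  rw [nambu_eq_evalSymbol hc, pds_evalSymbol (contDiff_letterContent hr ha hb 4)]

theorem pds_nambu_mul (l₀ l₁ l₂ l₃ : List (Fin 4)) (i₀ j₀ i₁ j₁ i₂ j₂ i₃ j₃ : Fin 4) (x : Pt) :
    pds l₀ (fun y => nambu r a b y i₀ j₀) x * pds l₁ (fun y => nambu r a b y i₁ j₁) x *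
      pds l₂ (fun y => nambu r a b y i₂ j₂) x * pds l₃ (fun y => nambu r a b y i₃ j₃) x =
      evalSymbol (letters 4) (letterContent 4 r a b)
        ((l₀.map (totalDer (block 0))).prod * nambuSymbol 0 (basisVector i₀) (basisVector j₀) *
        ((l₁.map (totalDer (block 1))).prod * nambuSymbol 1 (basisVector i₁) (basisVector j₁)) *
        ((l₂.map (totalDer (block 2))).prod * nambuSymbol 2 (basisVector i₂) (basisVector j₂)) *
        ((l₃.map (totalDer (block 3))).prod * nambuSymbol 3 (basisVector i₃) (basisVector j₃)))
        x := by
  rw [pds_nambu hr ha hb (c := 0) (by decide), pds_nambu hr ha hb (c := 1) (by decide),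
    pds_nambu hr ha hb (c := 2) (by decide), pds_nambu hr ha hb (c := 3) (by decide)]
  exact evalSymbol_blocks _ (derivatives_mem _ _ _ _) (derivatives_mem _ _ _ _)
    (derivatives_mem _ _ _ _) (derivatives_mem _ _ _ _) x

theorem tetraOne_nambu (x : Pt) (i j : Fin 4) : tetraOne (nambu r a b) x i j =
    evalSymbol (letters 4) (letterContent 4 r a b)
      (nambuSymbol 0 (basisVector i) (basisVector j) *
      nambuSymbol 1 (totalDer (block 0)) (totalDer (block 3)) *
      nambuSymbol 2 (totalDer (block 0)) (totalDer (block 1)) *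
      nambuSymbol 3 (totalDer (block 0)) (totalDer (block 2))) x := by
  let E : Symbol →ₗ[ℝ] ℝ :=
    (LinearMap.proj x).comp (evalSymbol (letters 4) (letterContent 4 r a b))
  have h : ∀ k l m k' l' m', pds [k, l, m] (fun y => nambu r a b y i j) x *
      pd l' (fun y => nambu r a b y k k') x * pd m' (fun y => nambu r a b y l l') x *
      pd k' (fun y => nambu r a b y m m') x =
      E (nambuSymbol 0 (basisVector i) (basisVector j) *
        ((totalDer (block 0) k * totalDer (block 0) l * totalDer (block 0) m) *
        (totalDer (block 3) k' * nambuSymbol 1 (basisVector k) (basisVector k') *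
        (totalDer (block 1) l' * nambuSymbol 2 (basisVector l) (basisVector l')) *
        (totalDer (block 2) m' * nambuSymbol 3 (basisVector m) (basisVector m'))))) := by
    intro k l m k' l' m'
    refine (pds_nambu_mul hr ha hb [k, l, m] [l'] [m'] [k'] i j k k' l l' m m' x).trans ?_
    refine congrArg E ?_
    simp only [List.map_cons, List.map_nil, List.prod_cons, List.prod_nil, mul_one]
    ring
  simp only [tetraOne, h, ← map_sum, ← Finset.mul_sum, ← Finset.sum_mul, sum_nambuSymbol_right]
  refine congrArg E ?_
  have h' : ∀ k l m, totalDer (block 0) k * totalDer (block 0) l * totalDer (block 0) m *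
      (nambuSymbol 1 (basisVector k) (totalDer (block 3)) *
        nambuSymbol 2 (basisVector l) (totalDer (block 1)) *
        nambuSymbol 3 (basisVector m) (totalDer (block 2))) =
      totalDer (block 0) k * nambuSymbol 1 (basisVector k) (totalDer (block 3)) *
      (totalDer (block 0) l * nambuSymbol 2 (basisVector l) (totalDer (block 1))) *
      (totalDer (block 0) m * nambuSymbol 3 (basisVector m) (totalDer (block 2))) := by
    intro k l m; ring
  simp only [h', ← Finset.mul_sum, ← Finset.sum_mul, sum_nambuSymbol_left]
  ring

theorem tetraTwo_nambu (x : Pt) (i j : Fin 4) : tetraTwo (nambu r a b) x i j =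
    evalSymbol (letters 4) (letterContent 4 r a b)
      (nambuSymbol 0 (basisVector i) (totalDer (block 3)) *
      nambuSymbol 1 (totalDer (block 0)) (basisVector j) *
      nambuSymbol 2 (totalDer (block 1)) (totalDer (block 0)) *
      nambuSymbol 3 (totalDer (block 2)) (totalDer (block 1))) x := by
  let E : Symbol →ₗ[ℝ] ℝ :=
    (LinearMap.proj x).comp (evalSymbol (letters 4) (letterContent 4 r a b))
  have h : ∀ n k l k' l' m', pds [k, l] (fun y => nambu r a b y i n) x *
      pds [k', l'] (fun y => nambu r a b y k j) x * pd m' (fun y => nambu r a b y k' l) x *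
      pd n (fun y => nambu r a b y m' l') x =
      E ((totalDer (block 3) n * nambuSymbol 0 (basisVector i) (basisVector n)) *
        (totalDer (block 0) k * nambuSymbol 1 (basisVector k) (basisVector j)) *
        (totalDer (block 0) l *
        (totalDer (block 1) k' * nambuSymbol 2 (basisVector k') (basisVector l) *
        (totalDer (block 1) l' *
        (totalDer (block 2) m' * nambuSymbol 3 (basisVector m') (basisVector l')))))) := by
    intro n k l k' l' m'
    refine (pds_nambu_mul hr ha hb [k, l] [k', l'] [m'] [n] i n k j k' l m' l' x).trans ?_
    refine congrArg E ?_
    simp only [List.map_cons, List.map_nil, List.prod_cons, List.prod_nil, mul_one]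
    ring
  simp only [tetraTwo, h, ← map_sum, ← Finset.mul_sum, ← Finset.sum_mul, sum_nambuSymbol_right,
    sum_nambuSymbol_left]
  refine congrArg E ?_
  simp only [← mul_assoc, ← Finset.sum_mul, sum_nambuSymbol_right]

end


theorem covectorSum_zero (i j : Fin 4) : covectorSum i j [0] = basisVector i := by
  funext k; simp [covectorSum, covector, basisVector]

theorem covectorSum_one (i j : Fin 4) : covectorSum i j [1] = basisVector j := by
  funext k; simp [covectorSum, covector, basisVector]

theorem totalDer_block (c : ℕ) : totalDer (block c) =
    fun k => MvPolynomial.X (2 + c, k) + (MvPolynomial.X (6 + c, k) +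
      MvPolynomial.X (10 + c, k)) := by
  funext k
  rw [totalDer, block, Finset.sum_insert (by simp), Finset.sum_insert (by simp),
    Finset.sum_singleton]

theorem covectorSum_letter (i j : Fin 4) {l : ℕ} (h₀ : l ≠ 0) (h₁ : l ≠ 1) :
    covectorSum i j [l] = fun k => MvPolynomial.X (l, k) := by
  funext k; simp [covectorSum, covector, h₀, h₁]

theorem covectorSum_block (i j : Fin 4) (c : ℕ) :
    covectorSum i j [2 + c, 6 + c, 10 + c] = totalDer (block c) := by
  rw [totalDer_block]
  funext k
  simp [covectorSum, covector, show 2 + c ≠ 1 by omega, show 6 + c ≠ 1 by omega,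
    show 10 + c ≠ 1 by omega]

theorem nambuRow_symbol (i j : Fin 4) (c : ℕ) (u v : List ℕ) :
    SumRow.symbol i j ⟨u, v, [6 + c], [10 + c]⟩ =
      nambuSymbol c (covectorSum i j u) (covectorSum i j v) := by
  rw [SumRow.symbol, covectorSum_letter i j (by omega) (by omega),
    covectorSum_letter i j (by omega) (by omega), nambuSymbol]

theorem tetraFlow_nambu {r a b : Pt → ℝ} (hr : ContDiff ℝ ∞ r) (ha : ContDiff ℝ ∞ a)
    (hb : ContDiff ℝ ∞ b) (x : Pt) (i j : Fin 4) (c : ℤ) :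
    c * tetraFlow (nambu r a b) x i j =
      GraphFunctional.eval (value 4 r a b x i j) (tetraSum c) := by
  have h := covectorSum_block i j
  have hrow := nambuRow_symbol i j
  have hs : sumSymbol i j (tetraSum c) =
      ((-8 * c : ℤ) : ℝ) • (nambuSymbol 0 (basisVector i) (basisVector j) *
        nambuSymbol 1 (totalDer (block 0)) (totalDer (block 3)) *
        nambuSymbol 2 (totalDer (block 0)) (totalDer (block 1)) *
        nambuSymbol 3 (totalDer (block 0)) (totalDer (block 2))) +
      (((-24 * c : ℤ) : ℝ) • (nambuSymbol 0 (basisVector i) (totalDer (block 3)) *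
        nambuSymbol 1 (totalDer (block 0)) (basisVector j) *
        nambuSymbol 2 (totalDer (block 1)) (totalDer (block 0)) *
        nambuSymbol 3 (totalDer (block 2)) (totalDer (block 1))) +
      ((24 * c : ℤ) : ℝ) • (nambuSymbol 0 (basisVector j) (totalDer (block 3)) *
        nambuSymbol 1 (totalDer (block 0)) (basisVector i) *
        nambuSymbol 2 (totalDer (block 1)) (totalDer (block 0)) *
        nambuSymbol 3 (totalDer (block 2)) (totalDer (block 1)))) := by
    rw [tetraSum, sumSymbol_append, sumSymbol_append, sumSymbol_expand, sumSymbol_expand,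
      sumSymbol_expand]
    simp only [List.map_cons, List.map_nil, List.prod_cons, List.prod_nil, mul_one]
    rw [hrow 0, hrow 1, hrow 2, hrow 3, hrow 0, hrow 1, hrow 2, hrow 3, hrow 0,
        hrow 1, covectorSum_zero, covectorSum_one, h 0, h 1, h 2, h 3]
    simp only [mul_assoc]
  rw [eval_value, hs]
  simp only [map_add, map_smul, Pi.add_apply, Pi.smul_apply, smul_eq_mul]
  rw [← tetraOne_nambu hr ha hb, ← tetraTwo_nambu hr ha hb, ← tetraTwo_nambu hr ha hb, tetraFlow]
  push_cast
  ring

/-! ### The Schouten bracket with a graph -/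

/-- The covector of a letter of a function. -/
def letterVector (l : ℕ) (k : Fin 4) : Symbol := MvPolynomial.X (l, k)

/-- The letters of a bracket belong to the functions of a graph. -/
def Row.Inner (r : Row) : Prop :=
  r.a ∈ letters 3 ∧ r.b ∈ letters 3 ∧ r.c ∈ letters 3 ∧ r.d ∈ letters 3

/-- A graph whose only edge into the sink is the first one. -/
inductive Rooted : List Row → Prop
  | mk (p q s : ℕ) (g : List Row) (hp : p ∈ letters 3) (hq : q ∈ letters 3) (hs : s ∈ letters 3)
      (hg : ∀ r ∈ g, r.Inner) : Rooted (⟨0, p, q, s⟩ :: g)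

/-- The symbol of a graph with the first entry replaced by a covector. -/
def rootSymbol (u : Fin 4 → Symbol) : List Row → Symbol
  | [] => 0
  | r :: g => Matrix.det (Matrix.of ![u, letterVector r.b, letterVector r.c, letterVector r.d]) *
      (g.map fun r => Matrix.det (Matrix.of ![letterVector r.a, letterVector r.b,
        letterVector r.c, letterVector r.d])).prod

theorem covector_eq_letterVector {l : ℕ} (hl : l ∈ letters 3) (i j : Fin 4) :
    covector i j l = letterVector l := by
  funext k
  have h := mem_letters.1 hl
  have h₀ : l ≠ 0 := by rintro rfl; simp [kind] at h
  have h₁ : l ≠ 1 := by rintro rfl; simp [kind] at h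
  simp [covector, letterVector, h₀, h₁]

theorem covectorSum_eq_letterVector {l : ℕ} (hl : l ∈ letters 3) (i j : Fin 4) :
    covectorSum i j [l] = letterVector l := by
  rw [← covector_eq_letterVector hl i j]
  funext k; simp [covectorSum]

theorem ne_zero_of_mem_letters {l : ℕ} (hl : l ∈ letters 3) : l ≠ 0 := by
  have h := mem_letters.1 hl
  rintro rfl; simp [kind] at h

theorem graphSymbol_rooted {g : List Row} (hg : Rooted g) (i j : Fin 4) :
    graphSymbol i j g = rootSymbol (basisVector i) g := by
  obtain ⟨p, q, s, g, hp, hq, hs, hg⟩ := hg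
  have h₀ : covector i j 0 = basisVector i := by funext k; simp [covector, basisVector]
  rw [graphSymbol, rootSymbol, List.map_cons, List.prod_cons, Row.symbol, h₀,
    covector_eq_letterVector hp, covector_eq_letterVector hq, covector_eq_letterVector hs]
  refine congrArg (_ * List.prod ·) ?_
  refine List.map_congr_left fun r hr => ?_
  obtain ⟨h₁, h₂, h₃, h₄⟩ := hg r hr
  rw [Row.symbol, covector_eq_letterVector h₁, covector_eq_letterVector h₂,
    covector_eq_letterVector h₃, covector_eq_letterVector h₄]

theorem singles_rooted {g : List Row} (hg : Rooted g) (i j : Fin 4) {f : ℕ → List ℕ}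
    (hf : ∀ l ≠ 0, f l = [l]) :
    ((g.map fun r => singles r f).map (SumRow.symbol i j)).prod =
      rootSymbol (covectorSum i j (f 0)) g := by
  obtain ⟨p, q, s, g, hp, hq, hs, hg⟩ := hg
  rw [List.map_cons, List.map_cons, List.prod_cons, rootSymbol, singles, SumRow.symbol,
    List.map_map, hf p (ne_zero_of_mem_letters hp), hf q (ne_zero_of_mem_letters hq),
    hf s (ne_zero_of_mem_letters hs), covectorSum_eq_letterVector hp,
    covectorSum_eq_letterVector hq, covectorSum_eq_letterVector hs]
  refine congrArg (_ * List.prod ·) ?_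
  refine List.map_congr_left fun r hr => ?_
  obtain ⟨h₁, h₂, h₃, h₄⟩ := hg r hr
  rw [Function.comp, singles, SumRow.symbol, hf _ (ne_zero_of_mem_letters h₁),
    hf _ (ne_zero_of_mem_letters h₂), hf _ (ne_zero_of_mem_letters h₃),
    hf _ (ne_zero_of_mem_letters h₄), covectorSum_eq_letterVector h₁,
    covectorSum_eq_letterVector h₂, covectorSum_eq_letterVector h₃,
    covectorSum_eq_letterVector h₄]

theorem sum_rootSymbol (u : Fin 4 → Symbol) (g : List Row) :
    ∑ k, u k * rootSymbol (basisVector k) g = rootSymbol u g := by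
  cases g with
  | nil => simp [rootSymbol]
  | cons r g =>
    simp only [rootSymbol, ← mul_assoc, ← Finset.sum_mul]
    refine congrArg (· * _) ?_
    simp only [det_explicit, Fin.sum_univ_four]
    simp [basisVector]
    ring

theorem rootSymbol_mem {g : List Row} (hg : Rooted g) (i : Fin 4) :
    rootSymbol (basisVector i) g ∈ symbols (letters 3) := by
  obtain ⟨p, q, s, g, hp, hq, hs, hg⟩ := hg
  refine (symbols _).mul_mem (det_mem (basisVector_mem _ i) (X_mem_symbols hp)
    (X_mem_symbols hq) (X_mem_symbols hs)) (Subalgebra.list_prod_mem _ fun y hy => ?_)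
  obtain ⟨r, hr, rfl⟩ := List.mem_map.1 hy
  obtain ⟨h₁, h₂, h₃, h₄⟩ := hg r hr
  exact det_mem (X_mem_symbols h₁) (X_mem_symbols h₂) (X_mem_symbols h₃) (X_mem_symbols h₄)

theorem schouten_graph {r a b : Pt → ℝ} (hr : ContDiff ℝ ∞ r) (ha : ContDiff ℝ ∞ a)
    (hb : ContDiff ℝ ∞ b) {X : VectorField} {g : List Row} (hg : Rooted g)
    (hX : ∀ k, (fun x => X x k) = evalSymbol (letters 3) (letterContent 4 r a b)
      (rootSymbol (basisVector k) g)) (x : Pt) (i j : Fin 4) (c : ℤ) :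
    c * schouten (nambu r a b) X x i j =
      GraphFunctional.eval (value 4 r a b x i j) (schoutenSum c g) := by
  have hF := contDiff_letterContent hr ha hb 4
  let E : Symbol →ₗ[ℝ] ℝ :=
    (LinearMap.proj x).comp (evalSymbol (letters 4) (letterContent 4 r a b))
  have hE : ∀ p q, p ∈ symbols (letters 3) → q ∈ symbols (block 3) →
      evalSymbol (letters 3) (letterContent 4 r a b) p x *
        evalSymbol (block 3) (letterContent 4 r a b) q x = E (p * q) := by
    intro p q hp hq
    have h : letters 4 = letters 3 ∪ block 3 := by decide
    simp only [E, LinearMap.comp_apply, LinearMap.proj_apply]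
    rw [h, ← evalSymbol_mul (by decide) hp hq]
    rfl
  have hX' : ∀ k x, X x k = evalSymbol (letters 3) (letterContent 4 r a b)
      (rootSymbol (basisVector k) g) x := fun k x => congrFun (hX k) x
  have hN : ∀ i j x, nambu r a b x i j = evalSymbol (block 3) (letterContent 4 r a b)
      (nambuSymbol 3 (basisVector i) (basisVector j)) x :=
    fun i j x => congrFun (nambu_eq_evalSymbol (by decide) r a b i j) x
  have hA : ∀ k, X x k * pd k (fun y => nambu r a b y i j) x =
      E (totalDer (block 3) k * rootSymbol (basisVector k) g *
        nambuSymbol 3 (basisVector i) (basisVector j)) := by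
    intro k
    rw [nambu_eq_evalSymbol (c := 3) (by decide), pd_evalSymbol hF, hX', hE _ _
      (rootSymbol_mem hg k) ((symbols _).mul_mem (totalDer_mem _ k) (nambuSymbol_mem 3 i j))]
    refine congrArg E ?_
    ring
  have hB : ∀ k i j l, nambu r a b x i j * pd k (fun y => X y l) x = E (totalDer (letters 3) k *
      nambuSymbol 3 (basisVector i) (basisVector j) * rootSymbol (basisVector l) g) := by
    intro k i j l
    rw [hX, pd_evalSymbol hF, hN, mul_comm, hE _ _ ((symbols _).mul_mem (totalDer_mem _ k)
      (rootSymbol_mem hg l)) (nambuSymbol_mem 3 i j)]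
    refine congrArg E ?_
    ring
  have hs : sumSymbol i j (schoutenSum c g) =
      ((-c : ℤ) : ℝ) • (nambuSymbol 3 (basisVector i) (basisVector j) *
        rootSymbol (totalDer (block 3)) g) +
      ((c : ℝ) • (nambuSymbol 3 (totalDer (letters 3)) (basisVector j) *
        rootSymbol (basisVector i) g) +
      (c : ℝ) • (nambuSymbol 3 (basisVector i) (totalDer (letters 3)) *
        rootSymbol (basisVector j) g)) := by
    have hl : covectorSum i j [2, 3, 4, 6, 7, 8, 10, 11, 12] = totalDer (letters 3) := by
      funext k
      have h : letters 3 = {2, 3, 4, 6, 7, 8, 10, 11, 12} := by decide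
      rw [totalDer, h]
      simp [covectorSum, covector]
    rw [schoutenSum, sumSymbol_append, sumSymbol_append, sumSymbol_expand, sumSymbol_expand,
      sumSymbol_expand, List.map_cons, List.prod_cons, List.map_cons, List.prod_cons,
      List.map_cons, List.prod_cons, singles_rooted hg i j (fun l hl => if_neg hl),
      singles_rooted hg i j (fun l _ => rfl), singles_rooted hg i j (fun l hl => if_neg hl),
      nambuRow_symbol i j 3, nambuRow_symbol i j 3, nambuRow_symbol i j 3, if_pos rfl, if_pos rfl,
      covectorSum_block i j 3, hl, covectorSum_zero, covectorSum_one]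
  rw [eval_value, hs, schouten, lieDeriv]
  simp only [hA, hB, Finset.sum_sub_distrib, ← map_sum]
  simp only [← Finset.sum_mul, sum_rootSymbol, sum_nambuSymbol_left, sum_nambuSymbol_right]
  change c * -(_ - _ - _) = E _
  simp only [map_add, map_smul, smul_eq_mul, mul_comm (rootSymbol (totalDer (block 3)) g)]
  push_cast
  ring


/-! ### Formulas of micro-graphs -/

/-- The letter of a vertex of a micro-graph. -/
def letter (v : Fin 10) : ℕ :=
  if v.val = 0 then 0 else if v.val ≤ 3 then v.val + 1 else if v.val ≤ 6 then v.val + 2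
  else v.val + 3

/-- The brackets of a micro-graph. -/
def graphRows (G : Graph) : List Row :=
  (List.finRange 3).map fun v => ⟨letter (G v 0), letter (G v 1), letter (G v 2), letter (G v 3)⟩

/-- The sink has one incoming edge, the first one. -/
def SinkFirst (G : Graph) : Prop := ∀ v e, G v e = 0 ↔ v = 0 ∧ e = 0

theorem evalSymbol_prod_X (W : Finset ℕ) (F : ℕ → Pt → ℝ) (l : List (ℕ × Fin 4)) (x : Pt) :
    evalSymbol W F (l.map MvPolynomial.X).prod x =
      ∏ w ∈ W, der (((l.filter (·.1 = w)).map Prod.snd : List (Fin 4))) (F w) x := by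
  have h₁ : (l.map MvPolynomial.X).prod =
      (MvPolynomial.monomial (l.map fun v => Finsupp.single v 1).sum 1 : Symbol) := by
    induction l with
    | nil => simp
    | cons v l ih =>
      simp only [List.map_cons, List.prod_cons, ih, List.sum_cons, MvPolynomial.X,
        MvPolynomial.monomial_mul, one_mul]
  have h₂ : ∀ (l : List (ℕ × Fin 4)) w, directions w (l.map fun v => Finsupp.single v 1).sum =
      ((l.filter (·.1 = w)).map Prod.snd : List (Fin 4)) := by
    intro l w
    induction l with
    | nil => simp [directions]
    | cons v l ih =>
      rw [List.map_cons, List.sum_cons, directions_add, directions_single, ih, List.filter_cons]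
      by_cases h : v.1 = w <;> simp [h]
  rw [h₁, evalSymbol_monomial, one_smul, evalMonomial]
  simp only [h₂]

def innerEdges : List (Fin 3 × Fin 4) := (List.finRange 3 ×ˢ List.finRange 4).tail

theorem edges_eq : List.finRange 3 ×ˢ List.finRange 4 = (0, 0) :: innerEdges := rfl

theorem prod_edges {M : Type} [CommMonoid M] (f : Fin 3 → Fin 4 → M) :
    ∏ v, ∏ e, f v e = f 0 0 * (innerEdges.map fun e => f e.1 e.2).prod := by
  have h : innerEdges = [(0, 1), (0, 2), (0, 3), (1, 0), (1, 1), (1, 2), (1, 3), (2, 0), (2, 1),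
    (2, 2), (2, 3)] := by decide
  rw [h]
  simp [Fin.prod_univ_succ, mul_assoc]

theorem letter_injective : Function.Injective letter := by decide

theorem SinkFirst.inner_ne_zero {G : Graph} (hG : SinkFirst G) {e : Fin 3 × Fin 4}
    (he : e ∈ innerEdges) : G e.1 e.2 ≠ 0 := by
  have h : ∀ e ∈ innerEdges, ¬(e.1 = 0 ∧ e.2 = 0) := by decide
  exact fun h' => h e he ((hG _ _).1 h')

theorem letter_ne {w : Fin 10} (hw : w ≠ 0) : letter w ≠ 0 ∧ letter w ≠ 1 := by
  revert w; decide

theorem kind_letter {w : Fin 10} (hw : w ≠ 0) :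
    kind 3 (letter w) = if w.val ≤ 3 then 0 else if w.val ≤ 6 then 1 else 2 := by
  revert w; decide

theorem letters_eq_image : letters 3 = (Finset.univ.erase (0 : Fin 10)).image letter := by decide

theorem prod_covector {G : Graph} (hG : SinkFirst G) (m j : Fin 4) (I : Fin 3 → Fin 4 → Fin 4) :
    ∏ v, ∏ e, covector m j (letter (G v e)) (I v e) =
      if I 0 0 = m then ((innerEdges.map fun e => (letter (G e.1 e.2), I e.1 e.2)).map
        MvPolynomial.X).prod else 0 := by
  rw [prod_edges, (hG 0 0).2 ⟨rfl, rfl⟩, List.map_map]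
  have h : innerEdges.map (fun e => covector m j (letter (G e.1 e.2)) (I e.1 e.2)) =
      innerEdges.map (MvPolynomial.X ∘ fun e => (letter (G e.1 e.2), I e.1 e.2)) := by
    refine List.map_congr_left fun e he => ?_
    obtain ⟨h₀, h₁⟩ := letter_ne (hG.inner_ne_zero he)
    simp [covector, h₀, h₁]
  rw [h]
  simp [covector, letter]

theorem incoming_zero {G : Graph} (hG : SinkFirst G) (I : Fin 3 → Fin 4 → Fin 4) :
    incoming G I 0 = [I 0 0] := by
  rw [incoming, edges_eq, List.filter_cons, if_pos (by simpa using (hG 0 0).2 ⟨rfl, rfl⟩),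
    List.filter_eq_nil_iff.2]
  · rfl
  · intro e he
    simpa using hG.inner_ne_zero he

theorem incoming_ne_zero {G : Graph} (hG : SinkFirst G) (I : Fin 3 → Fin 4 → Fin 4) {w : Fin 10}
    (hw : w ≠ 0) : incoming G I w = ((innerEdges.map fun e =>
      (letter (G e.1 e.2), I e.1 e.2)).filter (·.1 = letter w)).map Prod.snd := by
  have h : G 0 0 ≠ w := by rw [(hG 0 0).2 ⟨rfl, rfl⟩]; exact hw.symm
  rw [incoming, edges_eq, List.filter_cons, if_neg (by simpa using h), List.filter_map,
    List.map_map]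
  simp [Function.comp_def, letter_injective.eq_iff]

theorem graphSymbol_graphRows (G : Graph) (m j : Fin 4) : graphSymbol m j (graphRows G) =
    ∑ s : Fin 3 → Equiv.Perm (Fin 4), (∏ v, ((Equiv.Perm.sign (s v) : ℤ) : ℝ)) •
      ∏ v, ∏ e, covector m j (letter (G v e)) (s v e) := by
  have h : ∀ v : Fin 3, Row.symbol m j
      ⟨letter (G v 0), letter (G v 1), letter (G v 2), letter (G v 3)⟩ =
      ∑ σ : Equiv.Perm (Fin 4), ((Equiv.Perm.sign σ : ℤ) : ℝ) •
        ∏ e, covector m j (letter (G v e)) (σ e) := by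
    intro v
    rw [Row.symbol, ← Matrix.det_transpose, Matrix.det_apply]
    refine Finset.sum_congr rfl fun σ _ => ?_
    rw [Units.smul_def, ← Int.cast_smul_eq_zsmul ℝ]
    congr 1
  rw [graphSymbol, graphRows, List.map_map, ← Fin.prod_univ_def]
  simp only [Function.comp_def, h]
  rw [Finset.prod_univ_sum, Fintype.piFinset_univ]
  exact Finset.sum_congr rfl fun s _ => Finset.prod_smul ..

theorem formula_eq_evalSymbol {G : Graph} (hG : SinkFirst G) {r a b : Pt → ℝ}
    (hr : ContDiff ℝ ∞ r) (ha : ContDiff ℝ ∞ a) (hb : ContDiff ℝ ∞ b) (x : Pt) (m j : Fin 4) :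
    formula G r a b x m = value 3 r a b x m j (graphRows G) := by
  rw [formula, value, graphSymbol_graphRows, map_sum, Finset.sum_apply]
  refine Finset.sum_congr rfl fun s _ => ?_
  rw [map_smul, prod_covector hG, incoming_zero hG, Pi.smul_apply, smul_eq_mul]
  by_cases h : s 0 0 = m
  · rw [if_pos (by rw [h]), if_pos h, evalSymbol_prod_X, letters_eq_image,
      Finset.prod_image fun _ _ _ _ h => letter_injective h]
    congr 1
    refine Finset.prod_congr rfl fun w hw => ?_
    have hw := Finset.ne_of_mem_erase hw
    have hc : content r a b w = letterContent 3 r a b (letter w) := by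
      rw [content, letterContent, kind_letter hw]
      split_ifs <;> simp_all
    have hs : ContDiff ℝ ∞ (content r a b w) := hc ▸ contDiff_letterContent hr ha hb _ _
    rw [incoming_ne_zero hG _ hw, pds_eq_der hs, hc]
  · rw [if_neg (by simpa using h), if_neg h, map_zero]
    simp


/-! ### Skew pairs -/

theorem SinkFirst.swapCasimirs {G : Graph} (hG : SinkFirst G) : SinkFirst (swapCasimirs G) := by
  intro v e
  have h : ∀ w, swapVertex w = 0 ↔ w = 0 := by decide
  rw [← hG v e, NambuFlow.swapCasimirs, h]

/-- The exchange of the Casimir letters of a micro-graph. -/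
def exchangeLetter (l : ℕ) : ℕ :=
  if 6 ≤ l ∧ l ≤ 8 then l + 4 else if 10 ≤ l ∧ l ≤ 12 then l - 4 else l

theorem graphRows_swapCasimirs (G : Graph) :
    graphRows (swapCasimirs G) = (graphRows G).map (Row.map exchangeLetter) := by
  have h : ∀ w, letter (swapVertex w) = exchangeLetter (letter w) := by decide
  simp [graphRows, Row.map, swapCasimirs, h]

theorem value_exchange (r a b : Pt → ℝ) (x : Pt) (i j : Fin 4) (g : List Row) :
    value 3 r a b x i j (g.map (Row.map exchangeLetter)) = value 3 r b a x i j g := by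
  refine value_map (τ := swapKind) (fun k => ?_) (fun k hk => ?_) (fun l l' h => ?_) (fun l => ?_)
    (fun k hk => ?_) x i j g
  · unfold swapKind; split_ifs <;> omega
  · unfold swapKind; split_ifs <;> omega
  · unfold exchangeLetter at h; split_ifs at h <;> omega
  · rcases lt_or_ge l 14 with hl | hl
    · interval_cases l <;> decide
    · rw [exchangeLetter, if_neg (by omega), if_neg (by omega), kind, if_neg (by omega), swapKind,
        if_neg (by omega), if_neg (by omega)]
  · interval_cases k <;> simp [swapKind]

theorem phi_apply {G : Graph} (hG : SinkFirst G) (r a b : Smooth) (x : Pt) (m j : Fin 4) :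
    phi G r a b x m = value 3 r.1 a.1 b.1 x m j (graphRows G) :=
  formula_eq_evalSymbol hG r.2 a.2 b.2 x m j

theorem phi_swapCasimirs {G : Graph} (hG : SinkFirst G) (r a b : Smooth) :
    phi (swapCasimirs G) r a b = phi G r b a := by
  funext x m
  rw [phi_apply hG.swapCasimirs r a b x m m, phi_apply hG r b a x m m, graphRows_swapCasimirs,
    value_exchange]

theorem skewPair_apply {G : Graph} (hG : SinkFirst G) (r a b : Smooth) (x : Pt) (m : Fin 4) :
    skewPair G r a b x m = 1 / 2 * pairValue 3 (-1) r.1 a.1 b.1 x m m (graphRows G) := by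
  change (1 / 2 : ℝ) * (phi G r a b x m - phi (swapCasimirs G) r a b x m) = _
  rw [phi_swapCasimirs hG, phi_apply hG r a b x m m, phi_apply hG r b a x m m, pairValue]
  push_cast
  ring

/-- A vector field with smooth components. -/
def SmoothField (X : VectorField) : Prop := ∀ k, ContDiff ℝ ∞ fun x => X x k

theorem smoothField_phi {G : Graph} (hG : SinkFirst G) (r a b : Smooth) :
    SmoothField (phi G r a b) := by
  intro k
  have h : (fun x => phi G r a b x k) =
      evalSymbol (letters 3) (letterContent 3 r.1 a.1 b.1) (graphSymbol k k (graphRows G)) := by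
    funext x
    exact phi_apply hG r a b x k k
  rw [h]
  exact contDiff_evalSymbol (contDiff_letterContent r.2 a.2 b.2 3) _

theorem SmoothField.add {X Y : VectorField} (hX : SmoothField X) (hY : SmoothField Y) :
    SmoothField (X + Y) := fun k => (hX k).add (hY k)

theorem SmoothField.smul {X : VectorField} (hX : SmoothField X) (c : ℝ) :
    SmoothField (c • X) := fun k => contDiff_const.mul (hX k)

theorem smoothField_zero : SmoothField 0 := fun _ => contDiff_const

theorem schouten_add (P : BivectorField) {X Y : VectorField} (hX : SmoothField X)
    (hY : SmoothField Y) : schouten P (X + Y) = schouten P X + schouten P Y := by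
  funext x i j
  have h : ∀ k l, pd k (fun y => (X + Y) y l) x =
      pd k (fun y => X y l) x + pd k (fun y => Y y l) x := fun k l =>
    congrFun (pd_add (hX l) (hY l) k) x
  change _ = schouten P X x i j + schouten P Y x i j
  simp only [schouten, lieDeriv, h, ← neg_add, ← Finset.sum_add_distrib]
  refine congrArg Neg.neg (Finset.sum_congr rfl fun k _ => ?_)
  change (X x k + Y x k) * _ - _ - _ = _
  ring

theorem schouten_smul (P : BivectorField) {X : VectorField} (hX : SmoothField X) (c : ℝ) :
    schouten P (c • X) = c • schouten P X := by
  funext x i j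
  have h : ∀ k l, pd k (fun y => (c • X) y l) x = c * pd k (fun y => X y l) x := fun k l =>
    congrFun (pd_smul (hX l) c k) x
  change _ = c * schouten P X x i j
  simp only [schouten, lieDeriv, h, mul_neg, Finset.mul_sum]
  refine congrArg Neg.neg (Finset.sum_congr rfl fun k _ => ?_)
  change (c * X x k) * _ - _ - _ = _
  ring

theorem schouten_zero (P : BivectorField) : schouten P 0 = 0 := by
  have := schouten_smul P smoothField_zero 0
  simpa using this

theorem pd_neg (k : Fin 4) (f : Pt → ℝ) : pd k (fun y => -f y) = fun y => -pd k f y := by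
  funext x
  change fderiv ℝ (-f) x _ = _
  rw [fderiv_neg]
  rfl

theorem pds_neg (l : List (Fin 4)) (f : Pt → ℝ) : pds l (fun y => -f y) = fun y => -pds l f y := by
  induction l with
  | nil => rfl
  | cons k l ih =>
    change pd k (pds l fun y => -f y) = _
    rw [ih, pd_neg]
    rfl

theorem schouten_neg (P : BivectorField) (X : VectorField) : schouten (-P) X = -schouten P X := by
  funext x i j
  simp only [schouten, lieDeriv, Pi.neg_apply, pd_neg, ← Finset.sum_neg_distrib, neg_neg]
  refine Finset.sum_congr rfl fun k _ => ?_
  ring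

theorem tetraFlow_neg (P : BivectorField) : tetraFlow (-P) = tetraFlow P := by
  funext x i j
  simp only [tetraFlow, tetraOne, tetraTwo, Pi.neg_apply, pd_neg, pds_neg, mul_neg, neg_mul,
    neg_neg]

theorem eval_pairValue (n : ℕ) (ε : ℤ) (r a b : Pt → ℝ) (x : Pt) (i j : Fin 4) (s : FormalSum) :
    GraphFunctional.eval (pairValue n ε r a b x i j) s =
      GraphFunctional.eval (value n r a b x i j) s +
        ε * GraphFunctional.eval (value n r b a x i j) s := by
  induction s with
  | nil => simp [GraphFunctional.eval]
  | cons p s ih =>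
    simp only [GraphFunctional.eval, List.map_cons, List.sum_cons] at ih ⊢
    rw [ih, pairValue]
    ring

theorem eval_append (L : List Row → ℝ) (s t : FormalSum) : GraphFunctional.eval L (s ++ t) =
    GraphFunctional.eval L s + GraphFunctional.eval L t := by simp [GraphFunctional.eval]

theorem rooted_graphRows {G : Graph} (hG : SinkFirst G) : Rooted (graphRows G) := by
  have h : ∀ v e, ¬(v = 0 ∧ e = 0) → letter (G v e) ∈ letters 3 := by
    intro v e hv
    have h : ∀ w : Fin 10, w ≠ 0 → letter w ∈ letters 3 := by decide
    exact h _ (mt (hG v e).1 hv)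
  have h₀ : letter (G 0 0) = 0 := by rw [(hG 0 0).2 ⟨rfl, rfl⟩]; rfl
  have e : graphRows G = ⟨0, letter (G 0 1), letter (G 0 2), letter (G 0 3)⟩ ::
      [⟨letter (G 1 0), letter (G 1 1), letter (G 1 2), letter (G 1 3)⟩,
        ⟨letter (G 2 0), letter (G 2 1), letter (G 2 2), letter (G 2 3)⟩] := by
    rw [← h₀]; rfl
  rw [e]
  refine .mk _ _ _ _ (h _ _ (by decide)) (h _ _ (by decide)) (h _ _ (by decide)) ?_
  simp only [List.mem_cons, List.not_mem_nil, or_false, forall_eq_or_imp, forall_eq, Row.Inner]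
  exact ⟨⟨h _ _ (by decide), h _ _ (by decide), h _ _ (by decide), h _ _ (by decide)⟩,
    h _ _ (by decide), h _ _ (by decide), h _ _ (by decide), h _ _ (by decide)⟩

theorem schouten_phi {G : Graph} (hG : SinkFirst G) (r a b : Smooth) (x : Pt) (i j : Fin 4)
    (c : ℤ) : c * schouten (nambu r.1 a.1 b.1) (phi G r a b) x i j =
      GraphFunctional.eval (value 4 r.1 a.1 b.1 x i j) (schoutenSum c (graphRows G)) := by
  refine schouten_graph r.2 a.2 b.2 (rooted_graphRows hG) (fun k => ?_) x i j c
  funext x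
  rw [phi_apply hG r a b x k k, value, graphSymbol_rooted (rooted_graphRows hG)]
  refine congrFun (evalSymbol_congr (fun w hw => ?_) _) x
  have h : ∀ w ∈ letters 3, kind 3 w = kind 4 w := by decide
  rw [letterContent, letterContent, h w hw]

theorem smoothField_skewPair {G : Graph} (hG : SinkFirst G) (r a b : Smooth) :
    SmoothField (skewPair G r a b) := by
  have h : skewPair G r a b = (1 / 2 : ℝ) • (phi G r a b + (-1 : ℝ) • phi G r b a) := by
    rw [← phi_swapCasimirs hG r a b, neg_one_smul, ← sub_eq_add_neg]
    rfl
  rw [h]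
  exact ((smoothField_phi hG r a b).add ((smoothField_phi hG r b a).smul _)).smul _

theorem schouten_skewPair {G : Graph} (hG : SinkFirst G) (r a b : Smooth) (x : Pt) (i j : Fin 4)
    (c : ℤ) : c * schouten (nambu r.1 a.1 b.1) (skewPair G r a b) x i j =
      1 / 2 * GraphFunctional.eval (pairValue 4 1 r.1 a.1 b.1 x i j)
        (schoutenSum c (graphRows G)) := by
  have h : skewPair G r a b = (1 / 2 : ℝ) • (phi G r a b + (-1 : ℝ) • phi G r b a) := by
    rw [← phi_swapCasimirs hG r a b, neg_one_smul, ← sub_eq_add_neg]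
    rfl
  have hs := smoothField_phi hG r b a
  rw [h, schouten_smul _ ((smoothField_phi hG r a b).add (hs.smul _)),
    schouten_add _ (smoothField_phi hG r a b) (hs.smul _), schouten_smul _ hs, eval_pairValue,
    ← schouten_phi hG r a b, ← schouten_phi hG r b a, nambu_swap r.1 a.1 b.1, schouten_neg]
  simp only [Pi.smul_apply, Pi.add_apply, Pi.neg_apply, smul_eq_mul]
  push_cast
  ring

theorem tetraFlow_pair (r a b : Smooth) (x : Pt) (i j : Fin 4) (c : ℤ) :
    c * tetraFlow (nambu r.1 a.1 b.1) x i j =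
      1 / 2 * GraphFunctional.eval (pairValue 4 1 r.1 a.1 b.1 x i j) (tetraSum c) := by
  rw [eval_pairValue, ← tetraFlow_nambu r.2 a.2 b.2, ← tetraFlow_nambu r.2 b.2 a.2,
    nambu_swap r.1 a.1 b.1, tetraFlow_neg]
  push_cast
  ring


/-! ### Certificates for linear combinations of skew pairs -/

instance (G : Graph) : Decidable (SinkFirst G) :=
  inferInstanceAs (Decidable (∀ v e, G v e = 0 ↔ v = 0 ∧ e = 0))

theorem GraphFunctional.eval_eq_zero {n : ℕ} {ε : ℤ} {L : List Row → ℝ}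
    (hL : GraphFunctional n ε L) (hn : n = 3 ∨ n = 4) (hε : ε * ε = 1) {s : FormalSum}
    {rel ren : List ℕ} (hs : (s.all fun p => wellFormed n p.2) = true)
    (h : certifies n ε s rel ren = true) : GraphFunctional.eval L s = 0 := by
  refine hL.certifies_sound hn hε (fun p hp => ?_) h
  have := List.all_eq_true.1 hs p hp
  simp only [wellFormed, Bool.and_eq_true, List.all_eq_true, Nat.beq_eq, Nat.ble_eq] at this
  refine ⟨this.1, fun r hr => ?_⟩
  obtain ⟨⟨h₁, h₂⟩, h₃, h₄⟩ := this.2 r hr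
  refine ⟨?_, ?_, ?_, ?_⟩ <;> omega

/-- A linear combination of skew pairs. -/
def combination (l : List (ℤ × Graph)) : FieldFormula :=
  (l.map fun p => (p.1 : ℝ) • skewPair p.2).sum

def combinationRows (l : List (ℤ × Graph)) : FormalSum := l.map fun p => (p.1, graphRows p.2)

def combinationSchouten (c : ℤ) (l : List (ℤ × Graph)) : FormalSum :=
  l.flatMap fun p => schoutenSum (c * p.1) (graphRows p.2)

theorem combination_cons (p : ℤ × Graph) (l : List (ℤ × Graph)) :
    combination (p :: l) = (p.1 : ℝ) • skewPair p.2 + combination l := rfl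

/-- The formulas with smooth values. -/
def smoothFormulas : Submodule ℝ FieldFormula where
  carrier := {X | ∀ r a b, SmoothField (X r a b)}
  add_mem' hX hY r a b := (hX r a b).add (hY r a b)
  zero_mem' _ _ _ := smoothField_zero
  smul_mem' c _ hX r a b := (hX r a b).smul c

theorem skewPair_mem_smoothFormulas {G : Graph} (hG : SinkFirst G) :
    skewPair G ∈ smoothFormulas := smoothField_skewPair hG

theorem combination_mem {V : Submodule ℝ FieldFormula} {l : List (ℤ × Graph)}
    (h : ∀ p ∈ l, skewPair p.2 ∈ V) : combination l ∈ V := by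
  refine list_sum_mem fun X hX => ?_
  obtain ⟨p, hp, rfl⟩ := List.mem_map.1 hX
  exact V.smul_mem _ (h p hp)

theorem combination_mem_smoothFormulas {l : List (ℤ × Graph)} (hl : ∀ p ∈ l, SinkFirst p.2) :
    combination l ∈ smoothFormulas :=
  combination_mem fun p hp => skewPair_mem_smoothFormulas (hl p hp)

theorem combination_apply {l : List (ℤ × Graph)} (hl : ∀ p ∈ l, SinkFirst p.2) (r a b : Smooth)
    (x : Pt) (m : Fin 4) : combination l r a b x m = 1 / 2 *
      GraphFunctional.eval (pairValue 3 (-1) r.1 a.1 b.1 x m m) (combinationRows l) := by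
  induction l with
  | nil => simp [combination, combinationRows, GraphFunctional.eval]
  | cons p l ih =>
    have ih := ih fun q hq => hl q (List.mem_cons_of_mem _ hq)
    rw [combination_cons]
    change (p.1 : ℝ) * skewPair p.2 r a b x m + combination l r a b x m = _
    rw [ih, skewPair_apply (hl p List.mem_cons_self)]
    simp only [combinationRows, GraphFunctional.eval, List.map_cons, List.sum_cons]
    ring

theorem schouten_combination {l : List (ℤ × Graph)} (hl : ∀ p ∈ l, SinkFirst p.2)
    (r a b : Smooth) (x : Pt) (i j : Fin 4) (c : ℤ) :
    c * schouten (nambu r.1 a.1 b.1) (combination l r a b) x i j =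
      1 / 2 * GraphFunctional.eval (pairValue 4 1 r.1 a.1 b.1 x i j)
        (combinationSchouten c l) := by
  induction l with
  | nil =>
    have : combination [] r a b = 0 := rfl
    simp [this, schouten_zero, combinationSchouten, GraphFunctional.eval]
  | cons p l ih =>
    have hp := hl p List.mem_cons_self
    have hl := fun q hq => hl q (List.mem_cons_of_mem _ hq)
    have ih := ih hl
    have hs := smoothField_skewPair hp r a b
    have := schouten_skewPair hp r a b x i j (c * p.1)
    rw [combination_cons]
    change c * schouten _ ((p.1 : ℝ) • skewPair p.2 r a b + combination l r a b) x i j = _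
    rw [schouten_add _ (hs.smul _) (combination_mem_smoothFormulas hl r a b),
      schouten_smul _ hs]
    change c * ((p.1 : ℝ) * schouten _ (skewPair p.2 r a b) x i j +
      schouten _ (combination l r a b) x i j) = _
    rw [combinationSchouten, List.flatMap_cons, eval_append, mul_add, mul_add, ← this,
      ← combinationSchouten, ← ih]
    push_cast
    ring

theorem combination_eq_zero {l : List (ℤ × Graph)} {rel ren : List ℕ}
    (hl : ∀ p ∈ l, SinkFirst p.2)
    (hs : ((combinationRows l).all fun p => wellFormed 3 p.2) = true)
    (h : certifies 3 (-1) (combinationRows l) rel ren = true) : combination l = 0 := by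
  funext r a b x m
  rw [combination_apply hl,
    (graphFunctional_pairValue 3 (by norm_num) r.1 a.1 b.1 x m m).eval_eq_zero (.inl rfl)
      (by norm_num) hs h, mul_zero]
  rfl

theorem isOneCocycle_combination {l : List (ℤ × Graph)} {rel ren : List ℕ} (c : ℤ) (hc : c ≠ 0)
    (hl : ∀ p ∈ l, SinkFirst p.2)
    (hs : ((combinationSchouten c l).all fun p => wellFormed 4 p.2) = true)
    (h : certifies 4 1 (combinationSchouten c l) rel ren = true) :
    IsOneCocycle (combination l) := by
  intro r a b
  funext x i j
  have := schouten_combination hl r a b x i j c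
  rw [(graphFunctional_pairValue 4 (by norm_num) r.1 a.1 b.1 x i j).eval_eq_zero
    (.inr rfl) (by norm_num) hs h, mul_zero] at this
  exact (mul_eq_zero.1 this).resolve_left (by exact_mod_cast hc)

theorem trivialises_combination {l : List (ℤ × Graph)} {rel ren : List ℕ}
    (hl : ∀ p ∈ l, SinkFirst p.2)
    (hs : ((tetraSum 1 ++ combinationSchouten (-1) l).all fun p => wellFormed 4 p.2) = true)
    (h : certifies 4 1 (tetraSum 1 ++ combinationSchouten (-1) l) rel ren = true) :
    Trivialises (combination l) := by
  intro r a b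
  funext x i j
  have := (graphFunctional_pairValue 4 (by norm_num) r.1 a.1 b.1 x i j).eval_eq_zero
    (.inr rfl) (by norm_num) hs h
  have h₁ := schouten_combination hl r a b x i j (-1)
  have h₂ := tetraFlow_pair r a b x i j 1
  rw [eval_append] at this
  push_cast at h₁ h₂
  linarith


/-! ### Certificates -/

/-- The micro-graph with a given decimal code of targets. -/
def ofCode (k : ℕ) : Graph := fun v e =>
  Fin.ofNat 10 (digit k (Nat.sub (nat_lit 11) (Nat.add (Nat.mul (nat_lit 4) v.val) e.val)))

def ofCodes (l : List (ℤ × ℕ)) : List (ℤ × Graph) := l.map fun p => (p.1, ofCode p.2)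

theorem sinkFirst_solutionData : ∀ p ∈ solutionData, SinkFirst p.2 := by decide +kernel

def tetraRelations : List ℕ := [
    0x7fd0dba9dc86ba60ca718030dcb9da86ca71ba607fd0dca9ca86db6ab7108030dcb9dba8ca71ba60,
    0x8030cba9dcb6ba81a7608008dcbaa710d69cba867ff0dcb9a610d8acba767fe8cb86a710dca9dba6,
    0x7fd0cba9ba866cada7107fd0dba6cb96ca81ba707fd0cba9ba86ca60db718030cba9cb86ba60da71,
    0x8030cba9ba76ca78d6108030dca7ba97cb68a6107fd0cba9db76ca78a6107fd0cba9dca7b678a610,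
    0x8030ca97cba6ba71d8608030ca97dcb6ba71a8607fd0dca7ca96b760ba818030ca96da76cb7ab810,
    0x7fe8cba9a810d67cba767fd0ba97ca76ba60dc817fd0cb97da76ba60ca817fd0dba7c976ba60ca81,
    0x7fd0dba7cb76ba91a8608018dcb7a810ca69ba767fe8cba6a810697bdca78018da76a810cba7cb96,
    0x8030dcb7a760b861ca988030dca8a760cb79b8618030ba96ca767bada8107fd0ba97db76ba60ca81,
    0x8018dcb8cb76a189a7608018dca8b981c67ba7608030b961a760dc8acb877fd0db87a760ca89cb61,
    0x8018a987a610dcb8cb767fe8db91a760cb87ca868030ca86a760b918dcb78030dcb8cb76a960a871,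
    0x8030da87cb76ba89a6108030dba8ca87b679a6108030dba8c876ba79a6107ff8c876db91cba8a760,
    0x8030cba9ca86a067db618018c876a910dba8ba768018ba76a910db8ac8767fd0da87ba76ba89c610,
    0x7fd0ba96ca81d67ba7607fd0ba76a610cb9adc867fd0cb96ca86ba71da607fd0cba9ca86d067ba61,
    0x7fd0ba96ba76c760da817fd0da76c860ba97ba618030ba97da76cb61a8607fd0dba7ba96c760a861,
    0x8048dcb9ba60da82ca717fe8dca9b610d8acba727fd0ca76a610db9ab8767fd0ca768610dba9ba76,
    0x7fd0cba8a620d9bcba717fe8dcb9a721d8acba608030dca9da82cb71ba608030ca71ba60dc9bda82,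
    0x7fe8cba8a610d9acba727fd0dba9cba8cb72a6107fd0dba9cb82ca71ba608030cba8a721d9bcba60,
    0x8030cba9ba72dc68a6107fd0cb86ba72dca9a6108030dca9cba8b267a6108018cba9cba8da71a620,
    0x7fd0cba9db62ca86a7107fa0dca6a710cb9ab8628030dca6b862c9aba7107fe8cba9cba8a267d610,
    0x8030ba96a710cb28dca67fd0dca6cb82ba96a7107fd0dca6ba96cb82a7107fa0cba9ca86071adb62,
    0x7f70cba9ca86ba62d7107fd0dca6ca82ba96b7107fa0ca86b710da26cba97fd0ca86da62cb9ab710,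
    0x8030ba82a760cb61dca98030dcb9ca86ba61a7208030cba9a7206cadb8618030dca9ba71b620ca86,
    0x7fd0ba82a761cb60dca97fd0cb96ca82da60ba718030cb82ca71da69ba607fd0cba9a8216cadb760,
    0x7fd0cb96da62ca81ba708030cb82ba70da69ca617fd0dca9ba70b621ca868030da96ca82cb60ba71,
    0x7fd0cba6b710da96ca828018cba87610d9acba628018cba97610d6acba827fd0ba96ca62dc81ba70,
    0x8030dba9ca62b760ca818030dca9cb62ba81a7608030dca9b710ba68ca627fe8cba6da827016cba9,
    0x7fa0ca86dba2071acb968018cba2a710c69bda868018cb96a710da86cba28030cb86a710da26cba9,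
    0x8030cb62ba70d9aba8617fd0dba6ba92cb81a7607fd0cb62ba81d9aba7608030dba6cb96ba81a720,
    0x8030dca7b872cb69a6108030cba9b8726c7da6108030dba6ba82ca96a7107fd0ba86ca62d9aba710,
    0x8030db76cb82ca79a6108030b976cb827cada6108030ca97db72cb68a6107fd0cba9db72c678a610,
    0x7fd0ca87a620b761dcb97fd0c976db627baca8107fd0cb97a8106c7dba628030ca76a8107cbdb962,
    0x7fd0cb76db81a026ca978030c876a620ba71dcb97fd0cb96a6207cadb8718030cba9a620b761dc87,
    0x7fd0b872a760cb61dca97fd0ca92a7607cbdb8618030cba9b621a760dc878030cb87b621a760dca9,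
    0x7fd0c972ba716cbda8608030cb92b7617cada8608030ca97b7216cbda8608030cb97dc62a760ba81,
    0x7fd0dc76b972ba60ca818030c962ba607cbda8717fd0a872c761ba60dcb98030c876a721ba60dcb9,
    0x7fe8c976cb82da06ba718030ba71da60cb96c8728030cb96c872ba17da607fd0b976dc81ca72ba60,
    0x7fd0cba9cb76a721d8608030cba7d871c269ba607fd0c976da80ba72cb618030ca76da80b126cb97,
    0x7fe8a761dba0cb97c8627fd0cb97a810d26bca768018cb97a8106a7cdb628030ca76cb92b761da80,
    0x800ccb82da10c67ab9768030cba6d860a721cb977fd0cba686102a7dcb977ff0cba9d810c67ba762,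
    0x7fe8cba7a810d67cb9628030cb76ca76db92a8108018cb62a8106a7bdc977fd0c976cb72da81ba60,
    0x7ff4a876da10cb97cb628018cb62da10c79ab8768018cb62a810697bdca77fd0b876cb72a016dca9,
    0x8030dba9c762ba78a6107fe0cba7d810697cba628060cba6ba727c9d86107fe8cb96a810276dcba7,
    0x8030dba7ba82a610c9768030ba97ca72db68a6107fd0b876ca72d9aba6108030dba7ca97b268a610,
    0x8030dba7c762ba96a8108030dba7ba82c610a9767fd0ba97da72ba68c6108030cb76ba82da79a610,
    0x8030ba97da762b6ca8108030ca76a810b926dba77fd0dba7b9626a7ca8107fd0c762a810dba7ba96,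
    0x7fd0ba97db76a620ca818030ba62c810ba79da768090ba97da76ba62c8108018da76b810ba92ca76,
    0x7fd0dba9ca72a861b7607fd0ca76a8207badb9617fd0dba7a820ba69c7618030da97ca76b620ba81,
    0x8030dba6ba72a860c9718030dba7a821ba69c7608030dba7a962b760ca818030ca62ba81b760da97,
    0x8030ca76a9217badb8607fa0db76ca72ba91a8607fd0db62ca71ba97a8608030cb62ba71da97a860,
    0x7fd0da76b972ba81ca607fd0a976db72ca18ba608030cb72a871da69ba607fd0da76ca72ba91b860,
    0x7fd0ba97ca626b7da8107fd0dba9a610287bca768030da97ba10ca62b8767fd0ca62ba80b761da97,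
    0x7fe8ca76b810d9aba7627fd0db76a862ba79ca107fd0dba7ca10a967b8628030dba7ba76a820c961,
    0x8030ba97ca10d26ba8768030ba76c810da79ba627fd0da76ba76081acb927fb8ca768210dba7ba96,
    0x7fd0dba7ba768016ca928030ca72b610d9aba8768030ba87ca62d9ab76107fe8ba768210dba9ca76,
    0x7fd0ca82b610d7aba9768018ba76b810da97ca628030da97ba76b018ca628030ba76c962dba7a810,
    0x7fe88762ba10dba9ca767fe8dba987620a1bca767fd0ba97b610da76ca828018a976ca82b016dba7,
    0x7fd0cb76a872d9aba6108030ba76c8627a9dba107fe8ba76cb10da97a8627fe88762ca10dba7ba96,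
    0x8018da76ca76ba91a8208018ca76a810da97ba628030db72a860a976cba18018cb76ba10da97a862,
    0x7fe8da87ca87a269b6107fd0da87ba72c689a6107fd0c876ba72da89a6108030ca87b762da89a610,
    0x7fd0db96ca61ba86a7207fd0ba86c620d9aba7617fd0da87a910c867ba628018da879610ca86ba72,
    0x7fd0ba96ba81da62c7608030ba92a861db6ac7607fd0ba92a760db6ac8618030ba86c621d9aba760,
    0x8030ca61ba70d69ab8628030ba96ba70da62c8617fd0ba71ca60d69ab8628030db96ca60ba86a721,
    0x8030cba9ba72061adc838030cba9a610d38cba728060cba9ba72dc83a6107fd0dca9ba72cb83a610,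
    0x7fd0cba8a7319cadb6208030dcb9ca83ba71a6208030cba8a6209cadb7317fd0dca9ca83ba72b610,
    0x7fd0dba9a721cb83ba608030dba9a620cb83ba717fd0da93ca82cb71ba607fd0cb93da82ca71ba60,
    0x7fd0cb83ba72dc69a6107fd0cba9dc83b267a6107fd0dca9cb83b267a6108030dba9ba72ca83a610,
    0x7fd0dc63b862c9aba7107fd0b862a710dcb9ca637fa0ca63b8629cbda7107fd0dc83ba72cb69a610,
    0x8030c863a620d9bcba718030cba9b731a620dc868030cb86b731a620dca97fd0dc63a710cb9ab862,
    0x8030cba9a720b631dc867fd0ca86a720b631dcb97fd0ba83cb71a620dc967fd0dc83ba71cb69a620,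
    0x8030ca93b8216cbda7608030cba6c963072adb818030c863a720ba61dcb97fd0cb93a7206cadb861,
    0x7fd0ca83ba70c621db968030dc83ba70cb69a6217fd0c863a621d9bcba707fd0c863a721ba60dcb9,
    0x7fd0cba9cb63a720d8617fd0cb93ca62ba81d7607fd0cba6ba823c9d76108030cba6c963d07ab821,
    0x8030cba6a862071dcb937fb8cba6d710c39ba86280a8ca83d710cb69ba628090cb63d710c9aba862,
    0x8030dba9ca83b267a6108030cba6dc937620ba818030db83cb62ca96a7107fd0ca96a710d3bcb862,
    0x8030dba9b8623a6ca7108030dba9ba83c601a7628030ca83ba72db69a6108030dba9ba83a601c762,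
    0x8060ba96ca62d38ba7107fd0dba6c862ba93a7107fa0dba6ba93c826a7107fa0ca63b862d9aba710,
    0x7fd0dba6a862b39ac7107fd0da96ca62ba83b7107fd0cb62a710da96ba837fd0ba96ca623b8da710,
    0x7fd0dba9a863b620ca718030ca83ba71b620da968030a862c710dba6ba938030dba6a862071cba93,
    0x8030ca63a720db9ab8618030ca96a7206badb8318030dba9a720ba68c6317fd0dba9a731ba68c620,
    0x7fd0ca96a8316badb7208030dba6b963ca81a7208030ba96a720db38ca617fd0ba93a720db6ac861,
    0x8030ba93a821db6ac7608030da93ca62ba81b7607fd0ca63a821db9ab7608060da93cb62ba81a760,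
    0x8030dba9cba6a83176208060db63a962ca81ba707fd0ca83ba70b621da967fd0ba96a721db38ca60,
    0x7fd0da83a710ba69cb627fd0ba96dba3a720c8618030da83b710ba69ca628030ca937610dba6ba82,
    0x7fd0db83c762ba79a6108030b873c7629bada6108030da96ba62ca83a7108030ca83ba62d69ab710,
    0x7fd0dba7b973a268c6108030dba9b873a762c6107fd0cb73b8627a9da6108030dba7c973b268a610,
    0x8030dba9a620b678c7317fd0dba7a762b936c8108060db73a872ba69c6107fd0ba97db73a268c610,
    0x7fd0ba83a620db79c7617fd0cb83b761a620da978030ba97db76c831a6208030ba97c731a620db86,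
    0x7fd0ba86c620a731db978030dba9a731b678c6207fd0ca73a620db97b8618030ba97c761a620db83,
    0x8030dba7c820176ab9637fd0ba76b973c620da817fd0da73ba81b679c6207fd0ba83c620a761db97,
    0x8030ba83a621db79c7607fd0dba7c821076ab9638030ba83c621a760db978030ca83a760b621db97,
    0x7fd0ba73b962da81c7607fd0ba93b872da61c7608030b963c7607bada8217fd0ba97c760a621db83,
    0x7fe8dba78610397cba628030c973ba627bad86108030dba9cb76a37862108030cb73b621da97a860,
    0x7fd0ca728610db67ba938030db768610ba39ca727fd0db76ba932a7c86108018ba628610db7ac973,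
    0x7fd0ba978210db67ca638060ba97db76ca3682107fd0ba97ba63c860d7218030cb938610d7aba762,
    0x7fe8dba9ba768210c7637fd0ba76ba93d278c6108030db97a762c016ba837fd0db97c610ba38a762,
    0x7fe8ba76cba38201d9768018ba76d9768201cba38030ba97ba63d821c7608018c7638210dba9ba76,
    0x7fe8c8317620dba9ba768018c9218760ba76dba38018ba76dba3c91287607fe89761c820ba76dba3,
    0x8018db76cba38012a9768018ca768210ba36db97800cdba39762ba81c76080187631c820dba9ba76,
    0x8030ca83b762da79a6107fd0ba76c810db39a7628018ba93c810d67ba7627ff4cba38762dba97610,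
    0x8030ca63a810da79b7627fd0da97ca73a862b6107fd0ca83ba72d679a6107fd0da97ca73b862a610,
    0x8030da76a973b620ca817fd0ca76a831da79b6207fd0d976ca73a620ba818030b762a810da97ca63,
    0x7fd0da76ca73a820b9618030ca63a820da79b7618030ca76a820da79b6317fd0a976da73b620ca81,
    0x7fe8da76ba10c937a8628030ca73ba10d967a8628060da73a962b760ca817fd0ca63a821da79b760,
    0x7fe0cb83ba72dc94a6107fd0da96b621ca83a7608030da96b620ca83a76180188762ba10da97ca63,
    0x8030dc84a620cb9ab7318030dc84b731c9aba6207fa0cba9b731d48ca6207fd0dcb9ca84b731a620,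
    0x8020da94ba72ca83b6107fd0da94ca83ba72b6107fd0db94ca83ba72a6107fe0cba9d620c48ba731,
    0x7fe0ba84a731db9ac6208020ba84a620db9ac7318050dba9ba84c731a6207fd0dba9ca84b731a620,
    0x8020ba83a762db94c6108030db94c762ba83a6108030db94ca83b762a6108010da94ca83ba72a610,
    0x8020ba63c862db94a7107fa0db94c862ba63a7108020db94ba63c862a7107fe0db94b8623a6ca710,
    0x7fd0ca84b731db69a6207fd0c864b7319bada6207fa0db63a862ba94c7108020ba94db63c862a710,
    0x7fd0a731c620db9ab8648020da94b863a620cb717fe0ba83a620db94c7617fd0dba9b864a620c731,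
    0x7fd0c864a7209badb6318030db84c620ba96a7317f70ba96db84c620a7318030ba96a731db48c620,
    0x7fd0ba96a720db48c6317fd0db84c631ba96a7208030c631a720db9ab8648030cb84a720da69b631,
    0x8020da64b9631b8ca7207fd0dba6b964c831a7207fd0b831a720db6ac9647fb8dba6c964b831a720,
    0x8010ba64d963c07ab8217fe0b821ca70d46ba9638020ba83a621db94c7608010ba81c720d46ba963,
    0x7ff0ba63c710b49ad8627fe0db96ba84a367c2108030dba6cb948631a7208018dba97210c46ba863,
    0x8030da94ca83b267a6107fb8ba967210db48ca638048c8637210dba9ba648010ba647210db9ac863,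
    0x8030da96ca84b620a7317fe0c863ba71da49a6208030da94b862ca63a7108010da94ca83a267b610,
    0x8020c863ba70da49a6218020da94ca63a720b8618030da96ca64b831a7207fe0da94a863b620ca71,
    0x7fe8cba9a721d602cba88018cba9a620d712cba88018ca82ca72db9ab6108020c863a762da94ba10,
    0x8030cb92b8626cada7108030cba9b8622c6da7107fe8cb92da60ca82ba718018cb92da71ca82ba60,
    0x8018ba82ba72da69c6108018cba9d710c26ba8627fe8ba62d710cb96ca828030ca96cb822b6da710,
    0x8030ba96da621a8bc7207fd0dba6ba92c720a8617fd0ba96da62c18ba7207fd0dba6ba92a720c861,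
    0x7fd0ca62a710db9ab8628030da62b962ca81ba708030ba92ba62da81c7607fd0ba92db62ca81a760,
    0x7fd0db76ba92a278c6107fd0db72a872ba69c6108030ba82a710da69cb627fd0ba82c710da69ba62,
    0x8030dba7c820b269a7618030dba7b962a620c8718018ba97db76c821a6208030ba82da72b679c610,
    0x8030ba97db76ca2682108030dba7a762081cb9628018ba92c810d67ba7627fd0dba7c821b269a760,
    0x7fd0dba7b976c28a62108060dba7b976ca2862108018dba78210276acb967fe8ba978210db67ca62,
    0x7fe89762c810dba7ba627fd0b976ba72d28ac6108030dba7ba62697c82108030dba78210697bca62,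
    0x7fe8c762ba80a916da728018c762ba91a806da727fe8da76a921b802ca768018da76a820b912ca76,
    0x7ff4cb82cb72da93a6108030cb93ba722c8da6108030cba9b7322c8da6108030cb82b732d9aca610,
    0x8030ba82c610da93ba727fb8ba82ba72da93c6108010cba9d610c28ba7328030ca93cb722b8da610,
    0x7fd0ba93da82b620ca718060ba93db82ca71a6208030dba9ba82c713a6207fd0ba83a620db9ac721,
    0x8030da92b832ca71ba607fd0db92ba82ca71a6308030dba9ba82a713c6208030ba83a721db9ac620,
    0x7fd0ba96a732db28c6107fd0ba82a732db69c6107fd0dba9a610c28ab7328030db82a610ba93ca72,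
    0x8018ba93c610d28ba7627fd0ba93db82a267c6107fd0db82c610ba96a7327fe8ba96c610d28ba732,
    0x7fd0c962b8326bada7108030ba96c6322b8da7107fa0b862c632d9aba710800cba82ba72d963c610,
    0x7fd0dba9b863c721a6207fd0ba93db62a710c8628030cb92b8623a6da7107fa0cb62b832da96a710,
    0x8030b963cb71da28a6208030ba93cb71d268a6208030ba82c731a620db968030b862c731a620dba9,
    0x7fd0ba93db62a720c8617fd0b932c8616bada7208030c821a720db6ab9637fd0ba96b832c620da71,
    0x8030dba9b862a631c7207fd0a821c720db6ab9637fd0ba63db92a720c8618030db63ba92a720c861,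
    0x8030c821a730db6ab9628030db92ba82c761a6307fa0ba81c7203b6da9627fd0a831c720db6ab962,
    0x8030b932c7606bada8218018ba92ba62d861c7307fd0ba82c730a621db967fd0b862c730a621dba9,
    0x7fd0ba63c760d29ba8218030ba63db92076ca8218030ba63db92a812c7607fd0ba93db62c706a821,
    0x8030ba93ca70d268b6218060c821ba70a269db638018ba92d631076cba828018ba92d631ba82c760,
    0x8030ba93c710d26ba8627fd0ca92ba82d36b76108030db81ca70b269a6327fd0a963ca70db28b621,
    0x8030a963b762db28ca107fd0ba96c710d623ba827fd0a862c710db62ba937fd0a862c710b39adb62,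
    0x8090db96c821ba36a7207fe8ba629632db81ca708030db96ba63a821c7208030ba93ba62d862c710,
    0x8030db967210ca38ba627fd0dba972103b6ca8627fa0ba63c821072adb968030ba63c8216b9da720,
    0x7fe8ba96ba32d862c7107fe8ba62c710396dba828030ba63db92071ca8628018ba627210db96ca83,
    0x7fd0dba9b863021ca7628030b963ba62da82c7108030ba62b962da81c7308018ba32c710b69ad862,
    0x7fd0ca62ba81db9276308030db9672106a8bca327fe8dba9ba627201c8638030dba9a632b862c710,
    0x8018ba817620c26adb938018cba27210b69ad8637fe8ba96d8637201cba27fd0db92ba810637ca62,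
    0x8018ba21c720b69ad8637fb8ba32c821d69ba7607fd0db96c720ba23a8618018ba32c720b69ad861,
    0x8018dba3c962182ba7607fe8ba827210db6ac9638018dba6c963b821a7208030d863a720ba69cb21,
    0x7fe8dba37610c29ba8627fd0dba3cb92a86276107fd0d821c760ba96ba327fd0c962a760db3ab821,
    0x7fe8dba9c720ba6286318018dba9ba81c62376208018dba3c9627026ba818018ba92c8620617dba3,
    0x8030b632d821ba96ca707fe8c631ba70d29ba8628030db92a862c136ba708060ba62c821d963ba70,
    0x8018ba716320db9ac8628018ba82c630d721ba968018ba96ba82c036d7218030d821ca70ba69b632,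
    0x7fe8ba63c720186dba928018dba3c720b962a8617fe8dba38621c926ba708030dba3a861c29b7620,
    0x7fa0ba63ca81d29b76207fa0ba637620db9ac8218018dba9c720263ba8617fe8ba92c720d861ba63,
    0x7fe8dba96310b28ac7627fd0ca826310db96ba727fd0d962ba81a067cb328018c731ba60d29ba862,
    0x7fd0ba63c7208621dba98018c962ba817320dba67fe8ba817320db69ca627fe88632ba71c620dba9,
    0x7fd0ba81c720d962ba638030ba63c720d926ba818090db96c821a623ba708030ba63c8627201dba9,
    0x8018ba71c630d29ba8627fe8ba96ba82d167c3207fe8d962ba60c832ba718018d963ba61b28ac720,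
    0x7fd0ba62c720d963ba818030ba62ca817023db968018ba627320db9ac8618030db93c8620a6ba721,
    0x8030a762c310db96ba828018ba82c310d69ba7627fe8ba627620db9ac8318030cb31a760b29ad862,
    0x7fd0da96ca62b720a8317fd0ca63a821da96b7207fd0da96ca62a720b8318030ca63a720da96b821,
    0x7fd0ca62a710da96b8328030da62a932ca81b7608030da92c632ba81a7608030da62c962ba81a730,
    0x7fb0cb82b732da94a6107fa0c842b732d9aba6108030ca82a710d963ba627fd0da63c962ba81a720,
    0x8020a732c610ba94db827fd0ba94db82a723c6107fe0ba94db82a732c6108030ba94c7322b8da610,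
    0x8020db94ba82a731c6207fd0ba82c7314b9da6207fd0b842c731d9aba6207fe0db94ba83c721a620,
    0x8030ba94ba82d732c6108040ba92b842da71c6308030ba82c6304b9da7218030b842c630d9aba721,
    0x8030da92c842ba71a6307fe0da94ca82a731b6207fd0da94ca82b731a6208010da94ca83b721a620,
    0x7fd0da82c732a469b6108050ca82a732d964b6108060c842a732da69b6108020da92a842ca71b630,
    0x8010da94b710a268c6327fc0a862c632da94b7107fd0da94a862c623b7108020da94a862c632b710,
    0x8020da94a863c721b6208030da94c862a620b7317ff0da94c863a620b7218030a862b710da49c632,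
    0x8020c862b721da49a6307fe0c862b720da49a6318030a964d832b620ca718030a842c731da69b620,
    0x7fe0da64ba82396c72107fe0da92a642c861b7307fd0a842b730da69c6217fd0da92a862c741b630,
    0x7fd0da92c852b741a6308030da95c842a723b6108030c842b732da95a61080208632b710da64ca92,
    0x8030c632b710da93a8627fa0da63a932c861b7207fd0ba93b832da71c6207fd0ba93db82a620c731,
    0x7fc0a943d832ca71b6207ff0d943a832ca71b6207fb0da93a832c741b6208020c842b732da93a610,
    0x7ff4ba92ba82d762c610800ccb92cb82da72a6108018d953c832b741a6208040da93b610c824a732,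
    0x7fdcba92ba82d732c6107fe8ba82c610d29ba7328018ba92ba62d861c7207fe8ba92c710d26ba862,
    0x7fe0da92a732c842b6108010c842b732da92a6107fd0a862c632da92b7107fd0ba93db82c721a620,
    0x7ff0c842a732da92b610]

def tetraRenamings : List ℕ := [
    0x7fe8febadc8976543210dc95ba85db6474107fe8fecdab9786543210dc95db84ca746310,
    0x7ff4fecdab9876543210db76ca76dc9584107fe8fecdab9867543210dc95db74ca648410,
    0x8030fedcba9867543210dcb9dca6d97485108030fecdba9876543210ca87d876dc95b410,
    0x7fe8fecdba9867534210dcb8da74ca6395107fd0fedbca9867543210dcb9dba6dc748510,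
    0x7fe8fedcab8967543210dc98db97da86c5108018fecdba9867543210ca86dcb5d8749510,
    0x8018fedcab8967534210dc98b974a863d5107ff0fedbca7698534210a975c984b763d510,
    0x8020fedacb7968543210ba86cb94c873d5107fe8fedbca9867534210cba9c874b863d510,
    0x8020fedacb7968543210ba86c984b973d5107ff0fedbca9786534210a876c984b973d510,
    0x8060fedbac8697534210a976c984cb73d5108010fedacb8796534210b965c984ba73d510,
    0x8018fedcab8967543210cb97ca869854d5107fd0fedcba8976534210c987b964ba83d510,
    0x7fe8fedbca9867543210cba9c874b864d5107fe8fedcab8967543210dc98b974a864d510,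
    0x8030fedcab9867543210a986dc94b874d5108030fedcba9867543210cb98a974ca64d510,
    0x8018fedbca9876543210ba87c876cb95d5108018fedcba8967543210ba86c985b974d510,
    0x8048fedcba7698543210cb98ca97cb76d510800cfedbca9867543210c987b986cba5d510,
    0x7f70fedbac9786543210cb98ca97a986d5108030fe9768dbac543210c987cb96a986d510,
    0x8048fedcab9867543210cba9cb87ca86d5107fe8fedcba8976543210c987ba96ba86d510,
    0x8014fecdba8976325410d954b753c832a6108018fedbca9786543210dc98db97cba6d510,
    0x8020fedcba9876534210dc95d874db83a6107fc0fedbca7896435210d954db73c853a610,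
    0x8024fe9876dcba453210dc98dcb59874a6108030fedcba7986543210dc87db85d954a610,
    0x8048fe8796bdca453210db98dc95b874a6107ff4fe8796bdca453210dc87dc95b874a610,
    0x7fd0fecdba9786543210dc95db84cb74a6108018fe8796bdca453210dcb8dc95b874a610,
    0x8010fedcba8976543210dcb9dcb89875a6107fd0fedcba9786543210dc95b984db74a610,
    0x7fd0fedcba9786543210db98dcb7dc95a6108018fedcba9786543210dc98dc97b875a610,
    0x7fe8fedcba9786543210dc98dc97a987b6107fe8fe9876dcba543210dc98db98dc97a610,
    0x8040fedbac9876543210dcb9da98c875d6107fe8fedcba9786543210dc98dc97da87b610,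
    0x7ff8fedcab8976543210dcb9dca8ba75d6107ff0fedcab8976543210dcb9dca8a975d610,
    0x7ff0fedcba7986543210dcb9dc87a985d6108010fedacb9876543210dba9dc98cb75d610,
    0x7ff0fedcba8796543210dc98dcb7ba95d6107ff0fedbca9786543210dc98db97ba85d610,
    0x7ff0fedbca7986543210dca8db87dc95d6107fe0fedbca7986543210da98db87dc95d610,
    0x7ff0fedcba7986543210dcb9dc87a986d6108018fedbca9786543210dc98db97cba5d610,
    0x7ff0fedcba8796543210dc98dcb7ba96d6108020fedbca9786543210dc98db97ba86d610,
    0x7fe8fedacb8796543210dc98ba98dba7d6108018fedbca9786543210dc98db97cba6d610,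
    0x8030fedbac7986543210dcb9da87c86597107fd0fedbca7698543210dc98db76ba958710,
    0x7fe0febdca8976543210cb85dc65d954a7107ff0febdca8976543210cb85c965d954a710,
    0x7fd0fedbca8976543210db96dc95db85a7107fd0fedbca8976453210dc95db65db84a710,
    0x8030fedcba9867543210dc95db85ba64b7107fe8fe8976cdba543210da86d954c854b710,
    0x8010fe8769dcba543210dcb9a987d865c7107fe8fedcba9867543210dcb9dc98ba65b710,
    0x8018fedbca8976453210cba6dc95db84d7107fd0fedbca8976453210a986dc95db84d710,
    0x8030fedbca8976543210ba96dc95db85d7107ff8fedbca8769543210dc98ba97db65d710,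
    0x7ff0fedacb8976543210dba8db96dc95d7108010fecadb8976543210dba8b976dc95d710,
    0x8020fedbac9876543210dcb9da98c876d7107fe0fedacb8976543210dba8dcb6dc95d710,
    0x8008fedcab8976543210dcb9dca8ba76d7107fe0fedcab8976543210dcb9dca8a976d710,
    0x7fd0fedcba9867543210dc95b865d874a8108020fedacb9876543210dba9dc98cb76d710,
    0x8060fecbda9876543210dcb9b976dc75a8107fe0fedacb8796543210dc98dba7b965a810,
    0x7fd0fedcba9867543210dca6dc95d974b8107fd0fedcab9876543210dc95d875a864b810,
    0x7fe0fe9867adcb543210dcb9ca86d875b8107fd0fedbca9786543210dc98db97da65b810,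
    0x8018fecdba9867543210ca96dc95da75b8108020fedbca7698543210dc98db76a975b810,
    0x7fe0fe8796bdca453210da86dc95b874c8107fe0fecadb8697543210dc98ba96db75b810,
    0x7ff0fe8769dcba543210dcb9a987da65c8107ff0febdac8769543210dcb9da87ca65c810,
    0x7fe0fe8769dcab543210dcb9a986d875c8107fd0fe9876dcba543210dcb9d987da65c810,
    0x7ff0fe8796dbac543210dc98dba7b965a9108030fe7968acdb543210dcb9ca87d765d810,
    0x7ff0fedacb8796543210dc98dba7cb65a9108010fedbca9786543210dc98db97cb65a910,
    0x8008fedbca9786543210dc98db97cba6a9108018fe8769adcb543210dcb9dc87a876a910,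
    0x8008fe8769dbca543210dc98db76a975b9107ff0fedacb8796543210dc98dba7c765b910,
    0x8020fecbda7698543210dc98cba6db75b9108020fedbca7698543210dc98db76ca75b910,
    0x7fe0fedcab9786453210cb85ca746543d9107fe0febdca8796453210dca6d985cb74c910,
    0x8010fedbca9678534210cba7c854b653d9108010fe9867dcab534210ca87cb548653d910,
    0x8020fedbca9687435210ba65c854cb73d9108020fe9867dcba435210a865cb54c873d910,
    0x8010fe9786dacb543210da87b765c854d9108030fedacb9768453210c875ba64db83d910,
    0x8010fedacb9786543210db86ba75c854d9107fe0fe9786dacb543210dca7b765c854d910,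
    0x7ff0fedacb9786543210dcb6ba75c854d9107fe0fedacb9786543210cb96ba75c854d910,
    0x7fd0fedcba8976543210da76dc85b764d9107fd0fedcab9867543210dca6db75c854d910,
    0x7fe8fedbca9867453210cba8c875b864d9108018fe9876dcba453210cb87ca65a864d910,
    0x8040fedacb9786543210dba7dc85b864d9107fe8fedbca9867453210dcbac875b864d910,
    0x8030fedcba9867453210cba8c875cb64d9107fe8fedcab9867453210cba8cb75ca64d910,
    0x8050fedbca9687543210db76dc85a874d9108020fedacb9786543210dba7dc85cb64d910,
    0x7fd0fedcba8976543210dba6dc85ba74d9107fd0fedcba8976543210db76dc85ba74d910,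
    0x7fd0fedcab9786453210cb85a965ca74d9107fd0fedcba9786453210cb87c865ca74d910,
    0x8020fedbca9768543210dc87db65ba84d9107fd0fedcab9876543210a876dc85cb74d910,
    0x7fd0fedcab9786543210ca76d875cb84d9107fa0fedcba9768543210dcb6d875ca84d910,
    0x8030fedcba9876453210cb87c865cba4d9107fd0fedcba9876453210dc87b865cba4d910,
    0x7ff8fedcab9786543210dc87b865a765d9107ff4fe9876dcba543210cb87cba58765d910,
    0x7ff0fedbca9876543210cb85ba75c765d9108010fe9768dbca543210cb85a875c765d910,
    0x8010fedcab9786543210cb85ca75a865d9107ff0fedbca9876543210dcb8ba75c765d910,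
    0x7fe0fedcba9786543210dc87ba75b865d9107ff0fedcab9876543210dc87ca65b865d910,
    0x8008fedbca9867543210dcb8ca75ba65d9107ff8fedcab9786543210cb85ca75ba65d910,
    0x800cfe9876dcba543210cb87a875cb65d9107ff0fedcba9867543210dcb8a875ca65d910,
    0x8018fedcba8976543210db76da76dc85d9108018fedcab9786543210d876cb85ca75d910,
    0x8018fedbca9867543210dc87db86a876d9108018fedcba8976543210dba7dba6dc85d910,
    0x7fd0fedcab9876543210dc87ca86b876d910800cfedcba9786543210dcb8dcb7a876d910,
    0x7ff8fedcab9786543210dc87db86da76d9107fe8fe9786dbca543210dc98db97ca76d910,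
    0x8030fedcba7986543210da97dc87b986d9107ff0fedbac9876543210dcb8da87dc76d910,
    0x8018fedcab9867543210cba9cb87ca86d9107fd0fedcba9768543210dc87dcb6ca86d910,
    0x7ff0fedbac9786543210dcb8dca7da86d9107fd0fedcab9786543210dcb8dca7ca86d910,
    0x7fe0fedbca9768543210dc87dca6db86d9108030fedcba9786543210cba7dc87cb86d910,
    0x7fd0fedcba8976543210dcb8ca97db96d9107fd0fedcba7986543210da98dc87cb96d910,
    0x8030fedcba9867543210dcb8ca87cba6d9108030fedcba8976543210dcb8a987dc96d910,
    0x8018fedcab9786543210dcb8dca7cba6d9108018fedbca9786543210dc98db97cba6d910,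
    0x8010fedcba9768543210dba8dc87dcb6d9108008fedcab9786543210dcb8dca7dba6d910,
    0x8018fedcba7698543210dc98dc76b975da107fd0fedbca9786543210dc98db97b865da10,
    0x8030fedbca9786543210dc98db97ba86da108030fe9876dacb543210dc98d976cb75da10,
    0x8030febadc9678543210dc98ba96db75cb107fe8fedbca9786543210dc98db97cba6da10,
    0x8018fedabc7698543210dc98da76b975db107fd0fe9876cdab543210dc98ba97b865db10,
    0x7fd0fedcab7986543210db86a875b954dc107fd0fe8697cadb543210dc98b976da75db10,
    0x7fe8fedcab8976453210d987b965a864dc107fd0fedcab7986543210da87db959864dc10,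
    0x8018fedcba8967543210ba86d985b974dc107fd0fedcab8976543210a876d985b974dc10,
    0x7fd0fedcba8976453210d987b965ba84dc107fe8fedcab7698543210b985a765d974dc10,
    0x8030fedcba8976543210d987ba85b965dc107fe8fedcab9867543210dba9b875a865dc10,
    0x7fe8fedcba7698543210db98da97db76dc107fe8fedcba7698543210db98ba97db76dc10,
    0x7fd0fedcba9786543210ba97d987b986dc107fd0fedcab9786543210db98da97a986dc10,
    0x7fe8fedcab9867543210dba9db87da86dc108018fedcba8967543210db98ba97ba86dc10,
    0x7fe8fedcab9786543210db98da97ba96dc108030fedcba9867543210db98a987ba96dc10,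
    0x7fd0fedcba8796543210dc98d754b951a6307fd0fedcba8976543210dcb8d954c751a630,
    0x7fe0fedcab9867543210dc95d854a631b7307fd0fe8796bdca453210dc95b874da81a630,
    0x8020fedbac9768543210cb87ca64d951a8308010fedcba9867543210dc95db84da61d730,
    0x8030fedbca8976543210ca87db85dc9176408030fedcba9768543210cba6c874d951b830,
    0x7fd0fedcba8796543210dcb7d985c941a6407fe8fedbca7986543210db87dc959841a640,
    0x8030fedbca8796543210dc98db75ba91a6407fd0fedbca8796543210dc98db75b961a640,
    0x7fd0fe9876bdca543210cb86d875dc91a6408030fedcba8796543210dcb7d985ca91a640,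
    0x7fd0fecdba9786543210cba7db85dc91b6408030fedcba9786543210cba7c843d951b640,
    0x7fd0fedbca8976543210dc95db85b961a7408018fedbca8976543210dc95db859861a740,
    0x7fa0fe9876dcba543210dc95d653b981a7408018fedbca8976543210dc95db85cb61a740,
    0x7ff4fedcab9867543210dc95dc85a641b7408010fedcab9867543210d954c853a641b740,
    0x7ff4fedcba9867543210dc95dc85ba61b740800cfedcab9876543210dc95dc85a761b740,
    0x8020fedbca8976543210db85a763dc91d7408018fecdba9867543210dcb9a985c641d740,
    0x8018fe9876dcba543210b987da65dc91a8408030fedcba9768543210cb87c643d951a840,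
    0x8020fedcab9876543210dc95d653a871b8407fd0fedcab9786543210dc96dc95a741b840,
    0x8030fedcab9876543210d986dc95a871b8407fe0fedcab9876543210dc95d863a871b840,
    0x7fe0fedcba9786543210dc95d653ba71b8407fe8fedcab9687543210dc95a764d871b840,
    0x8030fedcba9768543210dba6d875dc91b8407fd0fedcba9867543210da86dc95db71b840,
    0x7fd0fedcba9786543210da96dc95db71d8408030fedcab9876543210dc95a765b971d840,
    0x7fd0fe9867dcba543210d985b765a971dc408030fedcba9786543210dca6dc95db71d840,
    0x7f70fedcba8796543210dc98dcb7db91a6507f70fedbca9786543210dc98db97db81a650,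
    0x80c0fedcba9768543210ba65db84dc9187508018fedbca7986543210db879854dc91a650,
    0x800cfedcab9867543210dc95dc85a651b7508008fedcab9867543210d954c853a651b750,
    0x7fe8fedcba9867543210dcb9dcb8da61d7507fe8fedcba9867543210dc98db98da61d750,
    0x8020fedcba9786453210ba74db63dc91b8507fa0fedcba9867543210dc95a964da71b850,
    0x7fd0fedacb8796543210dc98dba78761b9508030fe9867dcba543210a876cb74d951c850,
    0x8030fedacb8796543210dc98dba7a861b9507fd0fedacb8796543210dc98dba7c761b950,
    0x7fe0fedbac9768543210cb87ca64a831d9507fd0fedacb8796543210dc98dba7ca61b950,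
    0x8030fedcba7986543210dc87a986b641d9507fd0fedcba9768543210cba6c874b831d950,
    0x7fd0fedcba8976543210dcb8ca96a741d9507fd0fedcba7986543210ba98dc87b641d950,
    0x7fd0fedcba9786543210cba7db86c841d9508030fedcba9687543210da87cb76c841d950,
    0x8018fedcab9786543210dcb8dca78761d9508030fedacb9876543210ba87dcb6c841d950,
    0x7fd0fedcab9786543210dcb8dca7a861d9507fe8fedbca9867543210dc87db86a761d950,
    0x7fe8fe9876dcba543210cb98dc87ca61d9508018fedcab9786543210dcb8dca7ba61d950,
    0x7fd0fedbca9867543210dc87db86ba71d9508030fedacb9876543210dba8dc87cb61d950,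
    0x8030fedcba7986543210dc87ba64b981d9508030fedcab9876543210a764c843cb71d950,
    0x8030fedcba8976543210b987a764dc81d9508020fedcab9687543210ca74b763cb81d950,
    0x8030fe9876dcba543210dc98db977651ca507fd0fedcba8976543210b987ba64dc81d950,
    0x7fe8fedbca8976543210dc95db85cb71a7608030fedbca8976543210dc95db85b971a760,
    0x8030fedcab8976543210dcb9dca8a971d7607fd0fedbac9876543210dcb9da98c871d760,
    0x7fe8fedcab8976543210dcb9dca8ba71d7607fd0fedacb8976543210dba8dc95b971d760,
    0x7fd0fecdba9786543210dcb9da85ca71c8607fd0fedacb9876543210dba9dc98cb71d760,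
    0x8030fedcab8976543210dc98dba7a861b9608030fecdba9876543210cba6dc95b871d860,
    0x7fd0febadc8976453210dc95ba84db71b9607fd0fedacb8796543210dc98dba7ca61b960,
    0x8030fedacb8796543210dc98dba7b961ca607fd0fe9876bdca543210dc95d875b981ba60,
    0x7fe8fedbca9786543210dc98db97b851da607fd0fedcba8796543210dcb7d985c941da60,
    0x8030fedbca8796543210dc98db75ba91da608018fedbca9786543210dc98db97a871da60,
    0x7fe8fedbca9786543210dc98db97a951cb608030fedcba9786543210db98dcb7dc91da60,
    0x7fe8fedcab8976543210dcb9dca8d65198707fe8fedbca8976543210dc95db85a6419870,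
    0x7fd0fecdba9876543210cba6dc95d861b8707fe8fedbca9786543210dc98db97da61a870,
    0x8030fedbac9876543210dcb9da98d761c8708030fedcba9786543210a976dc95da81b870,
    0x8030fedcba9867543210dc95b865ca41d8707fd0fedcba9786543210ba76dc95b841d870,
    0x7fd0fecdba9876543210dcb9ba64c851d8708030fecdba9876543210dcb9a964c851d870,
    0x8030fecdba9867543210dcb9ca86a971d8708030feadcb8967543210cba8dc95db61d870,
    0x7fd0fedcba9768543210dba6dc95cb81d8707fd0fecdba9876543210cb76dc95ba81d870,
    0x8030fedcab8976543210dcb9dca8d651a9708030febdca7968543210cb86dc95dba1d870,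
    0x8030fedbca8976543210dc95db85a641b9707fd0fedcab8976543210dcb9dca8d761a970,
    0x8030fedacb8976543210dba8dc95d761b9707fd0fedbca8976543210dc95db85a761b970,
    0x7fe8fedcab8976543210dcb9dca8d651ba708030fedcab9876543210da76dc95d981b970,
    0x8030fe9876dcab543210dcb9d985c641ca708018fedcab8976543210dcb9dca8d761ba70,
    0x8030fecbad8967543210dcb9da85a961ca708090fedcab9867543210cb87ca86d951ca70,
    0x7fd0fe9786badc543210dc98d765b971ca707fd0fedbca9867543210dcb9da85ba61ca70,
    0x7fd0fe8796dacb543210b976dc95db81da708010fedcba9867543210dc95db84d631da70,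
    0x8030fedacb8976543210dba8dc95d641cb707fe8fedbca8976543210dc95db85a641cb70,
    0x7f70fe9876dcab543210ba86c854d951cb707fd0fedacb9876543210dba9dc98d651cb70,
    0x8030fedacb9876543210dba9dc98d761cb708018fedbca8976543210dc95db85a761cb70,
    0x7fd0fe9876dcab543210dc98b965a841db708030fe9876dcba543210dc98ba958641db70,
    0x8030febadc8976453210dc95ba84b961db707fd0fe8976dcab543210dc98ba96c761db70,
    0x8018fedcab9867543210dc95dc85da61db708030fedcab9867543210d954c853da61db70,
    0x8030fe9867dcba543210dc95b875d641a9807fd0fe9876dcab543210dc98b965da91db70,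
    0x7fd0fedcab9768543210db87dc95da61a9808030fe8796bdca453210dc95b874d861a980,
    0x7fd0fedcba9786543210dcb9d876ca71a9808030fecdba9687543210dcb9ca76d871a980,
    0x8030fe9876bdca543210dc95d875ba61b9807fa0fe9876dcba543210dc95d874a651b980,
    0x8030fedbca9786543210dc98db97d651ba807fd0fedcab9876543210da76dc95b971d980,
    0x7fd0fecdba9876543210c876dc95db71ba808030fecdba9876543210cb76dc95d871ba80,
    0x8090fedcba9768543210cb87cba6d951ca808030fedcba9768543210db87dba6dc91ba80,
    0x8030fe9768adcb543210dcb9d876a971ca807fd0fe8796bdca453210dc95b874d861ca80,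
    0x8030fe8796bdca453210dc95b874a631da807fd0fedbca9786543210dcb9d876ba71ca80,
    0x8030fecdba9786543210dcb9ca75d761da807fd0fe8796bdca453210dc95b874d761da80,
    0x7fb8febdca9687543210dcb9ca75ba61da807fd0fedcba9768543210dc95b874ba61da80,
    0x7fd0fedcba9786543210a976dc95b871da807fd0fe8796bdca453210dc95b874db61da80,
    0x8030fecdba9786543210b876dc95ca71da808048febcda9678543210dcb9ba65ca71da80,
    0x7fd0fedcab9876543210dc95a8759641db808030fedcba9768543210dba6dc95d871cb80,
    0x7fd0fe9876adcb453210dc958764a751db808060fedcba9786543210dc95b974a651db80,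
    0x8030fe7698dbca543210ba97dc95d761db808030fe9876dbca543210ba97dc958761db80,
    0x7fd0fedcab9687543210da76dc95b971db808030fe8976bdca543210c875d954ba61db80,
    0x8030fedcba9867543210a965c754dc91db808030fe8796dacb543210b976dc95da71db80,
    0x7fd0fedbca9876543210b875d954a631dc807fd0feacbd7698543210cba7da65dc91db80,
    0x7fd0fecadb7698543210dc98db76a871ba907fd0fedbca8796543210dc98db75da61ba90,
    0x8030fe9876dcab543210dc98b965db71da908030fedbca7698543210dc98db76ca71ba90,
    0x7fe0fedbca8976543210db85a763d741dc907fe0fedcba9867534210db85ba63b741dc90,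
    0x8030fe9867dcab543210db87a986b651dc908030fedbca7986543210db87da65c841dc90,
    0x7fe0fedcba8976543210ba74b643d851dc907fd0fecdba9768543210db87cba6a851dc90,
    0x8020fedcba8976543210db74a763d851dc908020fedcba8976543210b764a743d851dc90,
    0x7ff4fedcba8976543210ba74ba64d851dc907ff4fedcba8976543210b764a764d851dc90,
    0x7fd0fedcba9867543210cba6b974d851dc908030fedcab9876543210ca76b974d851dc90,
    0x7fd0fedcba8976543210da76db74d851dc908030fedcba9867543210ba96cb74d851dc90,
    0x7fe8fedcba8976543210db76da76d851dc908030fedcba8976543210dba6db74d851dc90,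
    0x8030fedbca9876543210a8659874db51dc907fe8fedcba8976543210dba7dba6d851dc90,
    0x7fa0fedcba9687453210db85d764a871dc908060fecdba9876453210d875cb84a861dc90,
    0x7fd0fedcba7986543210cb65a864d871dc908030fe9876bdca543210b965a864d871dc90,
    0x7fd0fe8796dcba543210da75a864b981dc908030fe9876bdca543210b965ba84d871dc90,
    0x8030fe8796dcba543210d765ba74b981dc908030fe8796dcba543210da75ba64b981dc90,
    0x8030fedcba9867543210ba96db75d981dc907fd0fedcab9876543210da76b975d981dc90,
    0x8030fedcba7986543210d875ba64cb81dc907fd0fedcba9768543210db87dba6ba81dc90,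
    0x7fd0fedbca8976543210a975b764db81dc908030fedbca8976543210d765a754db81dc90,
    0x7fd0fedbca8976543210a975ba64db81dc907fd0fedbca8976543210ca75a864db81dc90,
    0x7fd0fedbca8976543210c765a874db81dc908030fedbca8976543210ca75ba64db81dc90,
    0x7fd0fedcba9867543210da97dca6db81dc908018fedbca8976543210d765a765db81dc90,
    0x7ffcfedcab9876543210b876a876dc91dba07fd0febdca7968543210cb86dc95d871dba0,
    0x7fd0fecdba9768543210d987ca96a851dcb0]

theorem certifies_solution : certifies 4 1 (tetraSum 1 ++ combinationSchouten (-1) solutionData)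
    tetraRelations tetraRenamings = true := by decide +kernel

theorem trivialises_solution : Trivialises solution :=
  trivialises_combination sinkFirst_solutionData (by decide +kernel) certifies_solution

/-- Codes of linear combinations of micro-graphs that give cocycles. -/
def cocycleCodes : Fin 7 → List (ℤ × ℕ) :=
  ![[
    (1, 0x014743584569), (-1, 0x024716581569), (2, 0x054716581269), (2, 0x084716584269),
    (-2, 0x024719584569), (1, 0x054743581569)],
    [
    (2, 0x084716581869), (1, 0x014716581869), (1, 0x024716581869), (2, 0x054716581869)],
    [
    (1, 0x084743584269), (2, 0x014713581569), (2, 0x054713581569), (3, 0x054713581869),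
    (2, 0x024716581269), (1, 0x024716581869), (2, 0x054716581269), (1, 0x024716584869),
    (-2, 0x084716584269), (1, 0x024719584569), (1, 0x084743581569), (-1, 0x014743584869)],
    [
    (1, 0x084716581269), (1, 0x014713581569), (1, 0x054713581569), (1, 0x054713581869),
    (1, 0x024716581269), (1, 0x054716581269)],
    [
    (2, 0x084749584569), (-2, 0x054719584869), (4, 0x084719584569), (-1, 0x054749584869)],
    [
    (4, 0x084743584569), (1, 0x014716581569), (1, 0x024716581569), (2, 0x054716581569),
    (4, 0x054716581869), (4, 0x024716584869), (-4, 0x084716584269), (4, 0x084716584869),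
    (-4, 0x054719584569), (-2, 0x054719584869), (4, 0x084719584569), (4, 0x084743581569),
    (-4, 0x084746581869), (4, 0x054749581569)],
    [
    (2, 0x084716581569), (1, 0x014716581569), (1, 0x024716581569), (2, 0x054716581569)]]

def cocycleFactor : Fin 7 → ℤ := ![6, 1, 2, 1, 1, 6, 1]

def cocycleRelations : Fin 7 → List ℕ :=
  ![[
    0x8006cb83ba72d9aba6107ffadba9ba83cb71a6208006cba9ca83a620db718006ca83ba72dc9ab610,
    0x7ff4cba6c963db81a7207ff4b862a710c39adcb67ffaba83ca60d9aba7218006ba83ca71d9aba620,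
    0x7ffccba67210386adcb97ffecba6d710c39ba8628006ca83d710cb69ba627ff4ca83ba62c69bd710,
    0x8006dba6ba93a826c7108006dba9ba83a267c6107ffccba6d8637012cba97ff4cb83a710ca69db62,
    0x7ff4dba6ca81b936a7207ffaba63c861d9aba7207ffaba83da62ba96c7107ffaba93c710d6aba862,
    0x7ff4ba93ca817602dba67ffaca93ba826bad7610800cdba6ca70b936a8218006ba63c760d9aba821,
    0x7ff4dba7a762b936c8107ff4dba7b973a268c6108006ba83ba62da96c710800cba93ca708612dba6,
    0x800cba628610db7ac9737ff4dba78610b26ac973800cdba7c810b369a7627ff4b963a762db7ac810,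
    0x7ff4a976da73b620ca817ffa9762c810dba7ba637ff4ca728610db76ba937ff4ba93ca726b7d8610,
    0x8006dba9ba84c731a6208006c762ba10a976da83800ca973d762ca61ba807ffaa976ba10da37c862,
    0x7ffaba847210db69ca637ff4dba6b964c831a7207ff4ba94db63a862c7107ffaca84ba739bad6210,
    0x7ffaba83c721d9aba6208006cb82cb72da93a610800ccb82b732d9aca6107ffadba67210c49ba863,
    0x800cba92da71c603ba827ffaba82c721d9aba6308006ba82c620d9aba7318006ba83c620d9aba721,
    0x7ff4dba6b963c821a7207ffaba82ba72d963c6107ff4ba82a732db69c6107ff4ba92ca60d713ba82,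
    0x7ff4ba93db62a862c710800cba62b932da81c760800cba92ba62d861c730800cdba6b962a831c720,
    0x7ff4db63ba92a862c7107ff4dba672103b9ca8627ff4a832c710db6ab962800cdb62c710ba93a862,
    0x7ff4ba837210db69ca62800cdb967210ca63ba82800cba82a632db96c7107ff4ba92c710a268db63,
    0x8006ba92c620d713ba828006ba82c610d39ba7327ff4ba93b832da71c620800cba92b842da71c630,
    0x7ffaba92d721c603ba82],
    [
    0x8002cb62b862d9aca7107ffecb62b862da93a7108002ba62b962da81c7307ffeba72a872db69c610,
    0x7ffeca72a872da69b6107ffeca62a862db9ab7107fffda62a962c831b7207ffeda62a962ca81b730,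
    0x7ffecb62b862da92a710],
    [
    0x7ffab862a710cba9dc637ffadc63a710cb9ab8628006b862a710dc9bca637ffadcb9ca63071ab862,
    0x8002cba6c963db81a7208002b862a710c39adcb68004ca93a710d6bcb8627ffedcb6a710c39ab862,
    0x8004ca83ba62c69bd7108004ca83ba627016dcb98002ca83ba62dc9b76107ffeca96cb63db81a720,
    0x8004ba93a710db6ac8627ffedba6a710b39ac8628002cb83a710db62ca968002dcb97210c6aba863,
    0x8004ba83cb62da96a7108002ba96a710db38ca627ffeba96ca623b8da7108002c862a710dba6ba93,
    0x7ffeba96da623a8bc7107ffeba93c710d6aba8628002dba6a862b39ac7107ffeba83ca626a9db710,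
    0x8002da96ba63a720cb818002ba96db63ca81a7207ffedba6b963ca81a7208004ba83da62b69ac710,
    0x7ffeba62a861db93ca707ffeba62a760da93cb818002dba9ba62c38a76108002ca83ba62da96b710,
    0x7ffeba97db73a268c6108002dba7b973a268c6108002ca83ba62da96a7107ffeda96ba62ca83a710,
    0x8004a762c810dba7b9638002b963a762d7abc8108004b963a762db7ac8108002dba7a762b936c810,
    0x7ffcca728610db76ba938004ba938610db76ca728004ba93ca726b7d86107ffeba76b973c620da81,
    0x7ffe9762c810dba7ba638002ca628610db7ab9738002cb938610d7aba7627ffcdba786103b9ca762,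
    0x8002a976da73b620ca818002da76a973b620ca817ffeda97ca73a268b6107ffeda83ba72b679c610,
    0x7ffec863ba10da79a7627ffec863a762da97ba107ffeda83ca72a679b6108002da76ca73a820b961,
    0x7ffec762ba10a976da838002ca73ba62d79a86107ffca973d762ca61ba808002a976ba10da37c862,
    0x8002dba6b964c831a7208004ba94db63a862c7108002ca83ba62d69a76108002da96a863b620ca71,
    0x7ffeca847210db69ba637ffedb94ba63a862c7108002ba847210db69ca637ffeba96db64c831a720,
    0x8004cb82b732d9aca6108002ca84ba636a9d72107ffeda96ca64b831a7208002dba67210c49ba863,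
    0x7ffedba6b962a831c7207ffeba96db63c821a7208002dba6b963c821a7207ffcba82a732db69c610,
    0x8004ba93db62a862c7108006b962a632db81ca708004ba62b932da81c7608002ba96db62a831c720,
    0x7ffca832c710db6ab9628002dba6c710b926a8328006a862c7102b6dba938002db62c710ba93a862,
    0x8002dba67210a826cb937ffecb937210d6aba8628002dba672103b9ca8628002b962c710a823dba6,
    0x8002ba63db92071ca8628002ca83ba626b9d72107ffeba92c710db63a8628004db63ba92a862c710,
    0x7ffeba82a632db96c7107ffcba62b962da81c7308002ba63db92c826a7107ffeca827210db69ba63,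
    0x8006d962b632ba81ca707ffadb92b632a861ca708002ba837210db69ca627ffeba827210db6ac963,
    0x7ffcda62a932ca81b7608002da96ca62a831b7207ffeda96ca63b821a7207ffccb62b862da93a710,
    0x7ffcda92a842ca71b6308004ba92b842da71c6308002ca83ba626a9d72108002da96b710ca26a832,
    0x8004da93a832c741b6207ffec632b710da93a8628004da63a932c861b7208006da92a642c861b730,
    0x8004da92a732c842b6108002a862b710da29c6328002da92b710a268c6328004a862c632da92b710,
    0x8004da62a962ca81b7307ffeda63ca92a861b7207ffcca82a732da69b6107ffcca82a732db9ab610,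
    0x7ffcda93a732c862b6108004db93b732ca82a6108002a862b710da93ca628002da92a632ca81b760,
    0x8002da62a962c831b7208004da92a732c862b6107ffcdb92b732ca82a6107ffeda93a632c861b720,
    0x8002da92a632c861b720],
    [
    0x7fffcb62b832da96a7107fffb862c632d9aba7107fffba82a732db69c6108001cb82b732d9aca610,
    0x7fffda92a842ca71b6308001ba92b842da71c6308001d962b632ba81ca707fffdb92b632a861ca70,
    0x8001da92a732c842b6108001da93a832c741b6208001da92a642c861b7307fffa862c632da94b710,
    0x7fffda93a732c862b6108001db93b732ca82a6107fffca82a732da69b6107fffca82a732db9ab610,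
    0x8001da92a732c862b6107fffdb92b732ca82a610],
    [
    0x8002cb62da10c79ab8767ffcc976cb72ba60da818002ba76c8601a9bda767ffeba76da81c067ba96,
    0x7ffea762dc91b08acb767ffec762da80b19acb767ffecb76c762ba91da808002cb97cb62a678da10,
    0x8003ca76ba769bad82108004ba76c810da79ba628004ba76ba62da97c8108002b762a810ca96dcb7,
    0x7ffcba62ca80d716ba978004ba62da81c706ba977ffadba7ba76a962c8108003ba768210dba9ca76,
    0x7ffea762ca80b916dba77ffea762ca91b08adb768002b762ca801a9dba768002b762ca910a8bda76,
    0x7ffcba63d821c706ba977ffea762c810b936dba78002ba76c810ba97da627ffeba76a762db91ca80,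
    0x7ffeba76ba72d921c8607ffeba76c810db39a7628004ba73c820d169ba768004ba76ba73d961c820,
    0x7fffca76b8109bacda767ffeba76c810db29a7628002ba62c820d716ba977ffeba72d921c068ba76,
    0x7fffba76cb91a806dba77fffca76ca76db91ba807fffca76db80a916cba78001ca76db91a806cba7,
    0x8002dba8ba87a679c6108001ba76ca80a916dba77fffba76ca91a806dba78001ba76ca80b916dba7,
    0x8001ba879610dba8ca767fffda87ba87ba69c610],
    [
    0x8018ba96ca62dc81ba707ff4cba9d710ca68ba628018cba9ba626a8cd7108018cba9b710ca68da62,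
    0x7fe8ca81ba70ba69db627ff4cba6a962d18acb70800ccba6a862a710dcb97ff4dcb9a710ca68ba62,
    0x7fe8c976cb72ba60da817fe8dba9a710ba68ca628018ba86ca62d9aba7108018ba81ca70ba69db62,
    0x7ff4c762da80b19acb767ff4cb76c762ba91da80800ccb97cb62a678da10800ccb62da10c79ab876,
    0x7fe8da76ba62ba97c8108018ba97da72ba68c610800cb762a810ca96dcb77ff4a762dc91b08acb76,
    0x8018dba68610ba79ca728018c961ba80ba76da727fe8ba91c860ba76da727fe8ba62c810ba79da76,
    0x7fe8a976ca627badb8108018ba62da81c706ba978018ba76ba62da97c8108018dba7ba62a967c810,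
    0x7ff4a876a762dba9cb107ff4a762cb10da97ba867fe8ba86cb10da79a7628018ca76a9627badb810,
    0x7ff4a762db81c0aba976800cb762ca801a9dba76800cb762ca910a8bda767fe8ba62ca80d716ba97,
    0x7ff4a762ca80b916dba77fe8db81ca60ba76a9727ff4a762ca91b08adb768018dba7a872ba69c610,
    0x7fe8ba81c760ba69da62800ca762cb80d1aba9767fe8da61cb80a976ba727fe8dba9ba72a678c610,
    0x7fe8ca96cb63db81a7207fe8dc63a710cb9ab862800ccba9a710d36cb8628018c861ba70ba69da62,
    0x7fe8db81a760ca39cb628004cba9d8637012cba68004cba67210386adcb97ff4dcb97210c6aba863,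
    0x7ff4cba3db81c962a7607ffccba38621d706cba98004cba37620d816cba97ffccba9cba3d8627610,
    0x8018a862c710dba6ba937fd0dba6a862ba93c7108018db83a710ba69ca627fe8ba96ca623b8da710,
    0x8018db63ca81ba96a7207fe8ba96c710ba38da628018ba83da62b69ac7107fd0ba96da62ba83c710,
    0x8030dba9ba63a862c7108018a862a710dba6cb937fe8db63ca70ba96a8217fe8db63a962ca81ba70,
    0x7fe8db93ba62a861ca708018db96a710ca38ba627fe8ca83ba626b9da7108030dba97210c6aba863,
    0x8030dba7a762b963c8107fe8ba97db73a268c6108018b873a762c610dba9800cdba9c610b378a762,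
    0x8018ca728610ba93db768018ba93ca726b7d86107fe8ba76b973c620da817fe8b963a762c810dba7,
    0x7fe8a7638210dba9cb767fe8cb76a7639bad82108018a7628610dba7cb938018cb938610d7aba762,
    0x7fe8da83ba72b679c6107ffaba93c810d67ba76280069762c810dba7ba637ff4cba3a7628016db97,
    0x7fe8ca638762da97ba107ff4da76ba10c937a8627fd0da76a962ca73b8108018da76a973b620ca81,
    0x8018ca61ba80a379d7628030da97b210a867ca637fd0a876ca63da79b210800c8762ba10da97ca63,
    0x8018db967210ba48ca637fe8ba96db64c831a7208018ba94db63a862c7108018ca81ba60d379a762,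
    0x7ff4ca82ca72db9ab6107ff4dba47210b69ac8637ff4ba967210db48ca637fe8db94ba63a862c710,
    0x8018c821ba70ba69da627fe8ba92ba62da81c7607fe8ba81c720ba69da627ff4ba82ba72da69c610,
    0x7ff4ba72d921c068ba767ff4ba76ba72d921c8607fe8ba72a872db69c6107fe8da96ba62ba82c710,
    0x800cba82ba72da93c6107ffacb82cb72da93a6107ff4ba76c810db29a762800cba62c820d716ba97,
    0x7fe8db63c821ba96a7208018db82a710c623ba967ff4ba96c632071adb828006ba82ba72d963c610,
    0x8018b963da62c720ba817fe8db63a962ba81c7208018db62c720ba96a8318018db63c720ba96a821,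
    0x7ff4dba97210c36ba862800cba92c710d36ba8627ff4ba92ba62d861c7307fe8db62c821ba96a730,
    0x8030ba62b962da81c7308018ba63db92c826a710800cba627210db96ca838018ca83ba626b9d7210,
    0x7ff4ba62d821c706ba92800cba62c720d816ba928006ba92ba82d762c6107ffacb92cb82da72a610,
    0x7fe8dba9ba62ca81a7607fe8db96ba62ba81ca707fe8dba9ba62cb81a7608006ba92ba82d732c610,
    0x8018da97a762ca61ba808018ca61ba80da76a9727fe8ca81ba60da76a9728018dba6a962ca81ba70,
    0x7fe8ca76a872da89b6107fe8c971ba60da86a8728018ca71b960da87a8628018ca86b610da78a972,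
    0x8018ba62c760d9aba8617fe8ba96ca81076adb628018dba6ca81b962a7607fe8ba62c861d9aba760,
    0x7ff4cba3da70c962b8618018b861da70cb39ca628018ba96ca70186adb627fe8dba6ca70b962a861,
    0x7fe8ca61b820da76a9728018ba62a962db81ca707fe8dba9ba62a861c7208018cb62b862d9aca710,
    0x7fe8da97a762ca61b8208018c821ba60da76a9727fe8da72a762ca91b860],
    [
    0x7fffcb82cb72da93a6107ffeba92ba72d761c8607ffeba82ba72da69c6107ffeca82ca72db9ab610,
    0x7fffcb92cb82da72a6108002ba92ba62d861c7308001ba82ba72d963c6108002ba82ba72da93c610,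
    0x7ffecb82cb62da96a7108001ba92ba82d732c6108001ba92ba82d762c610]]

def cocycleRenamings : Fin 7 → List ℕ :=
  ![[
    0x8006fedcab8967543210cb97ca869854d5108006fedcba8967543210ba86c984b973d510,
    0x800cfedcba8967543210ba86c985b974d5107ff4fedcab9876543210ca76c985b974d510,
    0x7ffefe8796bdca453210dcb8dc95b874a6107ffdfe9876dcba453210dc98dcb59874a610,
    0x7ffdfedcba8976453210dc95dc84a654b710800cfe9876dcba543210d985cb94dc74a610,
    0x7ffafedbca9867453210cba8c875b864d9107ffdfedbca8976453210cba6dc95db84d710,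
    0x800cfedcba9867453210dcb8a875ca64d9107ffafedbca9867453210dcbac875b864d910,
    0x8006fedcba8967453210db98a975a864dc107ffdfedcab9867453210cba8cb75ca64d910,
    0x7ffafedcba7698543210db76d985a974dc10800cfedcba9876453210db98b765a974dc10,
    0x8006fedcab9867543210dc95dc85a641b7407ff4fedcba8967543210ba86d985b974dc10,
    0x8006fedcba9867543210dc95dc85ba61b7407ffafedcab9876543210dc95dc85a761b740,
    0x800cfedcab9876543210d986dc95a871b8407ffafedcab9786543210dc95dc64a741b840,
    0x800cfe9876dcab543210dcb9d985c641ca708006fedcba9786543210dca6dc95db71d840,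
    0x8006fedcab9867543210dc95da64dc81db707ffafedcab9867543210dc95dc84da61db70,
    0x8006fedcba8976543210ba74ba64d851dc908006fedcba8976543210b764a764d851dc90,
    0x7ffafedcab9867543210dc85da64db71dc908006fedcba8976543210dba6db74d851dc90,
    0x8018fedbca8976543210da65a754db81dc90],
    [
    0x8001fe9867dcba543210dc95d985a761b7407ffffedcab9867543210dc95d985a641b740,
    0x7ffffedcab9867543210dc95d985a651b7507ffffedcba9867543210dc95d985ba61b740,
    0x7ffefedcab9867543210dc95d985da61db708001fe9876dcba543210dc95d985da61b750,
    0x8002fedbca8976543210da75a765db81dc907ffefedcba8976543210ba74b764d851dc90],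
    [
    0x7ffefedcba8967543210ba86c985b974d5107ffefedcba8967543210ba86c984b973d510,
    0x7ffcfedcba7986543210dc87db85d954a6107ffffe8796bdca453210dc95b874d854a610,
    0x8001fe8796bdca453210db98dc95b874a6107ffffe9876dcba453210dc98dcb59874a610,
    0x7ffcfecdba9786543210dcb5d984c974a6107ffafecdba9876543210dc95cb84d874a610,
    0x8002fe9876dcba543210d985cb94dc74a6108002fedcba9786543210dc95b984db74a610,
    0x8002fe8796dcba543210b985d965dc54a7108004febdca8976543210cb85c965d954a710,
    0x8001fe8976cdba543210da86d954c854b7107ffefedbca8976453210dc95d865db84a710,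
    0x8001fedbca8976453210a986dc95db84d7107ffffe9876dcba453210da96dc95d984b710,
    0x7ffefedcab9768543210cb87ca65c854d9108002fedcba9867543210da96dc95dc74b810,
    0x7ffefedcba8976543210dba7dc85b764d9107ffefedbca9876453210cba8c765b764d910,
    0x7ffefedbca9867453210dcbac875b864d9108001fedbca9867453210cba8c875b864d910,
    0x7ffefedcba9867453210cba8c875cb64d9107ffefedcba9867453210dcb8a875ca64d910,
    0x7ffafedbca9876453210dcb8c765ba74d9108006fedcba9867543210cba6dc85b874d910,
    0x7ffefedcba9786453210cb87c865ca74d9107ffefedcba8976543210db76dc85ba74d910,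
    0x8004fedcba9876453210cb87cb65ca84d9108006fedcba9876453210dc87cb65ba84d910,
    0x8004fedcba9876453210db98b765a974dc108002fedcba8967453210db98a975a864dc10,
    0x7ffafedcab8976543210a876d985b974dc108002fedcba7698543210db76d985a974dc10,
    0x7ffefedcab9867543210dc95d985a641b7407ffcfedcab9867543210dc95d854a641b740,
    0x7ffefedcba9867543210dc95d985ba61b7408002fe9867dcba543210dc95d985a761b740,
    0x7ffefedcba9786543210db96dc95ba71b8407ffefedcab9876543210d986dc95a871b840,
    0x7ffcfedbca9786543210da65d954b751c8508002fedcba9786543210da96dc95db71d840,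
    0x7ffafedcab9867543210dc95d854a861b8708002fedcba9867543210cba6cb84c871d950,
    0x7ffefe9876dcab543210dcb9d985c641ca707ffefedcba9867543210db98dc95b641ba70,
    0x7ffcfedcba8976543210ba74b764d851dc907ffefedcba8796543210dcb7dc94a651d980,
    0x8004fedbca8976543210da65a754db81dc908002fedcba8976543210da76db74d851dc90,
    0x7ffcfedbca8976543210da65d754db81dc90],
    [
    0x7ffffedbca9786543210da65d954b751c8507ffffedcab9867543210dc95d854a641b740,
    0x8001fedbca8976543210d765a754db81dc907ffffedcab9867543210dc95d854a861b870,
    0x7ffffedbca8976543210da65d754db81dc908001fedbca8976543210da65a754db81dc90],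
    [
    0x8002fe8796bdca453210db98dc95b874a6108001fe9876dcba453210dc98dcb59874a610,
    0x8002fe9786dbca543210cb87ca85b765d9108001fe9876dcba543210cb87cba58765d910,
    0x8002fedcab9867543210dc98dc95a861b8708002fe9876dcba543210db98b987dc91da60,
    0x8001fedcab9867543210dc98dc98da61db70],
    [
    0x7fd0fedcab9876543210dc98dca6db9475108018fecdab9867543210db97ca96dc958410,
    0x8030fedcba9867543210dcb9dca6d97485108030fecdba9867543210dcb9ca96d9748510,
    0x7fd0fedcba8967543210dc98da86d974b5107ff4fecdba9867543210ca86dcb4d8739510,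
    0x7fe8fe9876dacb543210cb989764ca73d5107fe8fedacb7968543210ba86c984b973d510,
    0x7ff4fedcab8967543210cb97ca86c985d5108018fedcba9867543210a986cb95c874d510,
    0x8003fe9876dcba453210dc98dcb59874a6107fe8fedcab9867543210b987ca96c985d510,
    0x800cfe8796bdca453210db98dc95b874a6107ffdfe8796bdca453210dc87dc95b874a610,
    0x7ff4fecdba9786543210db98cb97dc95a6107fe8fedcba9786543210dc95b984db74a610,
    0x7fe8fedbca8976453210ba96dc95db84d7107fe8fedcba8796543210dca9dcb7d985d610,
    0x8018fedacb8976543210dba8db96dc95d7108018fedcba9876453210ca96d985dcb4d710,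
    0x8018fedcba9786543210ca96dc95db74d8107fe8fedcba9867543210dca6dc95d974b810,
    0x800cfedbca9867453210cba8c875b864d9107fe8fedacb9786543210db86ba75c854d910,
    0x8018fedcab9876543210a876dc85cb74d9108018fedcba9768453210c875da84cb64d910,
    0x8018fedcba9876453210cb87c865cba4d9108018fedcba9876453210dc87cb65ba84d910,
    0x800cfe9786dbca543210cb87ca85b765d9108006fe9876dcba543210cb87cba58765d910,
    0x7ff4fedcba8967453210db98a975a864dc107fe8fedcab7986543210da87db959864dc10,
    0x7fe8fedcba9876453210db98b765a974dc108018fedcba9867543210a986db95b874dc10,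
    0x800cfedcab7698543210db98da76d975dc10800cfedcab7698543210b985a765d974dc10,
    0x8006fedcab9876543210dc95dc85a761b7407ffafedcab9867543210dc95dc85a641b740,
    0x7fe8fedcba9786543210db96dc95ba71b8407ffafedcba9867543210dc95dc85ba61b740,
    0x7fe8fedcba9867543210dc95a964da71b8507ffafedcab9867543210dc95dc85a651b750,
    0x7fe8fedcab9687543210ca76c875cb81d950800cfecdba8976543210ba76ba75c851d950,
    0x7ffcfedbca9876543210a8768764db91dc508018fedcab9687543210ca76cb75cb81d950,
    0x8018fedcba8976543210dc98d875db91ca608018fecdba9786543210dcb9c975d981ba60,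
    0x800cfedcab9867543210dc98dc95a861b8707fe8fedbca7986543210db87d985dc91da60,
    0x7fe8fedcba9867543210db98dc95b641ba708018fecdba9867543210dcb9c965a981d970,
    0x8018fedcba8976543210dc98d865da91db707ff4fedcab9867543210dc95dc85da61db70,
    0x7fe8fecdba9867543210dcb9c965d971a9807fe8fedcba9867543210ba85d864dc91db70,
    0x8018fedcba8796543210dc75cb94ba61d9808018fecdba9786543210cb97dc95a961d980,
    0x8018fedcba9786543210dc95b974a651db807fe8fedcba9786543210b875d764dc91da80,
    0x7fe8fedcba8976543210dc98d865db71da907fe8fedcab97865432108765da74dc91db80,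
    0x7fe8fedbca7986543210db87dc85a651dc908018fedbca7986543210db87d985a651dc90,
    0x7ffafedcba8976543210ba74ba64d851dc907ffafedcba8976543210b764a764d851dc90,
    0x800cfedbca8976543210db859874a761dc907ffcfedbca9876543210a8768764db51dc90,
    0x7fe8fedbca8976543210dc87db85a761dc908018fedbca8976543210d987db85a761dc90,
    0x7fe8fedcba9867543210db85ba64a871dc907fe8fedcba7986543210db98d875ba61dc90,
    0x8018fedcab9786543210da758764db81dc907ff4fedcab9867543210dba5a864b871dc90,
    0x8018fedcba9687543210d765ba74db81dc908018fedcba9687543210d765a874db81dc90,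
    0x8018fedbca8976543210da75a765db81dc90],
    [
    0x8001fedcab9876543210dc95dc85a761b7407ffffedcab9867543210dc95dc85a641b740,
    0x7ffffedcab9867543210dc95dc85a651b7507ffffedcba9867543210dc95dc85ba61b740,
    0x7ffffedcba8976543210b764a764d851dc907ffefedcab9867543210dc95dc85da61db70,
    0x7ffefedbca8976543210d765a765db81dc907ffffedcba8976543210ba74ba64d851dc90]]

/-- A basis of the cocycles in the ansatz. -/
def cocycle (k : Fin 7) : FieldFormula := combination (ofCodes (cocycleCodes k))

theorem sinkFirst_cocycleCodes : ∀ k, ∀ p ∈ ofCodes (cocycleCodes k), SinkFirst p.2 := by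
  decide +kernel

theorem certifies_cocycle : ∀ k,
    certifies 4 1 (combinationSchouten (cocycleFactor k) (ofCodes (cocycleCodes k)))
      (cocycleRelations k) (cocycleRenamings k) = true := by decide +kernel

theorem isOneCocycle_cocycle (k : Fin 7) : IsOneCocycle (cocycle k) := by
  refine isOneCocycle_combination (cocycleFactor k) ?_ (sinkFirst_cocycleCodes k) ?_
    (certifies_cocycle k)
  · revert k; decide
  · revert k; decide +kernel


/-! ### Spanning sets of the ansatz -/

/-- Codes of micro-graphs whose skew pairs span a complement of the cocycles. -/
def complementCodes : List ℕ :=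
  [0x014713581269, 0x054716584569, 0x054746584869, 0x024743584269, 0x024713581269,
    0x024746584269, 0x024749584269, 0x014716581869, 0x084749584869, 0x084746584869,
    0x054743581569, 0x014743584269, 0x014713584269, 0x054713581269, 0x024743581569,
    0x024713581569, 0x084743584869, 0x084743581869, 0x014743584869, 0x024743581869,
    0x014743587269, 0x084746587869, 0x054749584869, 0x014713584569, 0x014716584869,
    0x014719584869, 0x014719584569, 0x014749584869, 0x054749581569, 0x084719584869,
    0x054719584569, 0x084743587869, 0x084746581869, 0x084716584869, 0x054716581869,
    0x014716581569, 0x054716581569, 0x024716581569, 0x014746584869, 0x024743587269,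
    0x014719584269, 0x014713584869, 0x054713581569, 0x014713581569, 0x024716581269,
    0x054716581269, 0x054713581869, 0x024716581869, 0x024716584869, 0x024719584869,
    0x084743581569, 0x024719584569, 0x084716584269, 0x084749581569, 0x054716584869,
    0x084719584569, 0x054719584869]

/-- A micro-graph with a multiple of its skew pair and a linear combination with zero sum, and
relations that prove this. -/
structure SpanEntry where
  head : ℤ × ℕ
  tail : List (ℤ × ℕ)
  relations : List ℕ
  renamings : List ℕ

def spanEntries : List SpanEntry :=
  [⟨(2, 0x014716584269), [(1, 0x024716581569), (-2, 0x054716581269)],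
      [0x7fff0000ba82c603ba727fff0000ba83c27ba620], []⟩,
   ⟨(3, 0x014716584569), [], [0x80010000cba8c27ba620], []⟩,
   ⟨(2, 0x024716584269), [(1, 0x024716581569), (-2, 0x054716581269), (2, 0x014713584569)],
      [0x7fff0000ba60c28ba7327fff0000ba72c38ba62080020000b732c8aba620],
      [0x7ffefedbca96785432100000ca74b643cb807ffefedcba97865432100000cba7c843b640]⟩,
   ⟨(3, 0x024716584569), [], [0x80010000cba8c37ba620], []⟩,
   ⟨(1, 0x084716584569), [(-2, 0x054716584869)], [0x80010000cb62c8aba760], []⟩,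
   ⟨(1, 0x024719584269), [(1, 0x014713584869), (-1, 0x014719584269)], [0x80010000b620ca86a732],
      [0x7ffffedcab96875342100000b764ca73c8407ffffed8769acb5432100000cb76a743c840]⟩,
   ⟨(1, 0x054719584269), [(1, 0x024716584869), (-1, 0x084716584269)], [0x80010000cb63ba86a720],
      [0x7ffffedcba98675432100000cb84a863ca708001fedcab97865342100000cb84ca73a860]⟩,
   ⟨(2, 0x084719584269), [(-2, 0x084716584269), (2, 0x024719584569), (-1, 0x024719584869)],
      [0x7fff0000ba60c38ba7627ffe0000b863a720cba67fff0000ba73c620ba86],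
      [0x7ffffedcab97865342100000cb84ca738760]⟩,
   ⟨(1, 0x054743581869), [(2, 0x024716584869), (-2, 0x084716584269)],
      [0x80010000ba70b36ac86280020000cb63ba86a720],
      [0x8001fedcab97865432100000ca74b763cb808002fedcab97865342100000cb84ca73a860,
         0x7ffffedacb97865342100000c764ba73cb80]⟩,
   ⟨(1, 0x054746581869), [(-2, 0x054716584869)], [0x7fff0000ba70cb6ac862], []⟩,
   ⟨(3, 0x084746581569), [(-6, 0x054716584869)],
      [0x7ffe0000cba2c68ba76080060000cb86ca26ba7080030000cb82c6aba760],
      [0x7ffdfedcab98675432100000cb87ca86ba40]⟩,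
   ⟨(1, 0x054749581869), [(-2, 0x054719584869)], [0x7fff0000c760ba87ba62], []⟩,
   ⟨(1, 0x054743584869), [(-1, 0x054719584569), (1, 0x054749581569)], [0x7fff0000ba70c6aba862],
      [0x8001fedcab96875432100000ca76cb74cb808001fedcba98675432100000cba8c864cb70]⟩,
   ⟨(1, 0x014746584569), [(2, 0x054716584569)], [0x7fff0000cba8c7aba620],
      [0x7ffffedcab98675432100000cba8ca64cb70]⟩,
   ⟨(1, 0x084746584269), [(-1, 0x054719584569), (-1, 0x014746584869)], [0x80010000cba6ba86a720],
      [0x8001fedcba98675432100000cba8c864cb70]⟩,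
   ⟨(1, 0x084746584569), [(-2, 0x054746584869)], [0x7fff0000cba6c8aba760], []⟩,
   ⟨(2, 0x084749584269), [(-2, 0x084716584869), (2, 0x084746581869), (-1, 0x014749584869)],
      [0x80010000a762ca87ba6080020000ba60ca76a87280010000ca76a802ba76],
      [0x7ffefedbca98675432100000cba8b864c8707ffefedcba97865432100000cb87ca74c860,
         0x8002fedcab96875432100000ca76c874cb807ffefedcba97865432100000cb87c764ca80]⟩,
   ⟨(2, 0x014743587569), [(2, 0x024719584569), (1, 0x024719584869)],
      [0x80010000cba6b836a7207fff0000ba73062acb86], [0x8002fedbac97685432100000cb87ca64a830]⟩,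
   ⟨(2, 0x014743587869), [(-2, 0x084716584269), (2, 0x024719584569), (2, 0x084743581569)],
      [0x7ffe0000a760cb38ba6280020000b763cba8a620],
      [0x7ffefedbca98675342100000cba4b863c8708002fedcba97685432100000cba6c874b830,
         0x8001fedbca98675342100000c874b863cba08002fed7689bca5342100000c764a873cb80]⟩,
   ⟨(1, 0x054743587269), [(2, 0x084716584269), (1, 0x024719584869)], [0x80010000ba73c620ba86], []⟩,
   ⟨(1, 0x054743587569), [(1, 0x054719584569), (1, 0x084719584869), (1, 0x014746584869)],
      [0x7fff0000ba72ca68ba607fff0000cba6ba86a720],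
      [0x8001fedcab97685432100000cb87ca64ca807ffffedcba98675432100000cba8c864cb70]⟩,
   ⟨(1, 0x054743587869), [(1, 0x054719584869), (-2, 0x084719584569), (2, 0x084749581569)],
      [0x80020000a860cb7ab76280010000b7628baca760], []⟩,
   ⟨(2, 0x084743587269), [(2, 0x084716584269), (1, 0x024719584869)],
      [0x80010000ba60c38ba76280010000ba73c620ba86], []⟩,
   ⟨(1, 0x084743587569), [(1, 0x054719584869), (-2, 0x084719584569), (1, 0x084749581569)],
      [0x80010000a860cb7ab7627fff0000ba627b8ca760], []⟩,
   ⟨(3, 0x014746587569), [(6, 0x054716584869)], [0x80010000cba0c68ba7627ffd0000cb76a620cba8], []⟩,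
   ⟨(4, 0x014746587869), [(-4, 0x054719584869), (16, 0x084719584569), (-8, 0x084749581569)],
      [0x7ffc0000ba72086acb767ff80000a860cb7ab76280040000ba62c706ba8780020000cba7687ba620,
         0x800100008760ba76cba280010000cba2b67a8760], []⟩,
   ⟨(2, 0x024746587269), [(2, 0x054716581869), (-1, 0x084716581569), (-2, 0x014716584869), (2,
      0x014719584569)],
      [0x80010000ba82076cba627ffe0000cb62ba86a72080010000cba6b826a72080020000b762a620cba8],
      [0x7ffefedcab97865432100000cb84ca74a8607ffffedcab97865432100000cb84ca748760,
         0x7ffefed8769acb5432100000cb84c764a870]⟩,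
   ⟨(3, 0x054746587269), [(6, 0x054716584869)],
      [0x7fff0000cba0c68ba7627ffd0000ba70cb68ca627ffd0000c762cba8ba60], []⟩,
   ⟨(2, 0x054746587569), [(2, 0x054746584869)], [0x7ffe0000ca76cba8ba60],
      [0x8001fedcab98675432100000cb87ca86cba0]⟩,
   ⟨(6, 0x054746587869), [], [0x7ffe0000cba7687cba60], [0x7ffffedbca98765432100000c876b876cba0]⟩,
   ⟨(4, 0x084746587269), [(4, 0x084719584569)],
      [0x7fff00008760cba7ba6280010000cba2b678a76080020000cba7687ba62080040000cba7a067b862], []⟩,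
   ⟨(6, 0x084746587569), [], [0x7ffe0000cba7076acb86],
      [0x7ffffedbca98765432100000c876b876cba07ffafedcab96875432100000ca76b876cb80]⟩,
   ⟨(4, 0x014749587569), [(4, 0x054719584869)],
      [0x80010000ba76ba82c76080020000ba82c67ba76080020000ba87062acb767ffc0000ba87c67ba620,
         0x7fff00007620cba8ba76], [0x8002fedcba96875432100000cba8cb768740]⟩,
   ⟨(2, 0x024749587269), [(2, 0x014719584569), (1, 0x014719584869)],
      [0x80010000cba6b826a7207fff0000ba72062acb86], []⟩,
   ⟨(2, 0x054749587269), [(2, 0x054719584869)], [0x80010000c760ba87ba6280010000ba82c67ba760], []⟩,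
   ⟨(2, 0x054749587569), [(1, 0x054749584869)], [0x80010000ca76ba87ba60], []⟩,
   ⟨(3, 0x054749587869), [], [0x7fff0000cba8c67ba760], []⟩,
   ⟨(6, 0x084749587269), [(6, 0x054716584869)], [0x80020000cba2c68ba76080060000cb86ca27ba60],
      [0x8003fedcab98675432100000cb87ca86ba40]⟩,
   ⟨(12, 0x084749587569), [], [0x80020000cba7076acb867ffa0000cb87ca67ba60],
      [0x8001fedbca98765432100000c876b876cba08006fedcab96875432100000ca76b876cb80]⟩,
   ⟨(1, 0x014713581869), [(-1, 0x014713581569)], [], []⟩,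
   ⟨(1, 0x024713581869), [(-1, 0x024713581569)], [], []⟩,
   ⟨(1, 0x084713581269), [(-1, 0x054713581269)], [], []⟩,
   ⟨(1, 0x084713581569), [(-1, 0x054713581869)], [], []⟩,
   ⟨(1, 0x084713581869), [(-1, 0x054713581569)], [], []⟩,
   ⟨(1, 0x014716581269), [(-1, 0x014713581569)], [], []⟩,
   ⟨(1, 0x014719581269), [(-1, 0x014713581569)], [], []⟩,
   ⟨(1, 0x014719581569), [(-1, 0x014716581869)], [], []⟩,
   ⟨(1, 0x014719581869), [(-1, 0x014716581569)], [], []⟩,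
   ⟨(1, 0x024719581269), [(-1, 0x024716581269)], [], []⟩,
   ⟨(1, 0x024719581569), [(-1, 0x024716581869)], [], []⟩,
   ⟨(1, 0x024719581869), [(-1, 0x024716581569)], [], []⟩,
   ⟨(1, 0x054719581269), [(-1, 0x084716581269)], [], []⟩,
   ⟨(1, 0x054719581569), [(-1, 0x084716581869)], [], []⟩,
   ⟨(1, 0x054719581869), [(-1, 0x084716581569)], [], []⟩,
   ⟨(1, 0x084719581269), [(-1, 0x054716581269)], [], []⟩,
   ⟨(1, 0x084719581569), [(-1, 0x054716581869)], [], []⟩,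
   ⟨(1, 0x084719581869), [(-1, 0x054716581569)], [], []⟩,
   ⟨(1, 0x024713584269), [], [], []⟩,
   ⟨(1, 0x024713584569), [], [], []⟩,
   ⟨(1, 0x024713584869), [], [], []⟩,
   ⟨(1, 0x054713584269), [], [], []⟩,
   ⟨(1, 0x054713584569), [], [], []⟩,
   ⟨(1, 0x054713584869), [], [], []⟩,
   ⟨(1, 0x084713584269), [], [], []⟩,
   ⟨(1, 0x084713584569), [], [], []⟩,
   ⟨(1, 0x084713584869), [], [], []⟩,
   ⟨(2, 0x054716584269), [], [], [0x8001fedcab97865342100000cb84ca73ba60]⟩,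
   ⟨(1, 0x014713587269), [(-1, 0x014713584269)], [], []⟩,
   ⟨(1, 0x014713587569), [(-1, 0x014713584869)], [], []⟩,
   ⟨(1, 0x014713587869), [(-1, 0x014713584569)], [], []⟩,
   ⟨(1, 0x024713587269), [], [], []⟩,
   ⟨(1, 0x024713587569), [], [], []⟩,
   ⟨(1, 0x024713587869), [], [], []⟩,
   ⟨(1, 0x054713587269), [], [], []⟩,
   ⟨(1, 0x054713587569), [], [], []⟩,
   ⟨(1, 0x054713587869), [], [], []⟩,
   ⟨(1, 0x084713587269), [], [], []⟩,
   ⟨(1, 0x084713587569), [], [], []⟩,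
   ⟨(1, 0x084713587869), [], [], []⟩,
   ⟨(1, 0x014716587269), [(-1, 0x014719584269)], [], []⟩,
   ⟨(1, 0x014716587569), [(-1, 0x014719584869)], [], []⟩,
   ⟨(1, 0x014716587869), [(-1, 0x014719584569)], [], []⟩,
   ⟨(1, 0x024716587269), [(-1, 0x024719584269)], [], []⟩,
   ⟨(1, 0x024716587569), [(-1, 0x024719584869)], [], []⟩,
   ⟨(1, 0x024716587869), [(-1, 0x024719584569)], [], []⟩,
   ⟨(1, 0x054716587269), [(-1, 0x084719584269)], [], []⟩,
   ⟨(1, 0x054716587569), [(-1, 0x084719584869)], [], []⟩,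
   ⟨(1, 0x054716587869), [(-1, 0x084719584569)], [], []⟩,
   ⟨(1, 0x084716587269), [(-1, 0x054719584269)], [], []⟩,
   ⟨(1, 0x084716587569), [(-1, 0x054719584869)], [], []⟩,
   ⟨(1, 0x084716587869), [(-1, 0x054719584569)], [], []⟩,
   ⟨(1, 0x014719587269), [(-1, 0x014716584269)], [], []⟩,
   ⟨(1, 0x014719587569), [(-1, 0x014716584869)], [], []⟩,
   ⟨(3, 0x014719587869), [], [0x80010000cba8c27ba620], []⟩,
   ⟨(1, 0x024719587269), [(-1, 0x024716584269)], [], []⟩,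
   ⟨(1, 0x024719587569), [(-1, 0x024716584869)], [], []⟩,
   ⟨(3, 0x024719587869), [], [0x80010000cba8c37ba620], []⟩,
   ⟨(1, 0x054719587269), [(-1, 0x084716584269)], [], []⟩,
   ⟨(1, 0x054719587569), [(-1, 0x084716584869)], [], []⟩,
   ⟨(1, 0x054719587869), [(-1, 0x084716584569)], [], []⟩,
   ⟨(2, 0x084719587269), [], [], [0x8001fedcab97865342100000cb84ca73ba60]⟩,
   ⟨(1, 0x084719587569), [(-1, 0x054716584869)], [], []⟩,
   ⟨(1, 0x084719587869), [(-1, 0x054716584569)], [], []⟩,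
   ⟨(1, 0x014743581269), [(-1, 0x014713584269)], [], []⟩,
   ⟨(1, 0x014743581569), [(-1, 0x014716584269)], [], [0x7ffffedcab97865342100000cb84ca73a640]⟩,
   ⟨(1, 0x014743581869), [(-1, 0x014719584269)], [], [0x7ffffed8769acb5342100000cb84c763a740]⟩,
   ⟨(1, 0x024743581269), [(1, 0x014713584269)], [], []⟩,
   ⟨(1, 0x054743581269), [], [], []⟩,
   ⟨(1, 0x084743581269), [], [], []⟩,
   ⟨(1, 0x014746581269), [(-1, 0x014713584569)], [], [0x8001fedcba97865432100000cba7c843b640]⟩,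
   ⟨(3, 0x014746581569), [], [0x80010000cba8c27ba620], []⟩,
   ⟨(1, 0x014746581869), [(-1, 0x014719584569)], [], []⟩,
   ⟨(1, 0x024746581269), [(1, 0x014713584569)], [], [0x7ffffedcba97865432100000cba7c843b640]⟩,
   ⟨(3, 0x024746581569), [], [0x80010000cba8c37ba620], []⟩,
   ⟨(1, 0x024746581869), [(-1, 0x024719584569)], [], []⟩,
   ⟨(1, 0x054746581269), [], [], []⟩,
   ⟨(1, 0x054746581569), [(-1, 0x054716584569)], [], []⟩,
   ⟨(1, 0x084746581269), [], [], []⟩,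
   ⟨(1, 0x014749581269), [(-1, 0x014713584869)], [], [0x8001fedcba97685432100000cb87c643a840]⟩,
   ⟨(1, 0x014749581569), [(-1, 0x014716584869)], [], []⟩,
   ⟨(1, 0x014749581869), [(-1, 0x014719584869)], [], []⟩,
   ⟨(1, 0x024749581269), [(1, 0x014713584869)], [], [0x7ffffedcba97685432100000cb87c643a840]⟩,
   ⟨(1, 0x024749581569), [(-1, 0x024716584869)], [], []⟩,
   ⟨(1, 0x024749581869), [(-1, 0x024719584869)], [], []⟩,
   ⟨(1, 0x054749581269), [], [], []⟩,
   ⟨(1, 0x084749581269), [], [], []⟩,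
   ⟨(1, 0x084749581869), [(-1, 0x084719584869)], [], []⟩,
   ⟨(1, 0x024743584569), [(-1, 0x014743584569)], [], []⟩,
   ⟨(1, 0x024743584869), [(-1, 0x014743584869)], [], []⟩,
   ⟨(1, 0x054743584269), [(1, 0x054743581569)], [], []⟩,
   ⟨(1, 0x054743584569), [], [], []⟩,
   ⟨(1, 0x014746584269), [(-1, 0x014743584569)], [], []⟩,
   ⟨(1, 0x024746584569), [(-1, 0x014746584569)], [], []⟩,
   ⟨(1, 0x024746584869), [(-1, 0x014746584869)], [], []⟩,
   ⟨(1, 0x054746584269), [(1, 0x054716584569)], [], []⟩,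
   ⟨(1, 0x054746584569), [], [], []⟩,
   ⟨(1, 0x014749584269), [(-1, 0x014743584869)], [], []⟩,
   ⟨(1, 0x014749584569), [(-1, 0x014746584869)], [], []⟩,
   ⟨(1, 0x024749584569), [(-1, 0x014746584869)], [], []⟩,
   ⟨(1, 0x024749584869), [(-1, 0x014749584869)], [], []⟩,
   ⟨(1, 0x054749584269), [(1, 0x054749581569)], [], []⟩,
   ⟨(1, 0x054749584569), [], [], []⟩,
   ⟨(1, 0x024743587569), [(-1, 0x014743587569)], [], []⟩,
   ⟨(1, 0x024743587869), [(-1, 0x014743587869)], [], []⟩,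
   ⟨(1, 0x014746587269), [(-1, 0x014743587869)], [], [0x7ffffedcba97685432100000cba6c874b830]⟩,
   ⟨(1, 0x024746587569), [(-1, 0x014746587569)], [], []⟩,
   ⟨(1, 0x024746587869), [(-1, 0x014746587869)], [], []⟩,
   ⟨(1, 0x014749587269), [(-1, 0x014743587569)], [], [0x7ffffedcab97685432100000cb87ca64a830]⟩,
   ⟨(1, 0x014749587869), [(-1, 0x014746587569)], [], [0x7ffffedcba97685432100000cb87cba6a840]⟩,
   ⟨(1, 0x024749587569), [(-1, 0x014749587569)], [], []⟩,
   ⟨(1, 0x024749587869), [(-1, 0x014746587569)], [], [0x7ffffedcba97685432100000cb87cba6a840]⟩,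
   ⟨(1, 0x084749587869), [(-1, 0x054746587569)], [], [0x7ffffedcba97685432100000cb87cba6ca80]⟩,
   ⟨(1, 0x014773581269), [(-1, 0x014713584269)], [], []⟩,
   ⟨(1, 0x014773581569), [(-1, 0x014719584269)], [], [0x7ffffed8769acb5342100000cb84c763a740]⟩,
   ⟨(1, 0x014773581869), [(-1, 0x014716584269)], [], [0x7ffffedcab97865342100000cb84ca73a640]⟩,
   ⟨(1, 0x024773581269), [(1, 0x014713584269)], [], []⟩,
   ⟨(1, 0x024773581569), [(-1, 0x024743581869)], [], []⟩,
   ⟨(1, 0x024773581869), [(-1, 0x024743581569)], [], []⟩,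
   ⟨(1, 0x054773581269), [], [], []⟩,
   ⟨(1, 0x054773581569), [(-1, 0x084743581869)], [], []⟩,
   ⟨(1, 0x054773581869), [(-1, 0x084743581569)], [], []⟩,
   ⟨(1, 0x084773581269), [], [], []⟩,
   ⟨(1, 0x084773581569), [(-1, 0x054743581869)], [], []⟩,
   ⟨(1, 0x084773581869), [(-1, 0x054743581569)], [], []⟩,
   ⟨(1, 0x014776581269), [(-1, 0x014713584869)], [], [0x8001fedcba97685432100000cb87c643a840]⟩,
   ⟨(1, 0x014776581569), [(-1, 0x014719584869)], [], []⟩,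
   ⟨(1, 0x014776581869), [(-1, 0x014716584869)], [], []⟩,
   ⟨(1, 0x024776581269), [(1, 0x014713584869)], [], [0x7ffffedcba97685432100000cb87c643a840]⟩,
   ⟨(1, 0x024776581569), [(-1, 0x024719584869)], [], []⟩,
   ⟨(1, 0x024776581869), [(-1, 0x024716584869)], [], []⟩,
   ⟨(1, 0x054776581269), [], [], []⟩,
   ⟨(1, 0x054776581569), [(-1, 0x084719584869)], [], []⟩,
   ⟨(1, 0x054776581869), [(-1, 0x084749581569)], [], []⟩,
   ⟨(1, 0x084776581269), [], [], []⟩,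
   ⟨(1, 0x084776581569), [(-1, 0x054749581869)], [], []⟩,
   ⟨(1, 0x084776581869), [(-1, 0x054749581569)], [], []⟩,
   ⟨(1, 0x014779581269), [(-1, 0x014713584569)], [], [0x8001fedcba97865432100000cba7c843b640]⟩,
   ⟨(1, 0x014779581569), [(-1, 0x014719584569)], [], []⟩,
   ⟨(3, 0x014779581869), [], [0x80010000cba8c27ba620], []⟩,
   ⟨(1, 0x024779581269), [(1, 0x014713584569)], [], [0x7ffffedcba97865432100000cba7c843b640]⟩,
   ⟨(1, 0x024779581569), [(-1, 0x024719584569)], [], []⟩,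
   ⟨(3, 0x024779581869), [], [0x80010000cba8c37ba620], []⟩,
   ⟨(1, 0x054779581269), [], [], []⟩,
   ⟨(1, 0x054779581569), [(-1, 0x084746581869)], [], []⟩,
   ⟨(1, 0x054779581869), [(-1, 0x084746581569)], [], []⟩,
   ⟨(1, 0x084779581269), [], [], []⟩,
   ⟨(1, 0x084779581569), [(-1, 0x054746581869)], [], []⟩,
   ⟨(1, 0x084779581869), [(-1, 0x054716584569)], [], []⟩,
   ⟨(1, 0x014773584269), [(-1, 0x014743587269)], [], []⟩,
   ⟨(1, 0x014773584569), [(-1, 0x014743587869)], [], []⟩,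
   ⟨(1, 0x014773584869), [(-1, 0x014743587569)], [], []⟩,
   ⟨(1, 0x024773584269), [(-1, 0x024743587269)], [], []⟩,
   ⟨(1, 0x024773584569), [(-1, 0x014743587869)], [], []⟩,
   ⟨(1, 0x024773584869), [(-1, 0x014743587569)], [], []⟩,
   ⟨(1, 0x054773584269), [(-1, 0x084743587269)], [], []⟩,
   ⟨(1, 0x054773584569), [(-1, 0x084743587869)], [], []⟩,
   ⟨(1, 0x054773584869), [(-1, 0x084743587569)], [], []⟩,
   ⟨(1, 0x084773584269), [(-1, 0x054743587269)], [], []⟩,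
   ⟨(1, 0x084773584569), [(-1, 0x054743587869)], [], []⟩,
   ⟨(1, 0x084773584869), [(-1, 0x054743587569)], [], []⟩,
   ⟨(1, 0x014776584269), [(-1, 0x014743587569)], [], [0x7ffffedcab97685432100000cb87ca64a830]⟩,
   ⟨(1, 0x014776584569), [(-1, 0x014746587569)], [], [0x7ffffedcba97685432100000cb87cba6a840]⟩,
   ⟨(1, 0x014776584869), [(-1, 0x014749587569)], [], []⟩,
   ⟨(1, 0x024776584269), [(-1, 0x024749587269)], [], []⟩,
   ⟨(1, 0x024776584569), [(-1, 0x014746587569)], [], [0x7ffffedcba97685432100000cb87cba6a840]⟩,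
   ⟨(1, 0x024776584869), [(-1, 0x014749587569)], [], []⟩,
   ⟨(1, 0x054776584269), [(-1, 0x084749587269)], [], []⟩,
   ⟨(1, 0x054776584569), [(-1, 0x054746587569)], [], [0x7ffffedcba97685432100000cb87cba6ca80]⟩,
   ⟨(12, 0x054776584869), [], [0x80020000cba7076acb867ffa0000cb87ca67ba60],
      [0x8001fedbca98765432100000c876b876cba08006fedcab96875432100000ca76b876cb80]⟩,
   ⟨(1, 0x084776584269), [(-1, 0x054749587269)], [], []⟩,
   ⟨(3, 0x084776584569), [], [0x7fff0000cba8c67ba760], []⟩,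
   ⟨(1, 0x084776584869), [(-1, 0x054749587569)], [], []⟩,
   ⟨(1, 0x014779584269), [(-1, 0x014743587869)], [], [0x7ffffedcba97685432100000cba6c874b830]⟩,
   ⟨(1, 0x014779584569), [(-1, 0x014746587869)], [], []⟩,
   ⟨(1, 0x014779584869), [(-1, 0x014746587569)], [], []⟩,
   ⟨(1, 0x024779584269), [(-1, 0x024746587269)], [], []⟩,
   ⟨(1, 0x024779584569), [(-1, 0x014746587869)], [], []⟩,
   ⟨(1, 0x024779584869), [(-1, 0x014746587569)], [], []⟩,
   ⟨(1, 0x054779584269), [(-1, 0x084746587269)], [], []⟩,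
   ⟨(1, 0x054779584569), [(-1, 0x084746587869)], [], []⟩,
   ⟨(6, 0x054779584869), [], [0x7ffe0000cba7076acb86],
      [0x7ffffedbca98765432100000c876b876cba07ffafedcab96875432100000ca76b876cb80]⟩,
   ⟨(1, 0x084779584269), [(-1, 0x054746587269)], [], []⟩,
   ⟨(6, 0x084779584569), [], [0x7ffe0000cba7687cba60], [0x7ffffedbca98765432100000c876b876cba0]⟩,
   ⟨(1, 0x084779584869), [(-1, 0x054746587569)], [], []⟩,
   ⟨(1, 0x014773587269), [(-1, 0x014743584269)], [], []⟩,
   ⟨(1, 0x014773587569), [(-1, 0x014743584869)], [], []⟩,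
   ⟨(1, 0x014773587869), [(-1, 0x014743584569)], [], []⟩,
   ⟨(1, 0x024773587269), [(-1, 0x024743584269)], [], []⟩,
   ⟨(1, 0x024773587569), [(-1, 0x014743584869)], [], []⟩,
   ⟨(1, 0x024773587869), [(-1, 0x014743584569)], [], []⟩,
   ⟨(1, 0x054773587269), [(-1, 0x084743584269)], [], []⟩,
   ⟨(1, 0x054773587569), [(-1, 0x084743584869)], [], []⟩,
   ⟨(1, 0x054773587869), [(-1, 0x084743584569)], [], []⟩,
   ⟨(1, 0x084773587269), [(1, 0x054743581569)], [], []⟩,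
   ⟨(1, 0x084773587569), [(-1, 0x054743584869)], [], []⟩,
   ⟨(1, 0x084773587869), [], [], []⟩,
   ⟨(1, 0x014776587269), [(-1, 0x014743584869)], [], []⟩,
   ⟨(1, 0x014776587569), [(-1, 0x014749584869)], [], []⟩,
   ⟨(1, 0x014776587869), [(-1, 0x014746584869)], [], []⟩,
   ⟨(1, 0x024776587269), [(-1, 0x024749584269)], [], []⟩,
   ⟨(1, 0x024776587569), [(-1, 0x014749584869)], [], []⟩,
   ⟨(1, 0x024776587869), [(-1, 0x014746584869)], [], []⟩,
   ⟨(1, 0x054776587269), [(-1, 0x084749584269)], [], []⟩,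
   ⟨(1, 0x054776587569), [(-1, 0x084749584869)], [], []⟩,
   ⟨(1, 0x054776587869), [(-1, 0x084749584569)], [], []⟩,
   ⟨(1, 0x084776587269), [(1, 0x054749581569)], [], []⟩,
   ⟨(1, 0x084776587569), [(-1, 0x054749584869)], [], []⟩,
   ⟨(1, 0x084776587869), [], [], []⟩,
   ⟨(1, 0x014779587269), [(-1, 0x014743584569)], [], []⟩,
   ⟨(1, 0x014779587569), [(-1, 0x014746584869)], [], []⟩,
   ⟨(1, 0x014779587869), [(-1, 0x014746584569)], [], []⟩,
   ⟨(1, 0x024779587269), [(-1, 0x024746584269)], [], []⟩,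
   ⟨(1, 0x024779587569), [(-1, 0x014746584869)], [], []⟩,
   ⟨(1, 0x024779587869), [(-1, 0x014746584569)], [], []⟩,
   ⟨(1, 0x054779587269), [(-1, 0x084746584269)], [], []⟩,
   ⟨(1, 0x054779587569), [(-1, 0x084746584869)], [], []⟩,
   ⟨(1, 0x054779587869), [(-1, 0x084746584569)], [], []⟩,
   ⟨(1, 0x084779587269), [(1, 0x054716584569)], [], []⟩,
   ⟨(1, 0x084779587569), [(-1, 0x054746584869)], [], []⟩,
   ⟨(1, 0x084779587869), [], [], []⟩]

def SpanEntry.codes (e : SpanEntry) : List (ℤ × Graph) := ofCodes (e.head :: e.tail)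

/-- The skew pair of the head is a linear combination of known skew pairs. -/
def SpanEntry.valid (known : List ℕ) (e : SpanEntry) : Bool :=
  !Int.beq' e.head.1 0 && (e.tail.all fun p => known.any (Nat.beq p.2)) &&
    (decide (∀ p ∈ e.codes, SinkFirst p.2) &&
      (((combinationRows e.codes).all fun p => wellFormed 3 p.2) &&
        certifies 3 (-1) (combinationRows e.codes) e.relations e.renamings))

/-- The skew pairs with the given codes are linear combinations of known skew pairs. -/
def spans (l : List ℕ) : List ℕ → List SpanEntry → Bool
  | known, [] => l.all fun k => known.any (Nat.beq k)
  | known, e :: es => e.valid known && spans l (e.head.2 :: known) es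

def descendantCodes : List ℕ :=
  [1, 2, 5, 8].flatMap fun k₁ => [1, 4, 7].flatMap fun i₁ => [3, 6, 9].flatMap fun j =>
    [1, 4, 7].flatMap fun i₂ => [2, 5, 8].map fun k₂ =>
      0x004700580069 + (k₁ * 0x10000000000 + i₁ * 0x10000000 + j * 0x1000000 + i₂ * 0x1000 +
        k₂ * 0x100)

def descendantList : List Graph :=
  [1, 2, 5, 8].flatMap fun k₁ => [1, 4, 7].flatMap fun i₁ => [3, 6, 9].flatMap fun j =>
    [1, 4, 7].flatMap fun i₂ => [2, 5, 8].map fun k₂ =>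
      ![![0, k₁, 4, 7], ![i₁, j, 5, 8], ![i₂, k₂, 6, 9]]

theorem mem_descendants {G : Graph} : G ∈ descendants ↔ G ∈ descendantList := by
  simp only [descendantList, List.mem_flatMap, List.mem_map, descendants, Set.mem_union,
    Set.mem_ofPred_eq, Set.mem_insert_iff, Set.mem_singleton_iff, List.mem_cons, List.not_mem_nil,
    or_false]
  constructor
  · rintro (⟨i₁, h₁, i₂, h₂, j, hj, k, hk, rfl⟩ | ⟨i₁, h₁, i₂, h₂, j, hj, k₁, hk₁, k₂, hk₂, rfl⟩)
    · exact ⟨1, .inl rfl, i₁, h₁, j, hj, i₂, h₂, k, hk, rfl⟩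
    · exact ⟨k₁, .inr hk₁, i₁, h₁, j, hj, i₂, h₂, k₂, hk₂, rfl⟩
  · rintro ⟨k₁, rfl | hk₁, i₁, h₁, j, hj, i₂, h₂, k₂, hk₂, rfl⟩
    · exact .inl ⟨i₁, h₁, i₂, h₂, j, hj, k₂, hk₂, rfl⟩
    · exact .inr ⟨i₁, h₁, i₂, h₂, j, hj, k₁, hk₁, k₂, hk₂, rfl⟩

theorem descendantCodes_map : descendantCodes.map ofCode = descendantList := by decide +kernel

theorem mem_descendants_iff {G : Graph} :
    G ∈ descendants ↔ ∃ k ∈ descendantCodes, ofCode k = G := by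
  rw [mem_descendants, ← descendantCodes_map, List.mem_map]

theorem combination_singleton_mem {V : Submodule ℝ FieldFormula} {c : ℤ} {k : ℕ}
    {l : List (ℤ × ℕ)} (hc : c ≠ 0) (h : combination (ofCodes ((c, k) :: l)) ∈ V)
    (hl : ∀ p ∈ l, skewPair (ofCode p.2) ∈ V) : skewPair (ofCode k) ∈ V := by
  have h₁ : combination (ofCodes l) ∈ V := combination_mem fun p hp => by
    obtain ⟨q, hq, rfl⟩ := List.mem_map.1 hp
    exact hl q hq
  have h₂ : (c : ℝ) • skewPair (ofCode k) ∈ V := (V.add_mem_iff_left h₁).1 h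
  exact (V.smul_mem_iff (by exact_mod_cast hc)).1 h₂

theorem mem_of_any {k : ℕ} {l : List ℕ} (h : l.any (Nat.beq k) = true) : k ∈ l := by
  obtain ⟨m, hm, e⟩ := List.any_eq_true.1 h
  exact (Nat.eq_of_beq_eq_true e) ▸ hm

theorem skewPair_mem_of_spans {V : Submodule ℝ FieldFormula} {l : List ℕ}
    {es : List SpanEntry} : ∀ {known : List ℕ}, spans l known es = true →
      (∀ k ∈ known, skewPair (ofCode k) ∈ V) → ∀ k ∈ l, skewPair (ofCode k) ∈ V := by
  induction es with
  | nil => exact fun h hV k hk => hV k (mem_of_any (List.all_eq_true.1 h k hk))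
  | cons e es ih =>
    intro known h hV
    simp only [spans, SpanEntry.valid, Bool.and_eq_true, decide_eq_true_eq] at h
    obtain ⟨⟨⟨h₁, h₂⟩, h₃, h₄, h₅⟩, h₆⟩ := h
    refine ih h₆ fun k hk => ?_
    rcases List.mem_cons.1 hk with rfl | hk
    · refine combination_singleton_mem (c := e.head.1) (l := e.tail) (fun h₀ => ?_) ?_
        fun p hp => hV _ (mem_of_any (List.all_eq_true.1 h₂ p hp))
      · rw [h₀] at h₁
        exact absurd h₁ (by decide)
      · have := combination_eq_zero h₃ h₄ h₅
        exact this ▸ V.zero_mem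
    · exact hV k hk

/-- The first code of each cocycle. -/
def pivotCodes : List ℕ := (List.finRange 7).map fun k => ((cocycleCodes k).headD (0, 0)).2

theorem spans_descendants :
    spans descendantCodes (pivotCodes ++ complementCodes) spanEntries = true := by
  decide +kernel

theorem cocycleCodes_spec : ∀ k : Fin 7, ∃ p ∈ (cocycleCodes k).head?, p.1 ≠ 0 ∧
    ∀ q ∈ (cocycleCodes k).tail, q.2 ∈ complementCodes := by decide +kernel

/-- Skew pairs that span a complement of the cocycles in the ansatz. -/
def complement (k : Fin complementCodes.length) : FieldFormula :=
  skewPair (ofCode (complementCodes.get k))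

theorem ansatz_le : ansatz ≤ Submodule.span ℝ (Set.range cocycle) ⊔
    Submodule.span ℝ (Set.range complement) := by
  refine Submodule.span_le.2 ?_
  rintro _ ⟨G, hG, rfl⟩
  obtain ⟨k, hk, rfl⟩ := mem_descendants_iff.1 hG
  have hc : ∀ k ∈ complementCodes, skewPair (ofCode k) ∈
      Submodule.span ℝ (Set.range cocycle) ⊔
        Submodule.span ℝ (Set.range complement) := fun k hk => by
    obtain ⟨m, rfl⟩ := List.mem_iff_get.1 hk
    exact Submodule.mem_sup_right (Submodule.subset_span ⟨m, rfl⟩)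
  refine skewPair_mem_of_spans spans_descendants (fun k hk => ?_) k hk
  rcases List.mem_append.1 hk with hk | hk
  · obtain ⟨m, -, rfl⟩ := List.mem_map.1 hk
    obtain ⟨p, hp, h₀, ht⟩ := cocycleCodes_spec m
    have e : cocycleCodes m = p :: (cocycleCodes m).tail :=
      (List.cons_head?_tail hp).symm
    have h := Submodule.mem_sup_left (S := Submodule.span ℝ (Set.range cocycle))
      (T := Submodule.span ℝ (Set.range complement))
      (Submodule.subset_span ⟨m, rfl⟩)
    rw [cocycle, e] at h
    rw [e]
    exact combination_singleton_mem h₀ h fun q hq => hc _ (ht q hq)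
  · exact hc k hk


/-! ### Jets at the origin -/

structure Covector where
  (x y z w : ℤ)

def Covector.coord (u : Covector) (k : Fin 4) : ℤ := ![u.x, u.y, u.z, u.w] k

/-- A list of divided powers of linear forms, with their degrees. -/
abbrev Jet : Type := List (ℕ × Covector)

def linearForm (u : Covector) (x : Pt) : ℝ := ∑ k, (u.coord k : ℝ) * x k

def dividedPower (d : ℕ) (u : Covector) : Pt → ℝ := fun x =>
  linearForm u x ^ d * (d.factorial : ℝ)⁻¹

def jetFunction (J : Jet) : Pt → ℝ := fun x => (J.map fun p => dividedPower p.1 p.2 x).sum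

theorem contDiff_dividedPower (d : ℕ) (u : Covector) : ContDiff ℝ ∞ (dividedPower d u) := by
  unfold dividedPower linearForm
  fun_prop

theorem contDiff_jetFunction (J : Jet) : ContDiff ℝ ∞ (jetFunction J) := by
  induction J with
  | nil => exact contDiff_const
  | cons p J ih => exact (contDiff_dividedPower p.1 p.2).add ih

theorem hasFDerivAt_linearForm (u : Covector) (x : Pt) : HasFDerivAt (linearForm u)
    (∑ k, (u.coord k : ℝ) • ContinuousLinearMap.proj (R := ℝ) (φ := fun _ : Fin 4 => ℝ) k) x := by
  have := (∑ k, (u.coord k : ℝ) •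
    ContinuousLinearMap.proj (R := ℝ) (φ := fun _ : Fin 4 => ℝ) k).hasFDerivAt (x := x)
  refine this.congr_of_eventuallyEq (Filter.Eventually.of_forall fun y => ?_)
  simp [linearForm]

theorem pd_dividedPower_zero (u : Covector) (k : Fin 4) : pd k (dividedPower 0 u) = 0 := by
  have : dividedPower 0 u = fun _ => 1 := by funext x; simp [dividedPower]
  funext x
  simp [pd, this]

theorem pd_dividedPower_succ (d : ℕ) (u : Covector) (k : Fin 4) :
    pd k (dividedPower (d + 1) u) = (u.coord k : ℝ) • dividedPower d u := by
  funext x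
  have h : HasFDerivAt (dividedPower (d + 1) u) _ x :=
    ((hasFDerivAt_linearForm u x).pow (d + 1)).mul_const ((d + 1).factorial : ℝ)⁻¹
  rw [pd, h.fderiv]
  have h₁ : (d.factorial : ℝ) ≠ 0 := mod_cast d.factorial_ne_zero
  have h₂ : (d : ℝ) + 1 ≠ 0 := by positivity
  simp [dividedPower, Nat.factorial_succ, Pi.single_apply]
  field_simp

theorem pds_dividedPower (l : List (Fin 4)) (d : ℕ) (u : Covector) :
    pds l (dividedPower d u) = if l.length ≤ d then
      ((l.map fun k => (u.coord k : ℝ)).prod) • dividedPower (d - l.length) u else 0 := by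
  induction l with
  | nil => simp [pds]
  | cons k l ih =>
    change pd k (pds l _) = _
    rw [ih]
    rw [List.length_cons]
    by_cases h : l.length + 1 ≤ d
    · obtain ⟨e, he⟩ : ∃ e, d - l.length = e + 1 := ⟨d - l.length - 1, by omega⟩
      rw [if_pos (by omega), if_pos h, he,
        show d - (l.length + 1) = e by omega]
      rw [pd_smul (contDiff_dividedPower _ _), pd_dividedPower_succ]
      funext x
      simp
      ring
    · rw [if_neg h]
      split_ifs with h'
      · rw [show d - l.length = 0 by omega]
        rw [pd_smul (contDiff_dividedPower _ _), pd_dividedPower_zero]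
        funext x
        simp
      · funext x
        simp [pd]

theorem pds_dividedPower_apply_zero (l : List (Fin 4)) (d : ℕ) (u : Covector) :
    pds l (dividedPower d u) 0 =
      if l.length = d then (l.map fun k => (u.coord k : ℝ)).prod else 0 := by
  rw [pds_dividedPower]
  rcases lt_trichotomy l.length d with h | h | h
  · have : d - l.length ≠ 0 := by omega
    rw [if_pos h.le, if_neg h.ne]
    simp [dividedPower, linearForm, this]
  · simp [h, dividedPower]
  · rw [if_neg h.not_ge, if_neg h.ne']
    rfl

theorem pds_add {f g : Pt → ℝ} (hf : ContDiff ℝ ∞ f) (hg : ContDiff ℝ ∞ g) (l : List (Fin 4)) :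
    pds l (fun x => f x + g x) = fun x => pds l f x + pds l g x := by
  induction l with
  | nil => rfl
  | cons k l ih =>
    change pd k (pds l _) = _
    rw [ih]
    exact pd_add (contDiff_pds hf l) (contDiff_pds hg l) k

theorem pds_zero (l : List (Fin 4)) : pds l (fun _ => 0) = fun _ => 0 := by
  induction l with
  | nil => rfl
  | cons k l ih =>
    change pd k (pds l _) = _
    rw [ih]
    funext x
    simp [pd]

theorem der_jetFunction (s : Multiset (Fin 4)) (J : Jet) : der s (jetFunction J) 0 =
    (((J.filter fun p => Nat.beq (Multiset.card s) p.1).map fun p =>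
      (s.map fun k => (p.2.coord k : ℝ)).prod)).sum := by
  induction J with
  | nil => exact congrFun (pds_zero _) 0
  | cons p J ih =>
    have h : der s (jetFunction (p :: J)) 0 =
        der s (dividedPower p.1 p.2) 0 + der s (jetFunction J) 0 :=
      congrFun (pds_add (contDiff_dividedPower p.1 p.2) (contDiff_jetFunction J) _) 0
    have e : (s.toList.map fun k => (p.2.coord k : ℝ)).prod =
        (s.map fun k => (p.2.coord k : ℝ)).prod := by
      conv_rhs => rw [← Multiset.coe_toList s]
      rw [Multiset.map_coe, Multiset.prod_coe]
    rw [h, ih, der, pds_dividedPower_apply_zero, Multiset.length_toList, e, List.filter_cons]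
    by_cases hc : Multiset.card s = p.1
    · simp [hc]
    · rw [if_neg hc, if_neg (by simpa using hc), zero_add]


/-! ### Evaluation of symbols on jets -/

/-- All monomials of a symbol differentiate the `w`-th argument `D w` times, for `2 ≤ w`. -/
def Graded (D : ℕ → ℕ) (S : Symbol) : Prop :=
  ∀ m ∈ S.support, ∀ w, 2 ≤ w → Multiset.card (directions w m) = D w

theorem Graded.mul {D D' : ℕ → ℕ} {S S' : Symbol} (h : Graded D S) (h' : Graded D' S') :
    Graded (D + D') (S * S') := by
  intro m hm w hw
  obtain ⟨k, hk, k', hk', rfl⟩ := Finset.mem_add.1 (MvPolynomial.support_mul S S' hm)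
  rw [directions_add, Multiset.card_add, h k hk w hw, h' k' hk' w hw]
  rfl

theorem Graded.add {D : ℕ → ℕ} {S S' : Symbol} (h : Graded D S) (h' : Graded D S') :
    Graded D (S + S') := by
  intro m hm
  rcases Finset.mem_union.1 (MvPolynomial.support_add hm) with hm | hm
  · exact h m hm
  · exact h' m hm

theorem Graded.neg {D : ℕ → ℕ} {S : Symbol} (h : Graded D S) : Graded D (-S) := by
  intro m hm
  rw [MvPolynomial.support_neg] at hm
  exact h m hm

theorem Graded.sub {D : ℕ → ℕ} {S S' : Symbol} (h : Graded D S) (h' : Graded D S') :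
    Graded D (S - S') := sub_eq_add_neg S S' ▸ h.add h'.neg

theorem graded_zero (D : ℕ → ℕ) : Graded D 0 := fun m hm => by simp at hm

theorem graded_one : Graded 0 1 := by
  intro m hm w _
  rw [MvPolynomial.support_one, Finset.mem_singleton] at hm
  simp [hm, directions]

theorem graded_covector (i j : Fin 4) (l : ℕ) (k : Fin 4) :
    Graded (fun w => if l = w then 1 else 0) (covector i j l k) := by
  have h₁ : l < 2 → Graded (fun w => if l = w then 1 else 0) (1 : Symbol) := by
    intro hl m hm w hw
    rw [graded_one m hm w hw, Pi.zero_apply]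
    exact (if_neg (by omega)).symm
  unfold covector
  split_ifs
  · exact h₁ (by omega)
  · exact graded_zero _
  · exact h₁ (by omega)
  · exact graded_zero _
  · intro m hm w _
    rw [MvPolynomial.support_X, Finset.mem_singleton] at hm
    rw [hm, directions_single]
    dsimp only
    split_ifs <;> rfl

/-- The number of occurrences of a letter in a list of brackets. -/
def occurrences (w : ℕ) : List Row → ℕ
  | [] => nat_lit 0
  | r :: g => Nat.add
    (Nat.add (Nat.add (cond (Nat.beq r.a w) (nat_lit 1) (nat_lit 0))
        (cond (Nat.beq r.b w) (nat_lit 1) (nat_lit 0)))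
      (Nat.add (cond (Nat.beq r.c w) (nat_lit 1) (nat_lit 0))
        (cond (Nat.beq r.d w) (nat_lit 1) (nat_lit 0))))
    (occurrences w g)

theorem graded_row (i j : Fin 4) (r : Row) : Graded (fun w => occurrences w [r])
    (r.symbol i j) := by
  have h : (fun w => occurrences w [r]) = (fun w => if r.a = w then 1 else 0) +
      ((fun w => if r.b = w then 1 else 0) + ((fun w => if r.c = w then 1 else 0) +
        fun w => if r.d = w then 1 else 0)) := by
    funext w
    change (cond (Nat.beq r.a w) 1 0 + cond (Nat.beq r.b w) 1 0) +
      (cond (Nat.beq r.c w) 1 0 + cond (Nat.beq r.d w) 1 0) + 0 = _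
    simp only [cond_eq_ite, Nat.beq_eq, Pi.add_apply]
    ring
  have g := graded_covector i j
  have h₂ : ∀ k k', Graded ((fun w => if r.c = w then 1 else 0) +
      fun w => if r.d = w then 1 else 0) (covector i j r.c k * covector i j r.d k' -
        covector i j r.c k' * covector i j r.d k) := fun k k' =>
    ((g _ k).mul (g _ k')).sub ((g _ k').mul (g _ k))
  rw [h, Row.symbol, det_explicit]
  have h₃ : ∀ k a b c, Graded _ (covector i j r.a k * (covector i j r.b a * _ -
      covector i j r.b b * _ + covector i j r.b c * _)) := fun k a b c =>
    (g r.a k).mul ((((g r.b a).mul (h₂ b c)).sub ((g r.b b).mul (h₂ a c))).add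
      ((g r.b c).mul (h₂ a b)))
  exact (((h₃ 0 1 2 3).sub (h₃ 1 0 2 3)).add (h₃ 2 0 1 3)).sub (h₃ 3 0 1 2)

theorem graded_graphSymbol (i j : Fin 4) (g : List Row) :
    Graded (fun w => occurrences w g) (graphSymbol i j g) := by
  induction g with
  | nil => exact graded_one
  | cons r g ih =>
    have := (graded_row i j r).mul ih
    rwa [show (fun w => occurrences w [r]) + (fun w => occurrences w g) =
      fun w => occurrences w (r :: g) from rfl] at this

/-- Substitution of covectors for gradients. -/
def substitute (A : ℕ → Covector) : Symbol →ₐ[ℝ] ℝ :=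
  MvPolynomial.aeval fun v => ((A v.1).coord v.2 : ℝ)

/-- An assignment of covectors with one value changed. -/
def assign (A : ℕ → Covector) (w : ℕ) (u : Covector) : ℕ → Covector :=
  fun l => cond (Nat.beq l w) u (A l)

/-- The sum over all substitutions of terms of the given degrees in the jets. -/
def substituteJets (D : ℕ → ℕ) : List (ℕ × Jet) → (ℕ → Covector) → Symbol →ₗ[ℝ] ℝ
  | [], A => (substitute A).toLinearMap
  | q :: l, A => ((q.2.filter fun p => Nat.beq (D q.1) p.1).map fun p =>
      substituteJets D l (assign A q.1 p.2)).sum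

/-- The value of a monomial in the variables that satisfy a condition. -/
def partialProduct (A : ℕ → Covector) (P : ℕ → Prop) [DecidablePred P] (m : ℕ × Fin 4 →₀ ℕ) : ℝ :=
  (((Finsupp.toMultiset m).filter fun v => P v.1).map fun v => ((A v.1).coord v.2 : ℝ)).prod

theorem substitute_monomial (A : ℕ → Covector) (m : ℕ × Fin 4 →₀ ℕ) (c : ℝ) :
    substitute A (MvPolynomial.monomial m c) =
      c * ((Finsupp.toMultiset m).map fun v => ((A v.1).coord v.2 : ℝ)).prod := by
  rw [substitute, MvPolynomial.aeval_monomial, Finsupp.toMultiset_map, Finsupp.prod_toMultiset,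
    Finsupp.prod_mapDomain_index (by simp) (by simp [pow_add])]
  rfl

theorem substituteJets_monomial (D : ℕ → ℕ) (l : List (ℕ × Jet)) (hl : (l.map Prod.fst).Nodup)
    (A : ℕ → Covector) (m : ℕ × Fin 4 →₀ ℕ) (c : ℝ) :
    substituteJets D l A (MvPolynomial.monomial m c) =
      c * partialProduct A (· ∉ l.map Prod.fst) m *
        (l.map fun q => ((q.2.filter fun p => Nat.beq (D q.1) p.1).map fun p =>
          ((directions q.1 m).map fun k => (p.2.coord k : ℝ)).prod).sum).prod := by
  induction l generalizing A with
  | nil =>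
    change substitute A _ = _
    simp [substitute_monomial, partialProduct]
  | cons q l ih =>
    rw [List.map_cons, List.nodup_cons] at hl
    have h : ∀ u, partialProduct (assign A q.1 u) (· ∉ l.map Prod.fst) m =
        partialProduct A (· ∉ (q :: l).map Prod.fst) m *
          ((directions q.1 m).map fun k => (u.coord k : ℝ)).prod := by
      intro u
      unfold partialProduct directions
      induction Finsupp.toMultiset m using Multiset.induction_on with
      | empty => simp
      | cons v s ihs =>
        by_cases hv : v.1 = q.1
        · rw [Multiset.filter_cons_of_pos _ (by rw [hv]; exact hl.1),
            Multiset.filter_cons_of_neg _ (by simp [hv]),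
            Multiset.filter_cons_of_pos (p := fun x : ℕ × Fin 4 => x.1 = q.1) _ hv]
          simp only [Multiset.map_cons, Multiset.prod_cons, ihs]
          have : assign A q.1 u v.1 = u := by simp [assign, hv]
          rw [this]
          ring
        · have e : assign A q.1 u v.1 = A v.1 := by
            rw [assign, cond_eq_ite, if_neg (by simpa using hv)]
          by_cases hv' : v.1 ∈ l.map Prod.fst
          · rw [Multiset.filter_cons_of_neg _ (by simpa using hv'),
              Multiset.filter_cons_of_neg _ (by simp only [List.map_cons, List.mem_cons]; tauto),
              Multiset.filter_cons_of_neg (p := fun x : ℕ × Fin 4 => x.1 = q.1) _ hv, ihs]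
          · rw [Multiset.filter_cons_of_pos (p := fun x : ℕ × Fin 4 => x.1 ∉ l.map Prod.fst) _ hv',
              Multiset.filter_cons_of_pos _ (by simp only [List.map_cons, List.mem_cons]; tauto),
              Multiset.filter_cons_of_neg (p := fun x : ℕ × Fin 4 => x.1 = q.1) _ hv]
            simp only [Multiset.map_cons, Multiset.prod_cons, ihs, e]
            ring
    have hs : ∀ L : List (Symbol →ₗ[ℝ] ℝ), ∀ S, L.sum S = (L.map fun f => f S).sum := by
      intro L S
      induction L with
      | nil => rfl
      | cons f L ihL => simp [ihL]
    rw [substituteJets, hs, List.map_map]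
    simp only [Function.comp_def, ih hl.2, h]
    have e : ∀ f : ℕ × Jet → ℝ, ((q :: l).map f).prod = f q * (l.map f).prod := fun f => by simp
    rw [e, mul_comm (List.sum _) (List.prod _), ← mul_assoc, ← List.sum_map_mul_left]
    refine congrArg List.sum (List.map_congr_left fun p _ => ?_)
    ring

/-- The substitution by `1` of all coordinates. -/
def unitAssignment : ℕ → Covector := fun _ => ⟨1, 1, 1, 1⟩

theorem evalSymbol_jets {D : ℕ → ℕ} {S : Symbol} (hS : Graded D S) {W : Finset ℕ}
    {F : ℕ → Pt → ℝ} {l : List (ℕ × Jet)} (hl : (l.map Prod.fst).Nodup)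
    (hlW : (l.map Prod.fst).toFinset = W) (hF : ∀ q ∈ l, F q.1 = jetFunction q.2)
        (hW : ∀ w ∈ W, 2 ≤ w) :
    evalSymbol W F S 0 = substituteJets D l unitAssignment S := by
  conv_lhs => rw [MvPolynomial.as_sum S]
  conv_rhs => rw [MvPolynomial.as_sum S]
  rw [map_sum, map_sum, Finset.sum_apply]
  refine Finset.sum_congr rfl fun m hm => ?_
  rw [evalSymbol_monomial, substituteJets_monomial D l hl]
  have h₁ : partialProduct unitAssignment (· ∉ l.map Prod.fst) m = 1 := by
    have : ∀ k, Covector.coord ⟨1, 1, 1, 1⟩ k = 1 := by decide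
    refine Multiset.prod_eq_one fun x hx => ?_
    obtain ⟨v, -, rfl⟩ := Multiset.mem_map.1 hx
    exact_mod_cast this v.2
  rw [h₁, mul_one]
  change _ * evalMonomial W F m 0 = _
  rw [evalMonomial, ← hlW, List.prod_toFinset _ hl, List.map_map]
  refine congrArg (_ * ·) (congrArg List.prod (List.map_congr_left fun q hq => ?_))
  have hq' : q.1 ∈ W := hlW ▸ List.mem_toFinset.2 (List.mem_map_of_mem hq)
  rw [Function.comp_apply, hF q hq, der_jetFunction, hS m hm _ (hW _ hq')]


/-! ### Evaluation of formal sums on jets -/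

/-- Application to an evaluated integer. -/
def strictInt {α : Type} (n : ℤ) (f : ℤ → α) : α :=
  @Int.rec (fun _ => α) (fun n => strict n fun n => f (Int.ofNat n))
    (fun n => strict n fun n => f (Int.negSucc n)) n

theorem strictInt_eq {α : Type} (n : ℤ) (f : ℤ → α) : strictInt n f = f n := by cases n <;> rfl

/-- The determinant of four covectors. -/
def bracketValue (u v w z : Covector) : ℤ :=
  @Covector.rec (fun _ => ℤ) (fun u₀ u₁ u₂ u₃ =>
  @Covector.rec (fun _ => ℤ) (fun v₀ v₁ v₂ v₃ =>
  @Covector.rec (fun _ => ℤ) (fun w₀ w₁ w₂ w₃ =>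
  @Covector.rec (fun _ => ℤ) (fun z₀ z₁ z₂ z₃ =>
    let minor (p q r s : ℤ) : ℤ := Int.sub (Int.mul p s) (Int.mul q r)
    Int.add
      (Int.add (Int.sub (Int.mul (minor u₀ u₁ v₀ v₁) (minor w₂ w₃ z₂ z₃))
          (Int.mul (minor u₀ u₂ v₀ v₂) (minor w₁ w₃ z₁ z₃)))
        (Int.add (Int.mul (minor u₀ u₃ v₀ v₃) (minor w₁ w₂ z₁ z₂))
          (Int.mul (minor u₁ u₂ v₁ v₂) (minor w₀ w₃ z₀ z₃))))
      (Int.sub (Int.mul (minor u₂ u₃ v₂ v₃) (minor w₀ w₁ z₀ z₁))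
        (Int.mul (minor u₁ u₃ v₁ v₃) (minor w₀ w₂ z₀ z₂)))) z) w) v) u

def basisCovector (i : Fin 4) : Covector :=
  ⟨cond (Nat.beq i.val 0) 1 0, cond (Nat.beq i.val 1) 1 0, cond (Nat.beq i.val 2) 1 0,
    cond (Nat.beq i.val 3) 1 0⟩

/-- The covectors of all letters: the first two are basis covectors. -/
def fullAssignment (i j : Fin 4) (A : ℕ → Covector) (l : ℕ) : Covector :=
  cond (Nat.beq l (nat_lit 0)) (basisCovector i)
      (cond (Nat.beq l (nat_lit 1)) (basisCovector j) (A l))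

def graphValue (A : ℕ → Covector) : List Row → ℤ
  | [] => 1
  | r :: g => strictInt (bracketValue (A r.a) (A r.b) (A r.c) (A r.d)) fun d =>
      cond (Int.beq' d 0) 0 (Int.mul d (graphValue A g))

def sumOver (d : ℕ) (f : Covector → ℤ) : Jet → ℤ
  | [] => 0
  | p :: J => cond (Nat.beq d p.1) (Int.add (f p.2) (sumOver d f J)) (sumOver d f J)

/-- The sum over the terms of the jets of the right degrees. -/
def jetSum (i j : Fin 4) (g : List Row) : List ((ℕ × ℕ) × Jet) → (ℕ → Covector) → ℤ
  | [], A => graphValue (fullAssignment i j A) g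
  | q :: l, A => sumOver q.1.2 (fun u => jetSum i j g l (assign A q.1.1 u)) q.2

/-- The letters of the three kinds. -/
def kindLetters (n s : ℕ) : List ℕ :=
  cond (Nat.beq n (nat_lit 3)) [s, Nat.add s (nat_lit 1), Nat.add s (nat_lit 2)]
    [s, Nat.add s (nat_lit 1), Nat.add s (nat_lit 2), Nat.add s (nat_lit 3)]

/-- The set of degrees, as a sum of powers of `2`. -/
def degreeMask : List ℕ → ℕ
  | [] => nat_lit 0
  | d :: l => Nat.lor (Nat.shiftLeft (nat_lit 1) d) (degreeMask l)

def isSubmask (m k : ℕ) : Bool := Nat.beq (Nat.land m k) m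

/-- A graph with its coefficient, the numbers of occurrences of its letters of each kind and the
sets of these numbers. -/
structure Profile where
  coefficient : ℤ
  rows : List Row
  first : List (ℕ × ℕ)
  second : List (ℕ × ℕ)
  third : List (ℕ × ℕ)
  firstMask : ℕ
  secondMask : ℕ
  thirdMask : ℕ

def withOccurrences {α : Type} (g : List Row) : List ℕ → (List (ℕ × ℕ) → α) → α
  | [], f => f []
  | w :: l, f => strict w fun w => strict (occurrences w g) fun d =>
      withOccurrences g l fun q => f ((w, d) :: q)

def withRows {α : Type} : List Row → (List Row → α) → α
  | [], f => f []
  | r :: g, f => strict r.a fun a => strict r.b fun b => strict r.c fun c => strict r.d fun d =>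
      withRows g fun g => f (⟨a, b, c, d⟩ :: g)

def withProfile {α : Type} (n : ℕ) (p : ℤ × List Row) (f : Profile → α) : α :=
  strictInt p.1 fun c => withRows p.2 fun g => withOccurrences g (kindLetters n 2) fun x =>
  withOccurrences g (kindLetters n 6) fun y => withOccurrences g (kindLetters n 10) fun z =>
  strict (degreeMask (x.map Prod.snd)) fun k => strict (degreeMask (y.map Prod.snd)) fun l =>
  strict (degreeMask (z.map Prod.snd)) fun m => f ⟨c, g, x, y, z, k, l, m⟩

def withProfiles {α : Type} (n : ℕ) : FormalSum → (List Profile → α) → α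
  | [], f => f []
  | p :: s, f => withProfile n p fun q => withProfiles n s fun l => f (q :: l)

/-- Two indices and three jets. -/
structure Sample where
  (i j : Fin 4)
  (r a b : Jet)

def profileSum (i j : Fin 4) (r a b : Jet) (q : Profile) : ℤ :=
  jetSum i j q.rows (q.first.map (fun w => (w, r)) ++ (q.second.map (fun w => (w, a)) ++
    q.third.map fun w => (w, b))) unitAssignment

/-- The sum over the terms of the jets, whose sets of degrees are also given. -/
def guardedSum (i j : Fin 4) (r a b : Jet) (k l m : ℕ) (q : Profile) : ℤ :=
  cond (isSubmask q.firstMask k && (isSubmask q.secondMask l && isSubmask q.thirdMask m))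
    (profileSum i j r a b q) 0

def maskedValue (ε : ℤ) (p : Sample) (k l m : ℕ) : List Profile → ℤ
  | [] => 0
  | q :: s => strictInt (Int.add (guardedSum p.i p.j p.r p.a p.b k l m q)
      (Int.mul ε (guardedSum p.i p.j p.r p.b p.a k m l q))) fun v =>
      cond (Int.beq' v 0) (maskedValue ε p k l m s)
        (Int.add (Int.mul q.coefficient v) (maskedValue ε p k l m s))

def Jet.mask (J : Jet) : ℕ := degreeMask (J.map Prod.fst)

def sampleValue (ε : ℤ) (p : Sample) (s : List Profile) : ℤ :=
  strict p.r.mask fun k => strict p.a.mask fun l => strict p.b.mask fun m => maskedValue ε p k l m s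

def profile (n : ℕ) (p : ℤ × List Row) : Profile :=
  let x := (kindLetters n 2).map fun w => (w, occurrences w p.2)
  let y := (kindLetters n 6).map fun w => (w, occurrences w p.2)
  let z := (kindLetters n 10).map fun w => (w, occurrences w p.2)
  ⟨p.1, p.2, x, y, z, degreeMask (x.map Prod.snd), degreeMask (y.map Prod.snd),
    degreeMask (z.map Prod.snd)⟩

theorem withOccurrences_eq {α : Type} (g : List Row) (l : List ℕ) (f : List (ℕ × ℕ) → α) :
    withOccurrences g l f = f (l.map fun w => (w, occurrences w g)) := by
  induction l generalizing f with
  | nil => rfl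
  | cons w l ih => rw [withOccurrences, strict_eq, strict_eq, ih]; rfl

theorem withRows_eq {α : Type} (g : List Row) (f : List Row → α) : withRows g f = f g := by
  induction g generalizing f with
  | nil => rfl
  | cons r g ih => rw [withRows, strict_eq, strict_eq, strict_eq, strict_eq, ih]

theorem withProfiles_eq {α : Type} (n : ℕ) (s : FormalSum) (f : List Profile → α) :
    withProfiles n s f = f (s.map (profile n)) := by
  induction s generalizing f with
  | nil => rfl
  | cons p s ih =>
    rw [withProfiles, withProfile, strictInt_eq, withRows_eq, withOccurrences_eq,
      withOccurrences_eq, withOccurrences_eq, strict_eq, strict_eq, strict_eq, ih]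
    rfl

theorem substitute_covector (i j : Fin 4) (A : ℕ → Covector) (l : ℕ) (k : Fin 4) :
    substitute A (covector i j l k) = ((fullAssignment i j A l).coord k : ℝ) := by
  have h : ∀ i k : Fin 4, (basisCovector i).coord k = if k = i then 1 else 0 := by decide
  rw [covector, fullAssignment, cond_eq_ite, cond_eq_ite]
  simp only [Nat.beq_eq]
  by_cases h₀ : l = 0
  · rw [if_pos h₀, if_pos h₀, h]
    split_ifs <;> simp
  by_cases h₁ : l = 1
  · rw [if_neg h₀, if_pos h₁, if_neg h₀, if_pos h₁, h]
    split_ifs <;> simp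
  rw [if_neg h₀, if_neg h₁, if_neg h₀, if_neg h₁, substitute, MvPolynomial.aeval_X]

theorem substitute_graphSymbol (i j : Fin 4) (A : ℕ → Covector) (g : List Row) :
    substitute A (graphSymbol i j g) = (graphValue (fullAssignment i j A) g : ℝ) := by
  induction g with
  | nil => simp [graphSymbol, graphValue]
  | cons r g ih =>
    have h : substitute A (r.symbol i j) = (bracketValue (fullAssignment i j A r.a)
        (fullAssignment i j A r.b) (fullAssignment i j A r.c) (fullAssignment i j A r.d) : ℝ) := by
      simp only [Row.symbol, det_explicit, map_add, map_sub, map_mul, substitute_covector]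
      generalize fullAssignment i j A r.a = u
      generalize fullAssignment i j A r.b = v
      generalize fullAssignment i j A r.c = w
      generalize fullAssignment i j A r.d = z
      obtain ⟨u₀, u₁, u₂, u₃⟩ := u
      obtain ⟨v₀, v₁, v₂, v₃⟩ := v
      obtain ⟨w₀, w₁, w₂, w₃⟩ := w
      obtain ⟨z₀, z₁, z₂, z₃⟩ := z
      have e : bracketValue ⟨u₀, u₁, u₂, u₃⟩ ⟨v₀, v₁, v₂, v₃⟩ ⟨w₀, w₁, w₂, w₃⟩ ⟨z₀, z₁, z₂, z₃⟩ =
          ((u₀ * v₁ - u₁ * v₀) * (w₂ * z₃ - w₃ * z₂) - (u₀ * v₂ - u₂ * v₀) * (w₁ * z₃ - w₃ * z₁) +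
          ((u₀ * v₃ - u₃ * v₀) * (w₁ * z₂ - w₂ * z₁) + (u₁ * v₂ - u₂ * v₁) * (w₀ * z₃ - w₃ * z₀))) +
          ((u₂ * v₃ - u₃ * v₂) * (w₀ * z₁ - w₁ * z₀) -
            (u₁ * v₃ - u₃ * v₁) * (w₀ * z₂ - w₂ * z₀)) := rfl
      rw [e]
      simp only [Covector.coord]
      simp
      ring
    change substitute A (r.symbol i j * graphSymbol i j g) = _
    rw [map_mul, ih, h, graphValue, strictInt_eq, ← Int.cast_mul]
    generalize bracketValue _ _ _ _ = d
    rw [cond_eq_ite]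
    split_ifs with hd
    · rw [show d = 0 from by simpa using hd, zero_mul]
    · rfl

theorem sumOver_eq (d : ℕ) (f : Covector → ℤ) (J : Jet) :
    sumOver d f J = ((J.filter fun p => Nat.beq d p.1).map fun p => f p.2).sum := by
  induction J with
  | nil => rfl
  | cons p J ih =>
    rw [sumOver, List.filter_cons, cond_eq_ite, ih]
    split_ifs <;> rfl

theorem jetSum_eq (i j : Fin 4) (g : List Row) (l : List ((ℕ × ℕ) × Jet))
    (hl : ∀ q ∈ l, q.1.2 = occurrences q.1.1 g) (A : ℕ → Covector) :
    (jetSum i j g l A : ℝ) = substituteJets (fun w => occurrences w g)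
      (l.map fun q => (q.1.1, q.2)) A (graphSymbol i j g) := by
  induction l generalizing A with
  | nil => exact (substitute_graphSymbol i j A g).symm
  | cons q l ih =>
    have ih := ih fun q hq => hl q (List.mem_cons_of_mem _ hq)
    have hs : ∀ L : List (Symbol →ₗ[ℝ] ℝ), ∀ S, L.sum S = (L.map fun f => f S).sum := by
      intro L S
      induction L with
      | nil => rfl
      | cons f L ihL => simp [ihL]
    rw [jetSum, sumOver_eq, List.map_cons, substituteJets, hs, hl q List.mem_cons_self,
      Int.cast_list_sum, List.map_map, List.map_map]
    exact congrArg List.sum (List.map_congr_left fun p _ => ih _)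

theorem kindLetters_three (s : ℕ) : kindLetters 3 s = [s, s + 1, s + 2] := rfl

theorem kindLetters_four (s : ℕ) : kindLetters 4 s = [s, s + 1, s + 2, s + 3] := rfl

theorem value_jets {n : ℕ} (hn : n = 3 ∨ n = 4) (r a b : Jet) (i j : Fin 4) (p : ℤ × List Row) :
    value n (jetFunction r) (jetFunction a) (jetFunction b) 0 i j p.2 =
      profileSum i j r a b (profile n p) := by
  have h : (((profile n p).first.map (fun w => (w, r)) ++ ((profile n p).second.map
      (fun w => (w, a)) ++ (profile n p).third.map fun w => (w, b))).map fun q =>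
        (q.1.1, q.2)).map Prod.fst = kindLetters n 2 ++ (kindLetters n 6 ++ kindLetters n 10) := by
    simp [profile, Function.comp_def]
  rw [profileSum, jetSum_eq, value]
  · refine evalSymbol_jets (graded_graphSymbol i j p.2) ?_ ?_ ?_ ?_
    · rw [h]
      rcases hn with rfl | rfl <;> decide
    · rw [h]
      rcases hn with rfl | rfl <;> decide
    · rcases hn with rfl | rfl <;>
        simp [profile, kindLetters_three, kindLetters_four, letterContent, kind]
    · rcases hn with rfl | rfl <;> decide
  · intro q hq
    simp only [profile, List.map_map, List.mem_append, List.mem_map] at hq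
    rcases hq with ⟨w, -, rfl⟩ | ⟨w, -, rfl⟩ | ⟨w, -, rfl⟩ <;> rfl

theorem testBit_degreeMask (l : List ℕ) (d : ℕ) : (degreeMask l).testBit d = true ↔ d ∈ l := by
  induction l with
  | nil => simp [degreeMask]
  | cons e l ih =>
    have h : (degreeMask (e :: l)).testBit d = ((1 <<< e).testBit d || (degreeMask l).testBit d) :=
      Nat.testBit_or _ _ _
    rw [h, Bool.or_eq_true, ih, List.mem_cons, Nat.one_shiftLeft, Nat.testBit_two_pow,
      decide_eq_true_eq, eq_comm]

theorem exists_of_not_isSubmask {l l' : List ℕ}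
    (h : isSubmask (degreeMask l) (degreeMask l') = false) : ∃ d ∈ l, d ∉ l' := by
  by_contra! hl
  refine Bool.eq_false_iff.1 h ((Nat.beq_eq ▸ ?_ : Nat.beq _ _ = true))
  refine Nat.eq_of_testBit_eq fun d => ?_
  change (degreeMask l &&& degreeMask l').testBit d = _
  rw [Nat.testBit_and, Bool.eq_iff_iff, Bool.and_eq_true, testBit_degreeMask, testBit_degreeMask]
  exact ⟨And.left, fun hd => ⟨hd, hl d hd⟩⟩

theorem jetSum_eq_zero (i j : Fin 4) (g : List Row) {l : List ((ℕ × ℕ) × Jet)}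
    {q : (ℕ × ℕ) × Jet} (hq : q ∈ l) (h : q.1.2 ∉ q.2.map Prod.fst) (A : ℕ → Covector) :
    jetSum i j g l A = 0 := by
  induction l generalizing A with
  | nil => simp at hq
  | cons q' l ih =>
    rw [jetSum, sumOver_eq]
    rcases List.mem_cons.1 hq with rfl | hq
    · rw [List.filter_eq_nil_iff.2]
      · rfl
      · intro p hp hc
        exact h (Nat.eq_of_beq_eq_true hc ▸ List.mem_map_of_mem hp)
    · simp [ih hq]

theorem guardedSum_eq (n : ℕ) (i j : Fin 4) (r a b : Jet) (p : ℤ × List Row) :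
    guardedSum i j r a b r.mask a.mask b.mask (profile n p) =
      profileSum i j r a b (profile n p) := by
  rw [guardedSum, cond_eq_ite]
  split_ifs with h
  · rfl
  have key : ∀ l : List (ℕ × ℕ), ∀ J : Jet,
      isSubmask (degreeMask (l.map Prod.snd)) J.mask = false →
        ∃ q ∈ l.map fun w => (w, J), q.1.2 ∉ q.2.map Prod.fst := by
    intro l J h
    obtain ⟨d, hd, h'⟩ := exists_of_not_isSubmask h
    obtain ⟨w, hw, rfl⟩ := List.mem_map.1 hd
    exact ⟨(w, J), List.mem_map_of_mem hw, h'⟩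
  rw [Bool.not_eq_true, Bool.and_eq_false_iff, Bool.and_eq_false_iff] at h
  rcases h with h | h | h <;> obtain ⟨q, hq, hq'⟩ := key _ _ h <;>
    refine (jetSum_eq_zero i j _ (q := q) ?_ hq' _).symm
  · exact List.mem_append_left _ hq
  · exact List.mem_append_right _ (List.mem_append_left _ hq)
  · exact List.mem_append_right _ (List.mem_append_right _ hq)

theorem sampleValue_eq {n : ℕ} (hn : n = 3 ∨ n = 4) (ε : ℤ) (p : Sample) (s : FormalSum) :
    GraphFunctional.eval
        (pairValue n ε (jetFunction p.r) (jetFunction p.a) (jetFunction p.b) 0 p.i p.j) s =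
      withProfiles n s (sampleValue ε p) := by
  rw [withProfiles_eq, sampleValue, strict_eq, strict_eq, strict_eq]
  induction s with
  | nil => simp [GraphFunctional.eval, maskedValue]
  | cons q s ih =>
    rw [GraphFunctional.eval, List.map_cons, List.sum_cons, ← GraphFunctional.eval, ih, pairValue,
      value_jets hn _ _ _ _ _ q, value_jets hn _ _ _ _ _ q, List.map_cons, maskedValue,
      strictInt_eq, cond_eq_ite, guardedSum_eq, guardedSum_eq]
    have e : (profile n q).coefficient = q.1 := rfl
    split_ifs with h
    · have h' : profileSum p.i p.j p.r p.a p.b (profile n q) +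
          ε * profileSum p.i p.j p.r p.b p.a (profile n q) = 0 := by simpa using h
      rw [← Int.cast_mul, ← Int.cast_add, h']
      simp
    · rw [e, ← Int.cast_mul, ← Int.cast_add, ← Int.cast_mul, ← Int.cast_add]
      rfl


/-! ### Linear independence -/

/-- The values of the formal sums at the samples form an invertible triangular matrix. -/
def triangular (n : ℕ) (ε : ℤ) : List FormalSum → List Sample → List Sample → Bool
  | [], _, _ => true
  | _ :: _, [], _ => false
  | s :: ss, p :: ps, qs =>
    withProfiles n s (fun l => !Int.beq' (sampleValue ε p l) 0 &&
      qs.all fun q => Int.beq' (sampleValue ε q l) 0) && triangular n ε ss ps (p :: qs)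

/-- The value of a formal sum at a sample. -/
def evalSample (n : ℕ) (ε : ℤ) (p : Sample) (s : FormalSum) : ℝ := GraphFunctional.eval
  (pairValue n ε (jetFunction p.r) (jetFunction p.a) (jetFunction p.b) 0 p.i p.j) s

theorem triangular_zero {n : ℕ} (hn : n = 3 ∨ n = 4) {ε : ℤ} {ss : List FormalSum} :
    ∀ {ps qs : List Sample}, triangular n ε ss ps qs = true → ∀ s ∈ ss, ∀ q ∈ qs,
      evalSample n ε q s = 0 := by
  induction ss with
  | nil => simp
  | cons s ss ih =>
    intro ps qs h t ht q hq
    cases ps with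
    | nil => exact absurd h (by simp [triangular])
    | cons p ps =>
      rw [triangular, withProfiles_eq, Bool.and_eq_true, Bool.and_eq_true] at h
      rcases List.mem_cons.1 ht with rfl | ht
      · rw [evalSample, sampleValue_eq hn, withProfiles_eq]
        have := List.all_eq_true.1 h.1.2 q hq
        exact_mod_cast (by simpa using this)
      · exact ih h.2 t ht q (List.mem_cons_of_mem _ hq)

theorem triangular_independent {n : ℕ} (hn : n = 3 ∨ n = 4) {ε : ℤ} {l : List (ℝ × FormalSum)} :
    ∀ {ps qs : List Sample}, triangular n ε (l.map Prod.snd) ps qs = true →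
      (∀ p ∈ ps, (l.map fun q => q.1 * evalSample n ε p q.2).sum = 0) → ∀ q ∈ l, q.1 = 0 := by
  induction l with
  | nil => simp
  | cons s l ih =>
    intro ps qs h h₀
    cases ps with
    | nil => exact absurd h (by simp [triangular])
    | cons p ps =>
      rw [List.map_cons, triangular, withProfiles_eq, Bool.and_eq_true, Bool.and_eq_true] at h
      have hz : (l.map fun q => q.1 * evalSample n ε p q.2).sum = 0 := by
        refine List.sum_eq_zero fun x hx => ?_
        obtain ⟨q, hq, rfl⟩ := List.mem_map.1 hx
        rw [triangular_zero hn h.2 q.2 (List.mem_map_of_mem hq) p List.mem_cons_self, mul_zero]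
      have hp := h₀ p List.mem_cons_self
      rw [List.map_cons, List.sum_cons, hz, add_zero] at hp
      have hne : evalSample n ε p s.2 ≠ 0 := by
        rw [evalSample, sampleValue_eq hn, withProfiles_eq]
        exact_mod_cast (by simpa using h.1.1)
      have hs : s.1 = 0 := (mul_eq_zero.1 hp).resolve_right hne
      intro q hq
      rcases List.mem_cons.1 hq with rfl | hq
      · exact hs
      · refine ih h.2 (fun p' hp' => ?_) q hq
        have := h₀ p' (List.mem_cons_of_mem _ hp')
        rwa [List.map_cons, List.sum_cons, hs, zero_mul, zero_add] at this

def jetSmooth (J : Jet) : Smooth := ⟨jetFunction J, contDiff_jetFunction J⟩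

def cocycleSamples : List Sample :=
  [⟨0, 0, [(0, ⟨0, 0, 0, 0⟩), (1, ⟨0, 1, 0, 0⟩)], [(1, ⟨0, 0, 0, 1⟩), (2, ⟨1, 0, -1, 0⟩), (3, ⟨0,
      -1, 0, -1⟩)], [(1, ⟨0, 0, 1, 0⟩)]⟩,
   ⟨0, 0, [(0, ⟨0, 0, 0, 0⟩), (2, ⟨1, 0, 1, -1⟩)], [(1, ⟨0, 0, 0, 1⟩), (2, ⟨0, -1, 1, 0⟩)], [(1,
      ⟨0, 0, 1, 0⟩), (3, ⟨0, -1, 0, 1⟩)]⟩,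
   ⟨0, 0, [(0, ⟨0, 0, 0, 0⟩), (1, ⟨0, 0, 1, 1⟩)], [(1, ⟨0, 0, 0, 1⟩), (2, ⟨0, 1, -1, 0⟩)], [(1, ⟨0,
      0, 1, 0⟩), (3, ⟨1, 1, 0, 1⟩)]⟩,
   ⟨1, 1, [(0, ⟨0, 0, 0, 0⟩), (1, ⟨1, 0, 0, 1⟩), (2, ⟨0, 1, 0, -1⟩), (3, ⟨-1, 0, 0, 0⟩)], [(1, ⟨0,
      0, 0, 1⟩)], [(1, ⟨0, 0, 1, 0⟩), (3, ⟨-1, 0, 1, 0⟩)]⟩,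
   ⟨0, 0, [(0, ⟨0, 0, 0, 0⟩)], [(1, ⟨0, 0, 0, 1⟩), (2, ⟨1, 1, 0, 0⟩), (2, ⟨-1, 1, 1, 0⟩)], [(1, ⟨0,
      0, 1, 0⟩), (2, ⟨0, 0, 0, -1⟩), (3, ⟨0, 1, 0, 0⟩)]⟩,
   ⟨1, 1, [(0, ⟨0, 0, 0, 0⟩), (1, ⟨0, 0, -1, 0⟩)], [(1, ⟨0, 0, 0, 1⟩), (3, ⟨-1, 0, 0, 0⟩)], [(1,
      ⟨0, 0, 1, 0⟩), (2, ⟨1, 1, 1, 0⟩), (2, ⟨0, 0, 1, -1⟩)]⟩,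
   ⟨0, 0, [(0, ⟨0, 0, 0, 0⟩), (2, ⟨0, 0, 1, 0⟩)], [(1, ⟨0, 0, 0, 1⟩)], [(1, ⟨0, 0, 1, 0⟩), (2, ⟨-1,
      0, 0, 0⟩), (3, ⟨0, -1, 0, 0⟩)]⟩]

def complementSamples : List Sample :=
  [⟨0, 2, [(1, ⟨0, 1, 1, 0⟩), (3, ⟨1, 0, 0, 0⟩)], [(1, ⟨0, 0, 0, 1⟩), (2, ⟨0, 0, 1, -1⟩)], [(1, ⟨0,
      1, 0, 0⟩), (2, ⟨0, -1, 0, 0⟩), (2, ⟨0, -1, 0, -1⟩)]⟩,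
   ⟨1, 2, [(0, ⟨0, 0, 0, 0⟩), (1, ⟨0, 0, 1, 1⟩), (2, ⟨1, -1, 0, -1⟩), (3, ⟨-1, 1, 0, 0⟩)], [(1, ⟨0,
      0, 0, 1⟩)], [(2, ⟨0, 0, 1, 0⟩), (2, ⟨-1, 0, -1, 0⟩), (3, ⟨0, -1, 0, 1⟩)]⟩,
   ⟨1, 3, [(0, ⟨0, 0, 0, 0⟩)], [(2, ⟨1, 0, 0, 0⟩), (2, ⟨0, 1, 1, 1⟩), (3, ⟨-1, -1, 1, 0⟩)], [(1,
      ⟨0, 0, 1, 0⟩), (2, ⟨0, 1, 0, -1⟩)]⟩,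
   ⟨1, 3, [(0, ⟨0, 0, 0, 0⟩), (2, ⟨1, 1, 0, -1⟩)], [(1, ⟨0, 0, 0, 1⟩), (3, ⟨0, 1, 0, 0⟩)], [(1, ⟨0,
      0, 1, 0⟩)]⟩,
   ⟨0, 1, [(0, ⟨0, 0, 0, 0⟩), (1, ⟨1, 0, 0, 0⟩), (2, ⟨-1, 0, 0, 1⟩), (3, ⟨0, 1, 0, 1⟩)], [(1, ⟨0,
      0, 0, 1⟩)], [(1, ⟨0, -1, -1, 0⟩)]⟩,
   ⟨1, 3, [(0, ⟨0, 0, 0, 0⟩), (3, ⟨1, 0, -1, 0⟩)], [(1, ⟨0, 0, 0, 1⟩), (2, ⟨0, 0, 1, -1⟩), (3, ⟨1,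
      0, 0, 0⟩)], [(1, ⟨-1, 1, 0, 0⟩)]⟩,
   ⟨0, 2, [(0, ⟨0, 0, 0, 0⟩), (3, ⟨0, 1, 1, 0⟩)], [(1, ⟨0, 0, 0, 1⟩), (2, ⟨-1, 0, 0, 1⟩)], [(1, ⟨0,
      0, 1, 0⟩), (3, ⟨1, -1, 1, 0⟩)]⟩,
   ⟨0, 1, [(0, ⟨0, 0, 0, 0⟩), (3, ⟨-1, 1, 0, 0⟩)], [(1, ⟨0, 0, 0, 1⟩), (2, ⟨0, 0, -1, 1⟩)], [(1,
      ⟨0, 0, 1, 0⟩), (3, ⟨-1, 0, 0, 0⟩)]⟩,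
   ⟨0, 3, [(0, ⟨0, 0, 0, 0⟩)], [(1, ⟨0, 0, 0, 1⟩), (3, ⟨1, 0, -1, 0⟩)], [(1, ⟨0, 0, 1, 0⟩), (2, ⟨1,
      1, 0, 1⟩), (3, ⟨0, 1, 0, 1⟩)]⟩,
   ⟨2, 3, [(0, ⟨0, 0, 0, 0⟩)], [(1, ⟨-1, 1, 0, 0⟩), (3, ⟨1, 0, 1, 0⟩)], [(1, ⟨0, 0, 1, 0⟩), (2, ⟨0,
      -1, 0, 0⟩), (3, ⟨1, 0, 0, 1⟩)]⟩,
   ⟨0, 1, [(0, ⟨0, 0, 0, 0⟩), (1, ⟨0, 0, 1, 1⟩)], [(1, ⟨0, 0, 0, 1⟩)], [(1, ⟨0, 0, 1, 0⟩), (2, ⟨-1,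
      0, 1, 0⟩), (3, ⟨0, -1, -1, 0⟩)]⟩,
   ⟨1, 2, [(0, ⟨0, 0, 0, 0⟩), (1, ⟨0, 1, 0, 0⟩)], [(1, ⟨0, 0, 0, 1⟩)], [(1, ⟨0, 0, 1, 0⟩), (2, ⟨1,
      0, 0, 1⟩), (3, ⟨1, 0, 1, 0⟩)]⟩,
   ⟨1, 3, [(0, ⟨0, 0, 0, 0⟩), (1, ⟨-1, 0, 0, 0⟩), (2, ⟨0, -1, 0, 0⟩)], [(1, ⟨0, 0, 0, 1⟩), (3, ⟨-1,
      -1, 0, 0⟩)], [(1, ⟨0, 0, 1, 0⟩)]⟩,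
   ⟨0, 1, [(1, ⟨-1, 1, 0, 0⟩), (2, ⟨0, 0, 1, 0⟩)], [(1, ⟨1, 0, 0, 1⟩)], [(1, ⟨0, -1, 1, 0⟩), (2,
      ⟨1, 0, 0, 0⟩), (3, ⟨1, 0, 0, 0⟩)]⟩,
   ⟨1, 3, [(0, ⟨0, 0, 0, 0⟩), (1, ⟨0, 0, -1, -1⟩)], [(1, ⟨1, 0, 1, 0⟩)], [(1, ⟨0, 0, 1, 0⟩), (2,
      ⟨-1, 0, 0, 0⟩), (3, ⟨-1, 1, 0, 0⟩)]⟩,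
   ⟨0, 1, [(0, ⟨0, 0, 0, 0⟩), (1, ⟨1, 0, 0, 0⟩), (2, ⟨1, 1, 0, 0⟩)], [(1, ⟨0, 0, 0, 1⟩), (3, ⟨-1,
      1, 0, 1⟩)], [(1, ⟨0, 0, 1, 0⟩)]⟩,
   ⟨1, 2, [(0, ⟨0, 0, 0, 0⟩), (2, ⟨1, 0, 0, 1⟩)], [(1, ⟨0, 0, 0, 1⟩), (3, ⟨-1, -1, 0, 0⟩)], [(1,
      ⟨0, 0, 1, 0⟩), (3, ⟨1, 0, 0, -1⟩)]⟩,
   ⟨1, 2, [(0, ⟨0, 0, 0, 0⟩), (1, ⟨-1, 0, 0, 0⟩)], [(1, ⟨0, 0, 0, 1⟩), (3, ⟨0, -1, 0, -1⟩)], [(1,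
      ⟨0, 1, -1, 0⟩), (3, ⟨1, 1, 0, 0⟩)]⟩,
   ⟨1, 3, [(0, ⟨0, 0, 0, 0⟩), (1, ⟨0, 1, 0, 0⟩)], [(1, ⟨0, 0, 0, 1⟩), (3, ⟨-1, 1, -1, 0⟩)], [(1,
      ⟨0, 0, 1, 0⟩), (3, ⟨1, 0, 0, 1⟩)]⟩,
   ⟨0, 1, [(0, ⟨0, 0, 0, 0⟩), (1, ⟨0, -1, 0, 0⟩)], [(1, ⟨0, 0, 0, 1⟩), (3, ⟨-1, 1, 1, 0⟩)], [(1,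
      ⟨0, 0, 1, 0⟩), (2, ⟨0, 0, 1, 1⟩)]⟩,
   ⟨0, 2, [(0, ⟨0, 0, 0, 0⟩), (1, ⟨1, 0, 1, 0⟩)], [(1, ⟨0, 0, 0, 1⟩), (3, ⟨0, 1, 0, 1⟩)], [(1, ⟨0,
      0, 1, 0⟩), (2, ⟨0, 1, 0, 0⟩)]⟩,
   ⟨1, 2, [(0, ⟨0, 0, 0, 0⟩)], [(1, ⟨0, 0, 0, 1⟩), (2, ⟨-1, 0, 0, 0⟩), (3, ⟨1, 0, 1, 1⟩)], [(1, ⟨0,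
      0, 1, 0⟩), (2, ⟨0, 0, 0, -1⟩), (2, ⟨1, 1, 0, 1⟩)]⟩,
   ⟨1, 2, [(0, ⟨0, 0, 0, 0⟩)], [(1, ⟨0, 0, 0, 1⟩), (2, ⟨0, 1, 0, 1⟩), (2, ⟨0, -1, -1, 0⟩)], [(1,
      ⟨0, 0, 1, 0⟩), (2, ⟨-1, 0, 0, -1⟩), (3, ⟨1, 1, 0, 0⟩)]⟩,
   ⟨0, 3, [(0, ⟨0, 0, 0, 0⟩), (1, ⟨1, 0, 0, 0⟩), (3, ⟨0, -1, 0, 0⟩)], [(1, ⟨0, 0, 0, 1⟩), (2, ⟨1,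
      0, -1, 1⟩), (2, ⟨0, -1, 0, -1⟩)], [(1, ⟨0, 0, 1, 1⟩)]⟩,
   ⟨0, 2, [(0, ⟨0, 0, 0, 0⟩), (3, ⟨0, 1, 0, 0⟩)], [(1, ⟨0, 1, 0, -1⟩), (2, ⟨1, 0, 1, 0⟩)], [(1, ⟨0,
      0, 1, 0⟩), (2, ⟨-1, 0, 1, 0⟩), (2, ⟨1, 0, 0, 1⟩)]⟩,
   ⟨0, 1, [(0, ⟨0, 0, 0, 0⟩), (3, ⟨1, -1, 0, -1⟩)], [(1, ⟨0, 0, 0, 1⟩), (2, ⟨0, 1, 0, 1⟩)], [(1,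
      ⟨0, 0, 1, 0⟩), (2, ⟨1, 0, 0, 0⟩), (2, ⟨0, 0, 1, 0⟩)]⟩,
   ⟨1, 3, [(0, ⟨0, 0, 0, 0⟩), (3, ⟨1, -1, 0, 0⟩)], [(1, ⟨0, 0, 0, 1⟩), (2, ⟨1, 0, 0, -1⟩), (2, ⟨0,
      -1, 0, 0⟩)], [(1, ⟨0, 0, 1, 0⟩), (2, ⟨-1, 0, 1, 1⟩)]⟩,
   ⟨0, 1, [(0, ⟨0, 0, 0, 0⟩), (2, ⟨1, -1, 1, 0⟩)], [(1, ⟨0, 0, 0, 1⟩), (2, ⟨0, -1, 1, -1⟩), (2, ⟨1,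
      0, 1, 0⟩)], [(1, ⟨-1, 0, 0, 0⟩), (3, ⟨0, 1, 0, 0⟩)]⟩,
   ⟨0, 2, [(0, ⟨0, 0, 0, 0⟩), (1, ⟨0, 0, 1, 1⟩)], [(1, ⟨0, 0, 0, 1⟩), (3, ⟨0, -1, 0, 0⟩)], [(1, ⟨0,
      0, 1, 0⟩), (2, ⟨-1, 0, 0, 0⟩), (3, ⟨1, -1, 1, 0⟩)]⟩,
   ⟨1, 3, [(0, ⟨0, 0, 0, 0⟩), (1, ⟨1, 0, 0, -1⟩)], [(1, ⟨0, 0, 0, 1⟩), (3, ⟨-1, 0, 0, 0⟩)], [(1,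
      ⟨0, 0, 1, 0⟩), (2, ⟨-1, 0, -1, 0⟩), (3, ⟨0, 1, 0, -1⟩)]⟩,
   ⟨1, 2, [(0, ⟨0, 0, 0, 0⟩), (1, ⟨1, 0, -1, 0⟩)], [(1, ⟨1, 0, -1, 0⟩), (2, ⟨0, -1, 0, 0⟩), (3, ⟨0,
      0, -1, -1⟩)], [(1, ⟨1, -1, 0, 0⟩), (3, ⟨0, 0, 0, -1⟩)]⟩,
   ⟨0, 1, [(0, ⟨0, 0, 0, 0⟩), (1, ⟨1, 0, 0, 0⟩)], [(1, ⟨0, 0, 0, 1⟩), (3, ⟨0, -1, 1, 1⟩)], [(1, ⟨0,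
      0, 1, 0⟩), (2, ⟨1, 0, 0, 0⟩), (3, ⟨0, -1, 0, 1⟩)]⟩,
   ⟨0, 3, [(0, ⟨0, 0, 0, 0⟩), (1, ⟨0, 0, 0, 1⟩)], [(1, ⟨0, 1, 0, 1⟩), (2, ⟨0, 0, 1, -1⟩), (3, ⟨1,
      0, 1, 1⟩)], [(1, ⟨0, 0, 1, 0⟩), (3, ⟨0, -1, 0, 0⟩)]⟩,
   ⟨1, 3, [(0, ⟨0, 0, 0, 0⟩), (2, ⟨-1, 0, 0, 1⟩)], [(1, ⟨0, 0, 0, 1⟩), (2, ⟨1, 0, 0, 0⟩), (2, ⟨0,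
      0, 1, 0⟩)], [(1, ⟨0, 0, -1, -1⟩), (3, ⟨0, 1, 1, 0⟩)]⟩,
   ⟨0, 2, [(0, ⟨0, 0, 0, 0⟩), (2, ⟨1, 0, 0, 0⟩)], [(1, ⟨0, 0, 0, 1⟩), (2, ⟨0, 1, 0, 0⟩), (2, ⟨1, 0,
      0, 1⟩)], [(1, ⟨1, 1, 0, 0⟩), (3, ⟨0, 1, 1, 0⟩)]⟩,
   ⟨0, 1, [(0, ⟨0, 0, 0, 0⟩), (3, ⟨0, -1, 1, 0⟩)], [(1, ⟨0, 0, 0, 1⟩), (2, ⟨0, 0, 0, 1⟩), (2, ⟨-1,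
      0, 0, 0⟩)], [(1, ⟨0, 0, 1, 0⟩), (2, ⟨-1, 0, 1, 0⟩)]⟩,
   ⟨0, 3, [(0, ⟨0, 0, 0, 0⟩), (3, ⟨0, 0, 1, -1⟩)], [(1, ⟨0, -1, 1, 0⟩), (2, ⟨0, -1, 0, 0⟩), (3,
      ⟨-1, 0, 0, 0⟩)], [(1, ⟨0, 0, 1, 0⟩)]⟩,
   ⟨1, 3, [(0, ⟨0, 0, 0, 0⟩), (1, ⟨0, -1, -1, 0⟩), (2, ⟨-1, -1, 0, 0⟩)], [(1, ⟨1, 0, -1, 0⟩)], [(1,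
      ⟨0, 0, 1, 0⟩), (2, ⟨-1, 0, 0, 0⟩), (3, ⟨1, 1, 0, 1⟩)]⟩,
   ⟨0, 1, [(0, ⟨0, 0, 0, 0⟩), (1, ⟨1, 0, 0, 0⟩)], [(1, ⟨0, 0, 0, 1⟩), (3, ⟨0, 1, 0, 1⟩)], [(1, ⟨0,
      0, 1, 0⟩), (2, ⟨-1, 0, 1, 0⟩), (3, ⟨0, 0, 1, 1⟩)]⟩,
   ⟨0, 3, [(0, ⟨0, 0, 0, 0⟩), (1, ⟨-1, 0, 1, 0⟩), (2, ⟨0, -1, 1, -1⟩)], [(1, ⟨0, 0, 0, 1⟩), (3, ⟨0,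
      1, 0, 0⟩)], [(1, ⟨0, 0, 1, 0⟩), (2, ⟨1, 0, 0, 0⟩)]⟩,
   ⟨2, 3, [(0, ⟨0, 0, 0, 0⟩), (2, ⟨1, 0, 0, 0⟩)], [(1, ⟨0, -1, 0, -1⟩), (2, ⟨0, 1, -1, 0⟩)], [(1,
      ⟨0, 0, 1, 0⟩), (2, ⟨0, 0, 1, -1⟩)]⟩,
   ⟨1, 2, [(0, ⟨0, 0, 0, 0⟩), (1, ⟨0, 0, 0, -1⟩), (2, ⟨0, 1, 1, 0⟩)], [(1, ⟨0, 0, 0, 1⟩), (3, ⟨-1,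
      1, -1, 0⟩)], [(1, ⟨0, 0, 1, 0⟩), (2, ⟨1, 0, 1, 0⟩)]⟩,
   ⟨0, 1, [(0, ⟨0, 0, 0, 0⟩), (1, ⟨0, 1, 0, 0⟩), (2, ⟨1, 0, 1, 0⟩)], [(1, ⟨0, 0, 0, 1⟩), (2, ⟨-1,
      0, 0, 1⟩)], [(1, ⟨0, 0, 1, 0⟩), (3, ⟨0, -1, 1, 1⟩)]⟩,
   ⟨1, 3, [(0, ⟨0, 0, 0, 0⟩), (1, ⟨-1, 0, 0, 0⟩), (3, ⟨0, 0, -1, 0⟩)], [(1, ⟨0, 1, 1, 0⟩)], [(1,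
      ⟨-1, 1, 0, 0⟩), (3, ⟨0, 0, 0, 1⟩)]⟩,
   ⟨0, 1, [(0, ⟨0, 0, 0, 0⟩), (2, ⟨1, 0, 0, 1⟩), (3, ⟨0, 1, 0, 0⟩)], [(1, ⟨0, 0, 0, 1⟩), (2, ⟨1,
      -1, 0, 0⟩)], [(1, ⟨0, 0, 1, 0⟩)]⟩,
   ⟨0, 2, [(0, ⟨0, 0, 0, 0⟩), (1, ⟨1, 0, 0, 1⟩), (3, ⟨0, 0, 1, 0⟩)], [(1, ⟨1, 0, 0, -1⟩)], [(1, ⟨0,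
      1, 0, 0⟩), (2, ⟨1, 0, 0, 0⟩), (2, ⟨0, 1, 0, 0⟩)]⟩,
   ⟨1, 2, [(0, ⟨0, 0, 0, 0⟩), (1, ⟨0, 0, -1, 0⟩), (2, ⟨1, 1, 0, 0⟩)], [(1, ⟨0, 0, 0, 1⟩), (2, ⟨0,
      1, 0, 0⟩)], [(1, ⟨1, -1, 0, 0⟩), (3, ⟨0, 0, 1, -1⟩)]⟩,
   ⟨1, 3, [(0, ⟨0, 0, 0, 0⟩), (1, ⟨-1, 0, 0, -1⟩), (2, ⟨0, 0, 0, 1⟩)], [(1, ⟨1, 0, 0, 0⟩), (3, ⟨0,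
      1, 0, -1⟩)], [(1, ⟨0, 0, 1, 0⟩), (2, ⟨1, 0, 1, 0⟩)]⟩,
   ⟨1, 3, [(0, ⟨0, 0, 0, 0⟩), (1, ⟨0, 0, 0, 1⟩)], [(1, ⟨1, 0, 0, 0⟩), (2, ⟨-1, 1, 1, 0⟩), (2, ⟨1,
      0, 1, 1⟩)], [(1, ⟨0, 0, 1, 0⟩), (3, ⟨0, 1, 0, -1⟩)]⟩,
   ⟨0, 3, [(0, ⟨0, 0, 0, 0⟩), (1, ⟨1, 0, -1, 0⟩)], [(1, ⟨0, 0, 0, 1⟩), (3, ⟨0, 1, -1, 0⟩)], [(1,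
      ⟨0, 0, 1, 0⟩), (2, ⟨1, -1, 0, 1⟩), (2, ⟨-1, 0, 0, 1⟩)]⟩,
   ⟨0, 2, [(0, ⟨0, 0, 0, 0⟩), (1, ⟨-1, 0, 0, 0⟩)], [(1, ⟨0, 0, 0, 1⟩), (3, ⟨1, 1, -1, 0⟩)], [(1,
      ⟨0, 0, 1, 0⟩), (2, ⟨0, -1, 0, 1⟩), (2, ⟨1, 1, 0, 0⟩)]⟩,
   ⟨0, 3, [(0, ⟨0, 0, 0, 0⟩), (1, ⟨0, 0, 1, 0⟩)], [(1, ⟨1, -1, 0, 0⟩), (2, ⟨-1, 0, 1, 0⟩)], [(1,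
      ⟨0, 0, 1, 0⟩), (2, ⟨0, -1, 0, 0⟩), (3, ⟨0, 0, 0, 1⟩)]⟩,
   ⟨2, 3, [(0, ⟨0, 0, 0, 0⟩), (1, ⟨1, 0, -1, 0⟩)], [(1, ⟨0, 0, 0, 1⟩), (2, ⟨0, 0, 1, -1⟩), (2, ⟨0,
      1, 1, 0⟩)], [(1, ⟨-1, 0, 0, 0⟩), (3, ⟨1, 1, 0, 0⟩)]⟩,
   ⟨0, 3, [(0, ⟨0, 0, 0, 0⟩), (2, ⟨0, 1, 0, 1⟩)], [(1, ⟨0, 0, 0, 1⟩), (2, ⟨0, 0, 1, 0⟩), (2, ⟨-1,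
      0, 0, 1⟩)], [(1, ⟨0, 1, 1, 0⟩), (2, ⟨0, 1, 0, 0⟩), (2, ⟨-1, 0, 0, 0⟩)]⟩,
   ⟨1, 3, [(0, ⟨0, 0, 0, 0⟩), (1, ⟨-1, 0, 0, 0⟩)], [(1, ⟨0, 0, 0, 1⟩), (2, ⟨0, -1, 1, 0⟩), (2, ⟨0,
      1, 0, 1⟩), (3, ⟨1, 0, 0, 0⟩)], [(1, ⟨0, 0, 1, 0⟩), (2, ⟨0, 1, 0, 0⟩)]⟩,
   ⟨0, 1, [(0, ⟨0, 0, 0, 0⟩), (1, ⟨0, 1, 0, 0⟩)], [(1, ⟨0, 0, 0, 1⟩), (2, ⟨0, 0, 0, 1⟩), (2, ⟨0,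
      -1, 1, 0⟩)], [(1, ⟨0, 0, 1, 0⟩), (2, ⟨0, 1, 0, 0⟩), (3, ⟨-1, 0, 0, 0⟩)]⟩,
   ⟨0, 1, [(0, ⟨0, 0, 0, 0⟩), (2, ⟨0, 1, -1, 0⟩)], [(1, ⟨0, 0, 0, 1⟩), (2, ⟨-1, 0, 0, 1⟩), (2, ⟨1,
      0, 0, 1⟩)], [(1, ⟨0, 0, 1, 0⟩), (2, ⟨1, -1, 0, 0⟩), (2, ⟨0, 1, 1, 0⟩)]⟩]

theorem triangular_cocycle : triangular 3 (-1) ((List.finRange 7).map fun k =>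
    combinationRows (ofCodes (cocycleCodes k))) cocycleSamples [] = true := by
  decide +kernel

theorem triangular_complement : triangular 4 1 (complementCodes.map fun k =>
    schoutenSum 1 (graphRows (ofCode k))) complementSamples [] = true := by
  decide +kernel

theorem cocycleSamples_diagonal : ∀ p ∈ cocycleSamples, p.j = p.i := by decide

theorem linearIndependent_cocycle : LinearIndependent ℝ cocycle := by
  rw [Fintype.linearIndependent_iff]
  intro c hc k
  have h := triangular_independent (.inl rfl) (ε := -1) (l := (List.finRange 7).map fun k =>
    (c k, combinationRows (ofCodes (cocycleCodes k)))) (ps := cocycleSamples) (qs := [])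
    (by rw [List.map_map]; exact triangular_cocycle) (fun p hp => ?_)
  · exact h _ (List.mem_map_of_mem (List.mem_finRange k))
  · have := congrFun (congrFun (congrFun (congrFun (congrFun hc (jetSmooth p.r))
      (jetSmooth p.a)) (jetSmooth p.b)) 0) p.i
    have e : ∀ k, (c k • cocycle k) (jetSmooth p.r) (jetSmooth p.a) (jetSmooth p.b) 0 p.i =
        1 / 2 * (c k * evalSample 3 (-1) p (combinationRows (ofCodes (cocycleCodes k)))) := by
      intro k
      change c k * cocycle k _ _ _ 0 p.i = _
      rw [cocycle, combination_apply (sinkFirst_cocycleCodes k), evalSample,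
        cocycleSamples_diagonal p hp]
      simp only [jetSmooth]
      ring
    simp only [Finset.sum_apply, e, ← Finset.mul_sum] at this
    rw [List.map_map, ← Fin.sum_univ_def]
    simpa using this

theorem sinkFirst_complementCodes : ∀ k ∈ complementCodes, SinkFirst (ofCode k) := by
  decide +kernel

theorem complement_eq_zero {X : FieldFormula} (hX : X ∈ Submodule.span ℝ (Set.range complement))
    (h : IsOneCocycle X) : X = 0 := by
  obtain ⟨c, rfl⟩ := (Submodule.mem_span_range_iff_exists_fun ℝ).1 hX
  have hG : ∀ k, SinkFirst (ofCode (complementCodes.get k)) := fun k =>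
    sinkFirst_complementCodes _ (List.get_mem _ _)
  have h := triangular_independent (.inr rfl) (ε := 1)
    (l := (List.finRange complementCodes.length).map fun k =>
      (c k, schoutenSum 1 (graphRows (ofCode (complementCodes.get k)))))
    (ps := complementSamples) (qs := []) ?_ (fun p hp => ?_)
  · refine Finset.sum_eq_zero fun k _ => ?_
    rw [show c k = 0 from h _ (List.mem_map_of_mem (List.mem_finRange k)), zero_smul]
  · rw [List.map_map]
    have := List.map_map (l := List.finRange complementCodes.length)
      (f := complementCodes.get) (g := fun k => schoutenSum 1 (graphRows (ofCode k)))
    rw [List.map_get_finRange] at this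
    rw [← triangular_complement, this]
    rfl
  · have := congrFun (congrFun (congrFun (h (jetSmooth p.r) (jetSmooth p.a) (jetSmooth p.b)) 0)
      p.i) p.j
    have e : ∀ P : BivectorField, ∀ s : Finset (Fin complementCodes.length),
        SmoothField ((∑ k ∈ s, c k • complement k) (jetSmooth p.r) (jetSmooth p.a)
          (jetSmooth p.b)) ∧
        schouten P ((∑ k ∈ s, c k • complement k) (jetSmooth p.r) (jetSmooth p.a)
          (jetSmooth p.b)) = ∑ k ∈ s, c k • schouten P (complement k (jetSmooth p.r)
            (jetSmooth p.a) (jetSmooth p.b)) := by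
      intro P s
      induction s using Finset.induction_on with
      | empty => exact ⟨smoothField_zero, schouten_zero P⟩
      | insert k s hk ih =>
        have hs : SmoothField (complement k (jetSmooth p.r) (jetSmooth p.a) (jetSmooth p.b)) :=
          smoothField_skewPair (hG k) _ _ _
        rw [Finset.sum_insert hk, Finset.sum_insert hk]
        refine ⟨(hs.smul (c k)).add ih.1, ?_⟩
        rw [← ih.2, ← schouten_smul P hs]
        exact schouten_add P (hs.smul (c k)) ih.1
    have e' : ∀ k, (c k • schouten (nambu (jetSmooth p.r).1 (jetSmooth p.a).1 (jetSmooth p.b).1)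
        (complement k (jetSmooth p.r) (jetSmooth p.a) (jetSmooth p.b))) 0 p.i p.j =
        1 / 2 * (c k * evalSample 4 1 p
          (schoutenSum 1 (graphRows (ofCode (complementCodes.get k))))) := by
      intro k
      have h₁ := schouten_skewPair (hG k) (jetSmooth p.r) (jetSmooth p.a) (jetSmooth p.b) 0 p.i
        p.j 1
      rw [Int.cast_one, one_mul] at h₁
      change c k * schouten _ (skewPair _ _ _ _) 0 p.i p.j = _
      rw [h₁, evalSample]
      simp only [jetSmooth]
      ring
    rw [(e _ Finset.univ).2] at this
    simp only [Finset.sum_apply, e', ← Finset.mul_sum] at this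
    rw [List.map_map, ← Fin.sum_univ_def]
    simpa using this


/-! ### The affine space of solutions -/

theorem solutionData_subset : ∀ p ∈ solutionData, p.2 ∈ descendants := by
  simp only [mem_descendants]
  decide +kernel

theorem cocycleCodes_subset (k : Fin 7) :
    ∀ p ∈ ofCodes (cocycleCodes k), p.2 ∈ descendants := by
  have h : ∀ k, ((cocycleCodes k).all fun p => descendantCodes.any (Nat.beq p.2)) = true := by
    decide +kernel
  intro p hp
  obtain ⟨q, hq, rfl⟩ := List.mem_map.1 hp
  exact mem_descendants_iff.2 ⟨q.2, mem_of_any (List.all_eq_true.1 (h k) q hq), rfl⟩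

theorem skewPair_mem_ansatz {G : Graph} (hG : G ∈ descendants) : skewPair G ∈ ansatz :=
  Submodule.subset_span ⟨G, hG, rfl⟩

theorem solution_mem_ansatz : solution ∈ ansatz :=
  combination_mem fun p hp => skewPair_mem_ansatz (solutionData_subset p hp)

theorem sinkFirst_descendants {G : Graph} (hG : G ∈ descendants) : SinkFirst G := by
  have h : (descendantList.all fun G => decide (SinkFirst G)) = true := by decide +kernel
  exact of_decide_eq_true (List.all_eq_true.1 h G (mem_descendants.1 hG))

theorem ansatz_le_smoothFormulas : ansatz ≤ smoothFormulas := by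
  refine Submodule.span_le.2 ?_
  rintro _ ⟨G, hG, rfl⟩
  exact skewPair_mem_smoothFormulas (sinkFirst_descendants hG)

theorem IsOneCocycle.add {X Y : FieldFormula} (hX : IsOneCocycle X) (hY : IsOneCocycle Y)
    (hX' : X ∈ smoothFormulas) (hY' : Y ∈ smoothFormulas) : IsOneCocycle (X + Y) := by
  intro r a b
  change schouten _ (X r a b + Y r a b) = 0
  rw [schouten_add _ (hX' r a b) (hY' r a b), hX, hY, add_zero]

theorem IsOneCocycle.smul {X : FieldFormula} (hX : IsOneCocycle X) (hX' : X ∈ smoothFormulas)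
    (c : ℝ) : IsOneCocycle (c • X) := by
  intro r a b
  change schouten _ (c • X r a b) = 0
  rw [schouten_smul _ (hX' r a b), hX, smul_zero]

theorem isOneCocycle_sub {X Y : FieldFormula} (hX' : X ∈ smoothFormulas)
    (hY' : Y ∈ smoothFormulas) (hX : Trivialises X) : IsOneCocycle (Y - X) ↔ Trivialises Y := by
  refine forall_congr' fun r => forall_congr' fun a => forall_congr' fun b => ?_
  have h : (Y - X) r a b = Y r a b + (-1 : ℝ) • X r a b := by
    rw [neg_one_smul, ← sub_eq_add_neg]
    rfl
  rw [h, schouten_add _ (hY' r a b) ((hX' r a b).smul _), schouten_smul _ (hX' r a b), hX r a b,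
    neg_one_smul, ← sub_eq_add_neg, sub_eq_zero]

/-- The cocycles in the ansatz, as a space with a given basis. -/
def cocycleSpace : Submodule ℝ FieldFormula := Submodule.span ℝ (Set.range cocycle)

theorem finrank_cocycleSpace : Module.finrank ℝ cocycleSpace = 7 :=
  finrank_span_eq_card linearIndependent_cocycle

theorem cocycleSpace_le_ansatz : cocycleSpace ≤ ansatz := by
  refine Submodule.span_le.2 ?_
  rintro _ ⟨k, rfl⟩
  exact combination_mem fun p hp => skewPair_mem_ansatz (cocycleCodes_subset k p hp)

theorem isOneCocycle_of_mem {Y : FieldFormula} (hY : Y ∈ cocycleSpace) : IsOneCocycle Y := by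
  have h : ∀ X ∈ cocycleSpace, X ∈ smoothFormulas := fun X hX =>
    ansatz_le_smoothFormulas (cocycleSpace_le_ansatz hX)
  induction hY using Submodule.span_induction with
  | mem X hX =>
    obtain ⟨k, rfl⟩ := hX
    exact isOneCocycle_cocycle k
  | zero => exact fun r a b => schouten_zero _
  | add X Y hX hY ihX ihY => exact ihX.add ihY (h X hX) (h Y hY)
  | smul c X hX ih => exact ih.smul (h X hX) c

theorem mem_cocycleSpace {Y : FieldFormula} :
    Y ∈ cocycleSpace ↔ Y ∈ ansatz ∧ IsOneCocycle Y := by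
  refine ⟨fun hY => ⟨cocycleSpace_le_ansatz hY, isOneCocycle_of_mem hY⟩, fun ⟨hY, h⟩ => ?_⟩
  obtain ⟨k, hk, X, hX, rfl⟩ := Submodule.mem_sup.1 (ansatz_le hY)
  have hkA := cocycleSpace_le_ansatz hk
  have e : X = (k + X) + (-1 : ℝ) • k := by rw [neg_one_smul]; abel
  have hc : IsOneCocycle X := by
    rw [e]
    exact h.add ((isOneCocycle_of_mem hk).smul (ansatz_le_smoothFormulas hkA) _)
      (ansatz_le_smoothFormulas hY) (smoothFormulas.smul_mem _ (ansatz_le_smoothFormulas hkA))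
  rw [complement_eq_zero hX hc, add_zero]
  exact hk

theorem contDiff_solution (r a b : Smooth) : ContDiff ℝ ∞ (solution r a b) :=
  contDiff_pi.2 (ansatz_le_smoothFormulas solution_mem_ansatz r a b)

end NambuFlow

end

theorem proposition3 :
    (∀ r a b : NambuFlow.Smooth, ContDiff ℝ ∞ (NambuFlow.solution r a b)) ∧
    NambuFlow.Trivialises NambuFlow.solution ∧
    (∀ p ∈ NambuFlow.solutionData, p.2 ∈ NambuFlow.descendants) ∧
    ∃ K : Submodule ℝ NambuFlow.FieldFormula,
      Module.finrank ℝ K = 7 ∧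
      (∀ Y : NambuFlow.FieldFormula,
        Y ∈ K ↔ Y ∈ NambuFlow.ansatz ∧ NambuFlow.IsOneCocycle Y) ∧
      (∀ Y : NambuFlow.FieldFormula,
        (Y ∈ NambuFlow.ansatz ∧ NambuFlow.Trivialises Y) ↔ Y - NambuFlow.solution ∈ K) := by
  refine ⟨NambuFlow.contDiff_solution, NambuFlow.trivialises_solution,
    NambuFlow.solutionData_subset, NambuFlow.cocycleSpace, NambuFlow.finrank_cocycleSpace,
    fun Y => NambuFlow.mem_cocycleSpace, fun Y => ?_⟩
  have hX := NambuFlow.solution_mem_ansatz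
  rw [NambuFlow.mem_cocycleSpace, NambuFlow.ansatz.sub_mem_iff_left hX]
  refine and_congr_right fun hY => (NambuFlow.isOneCocycle_sub
    (NambuFlow.ansatz_le_smoothFormulas hX) (NambuFlow.ansatz_le_smoothFormulas hY)
    NambuFlow.trivialises_solution).symm
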